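/- Let $R$ be a commutative ring with unit in which $2$ is not a zero divisor, and let $\mathfrak g$ be an $R$-Lie algebra whose underlying $R$-module is projective. Let $C\mathfrak g=s\mathfrak g\oplus\mathfrak g$ be the cone of $\mathfrak g$, the differential graded Lie algebra with $\mathfrak g$ in degree $0$ and $s\mathfrak g$ in degree $1$, differential $sx\mapsto x$, and brackets $[x,y]$ as in $\mathfrak g$, $[sx,y]=[x,sy]=s[x,y]$, $[sx,sy]=0$. Let $\Lambda=\Lambda[s\mathfrak g]$ be the exterior Hopf algebra on $s\mathfrak g$ (degree $1$), $\Lambda'$ its underlying coalgebra, $I\Lambda$ its augmentation ideal, and $\bar w\in I\Lambda$ the image of $w\in \Lambda$ under the projection along the unit. Let $\partial\colon\Lambda'\to\Lambda'$ be the Chevalley–Eilenberg coderivation, with component $sx_1\,sx_2\mapsto s[x_2,x_1]$ in $s\mathfrak g$, and let $\tau_{\mathfrak g}\colon\Lambda'\to\mathfrak g$ be $sx\mapsto x$, zero off degree $1$. Let $\mathrm S'=\mathrm S'[s^2\mathfrak g]$ be the symmetric coalgebra on $s^2\mathfrak g$ (degree $2$), and let $\tau^{\mathrm S}\colon \mathrm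 S'\to\Lambda$ be the twisting cochain $s^2x\mapsto sx$, zero off degree $2$. Let $\mathrm T'=\mathrm T'[sI\Lambda]$ be the tensor coalgebra on $sI\Lambda$. The Lie algebra $\mathfrak g$ acts on $\mathrm S'$, $\Lambda$ and $\mathrm T'$ from the right by derivations, through $x\cdot Y=[x,Y]$ on generators. We write $c\mapsto\sum c'\otimes c''$ for diagonals. (i) The Weil coalgebra $W'[\mathfrak g]=\mathrm S'[s^2\mathfrak g]\otimes\Lambda'[s\mathfrak g]$, with the tensor product coalgebra structure and the differential $$D(c\otimes a)=-\sum c'\otimes\tau^{\mathrm S}(c'')\,a+c\otimes\partial a+\sum \bigl(c\cdot\tau_{\mathfrak g}(a')\bigr)\otimes a'',$$ is a differential graded coalgebra. The differential is that of the Chevalley–Eilenberg coalgebra of $C\mathfrak g$: the projection $\tau$ of $W'[\mathfrak g]=\mathrm S'[sC\mathfrak g]$ to $sC\mathfrak g$, followed by the desuspension, satisfies $2(d\tau+\tau D)=[\tau,\tau]$ for the cup bracket, $d$ being the differential of $C\mathfrak g$. With the right actions $(c\otimes a)\cdot Y=c\cdot Y\otimes a+c\otimes a\cdot Y$ and $(c\otimes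 a)\cdot sY=c\otimes a\,(sY)$, $W'[\mathfrak g]$ is a differential graded right $(C\mathfrak g)$-module. (ii) Let $\mathrm B\Lambda_\partial[s\mathfrak g]$ be $\mathrm T'[sI\Lambda]\otimes\Lambda'[s\mathfrak g]$ with the differential $$D(m\otimes a)=(dm+\partial m)\otimes a-\sum(-1)^{|m'|}m'\otimes\tau^{\overline{\mathrm B}}(m'')\,a+(-1)^{|m|}\Bigl(m\otimes\partial a+\sum\bigl(m\cdot\tau_{\mathfrak g}(a')\bigr)\otimes a''\Bigr).$$ Here $\tau^{\overline{\mathrm B}}\colon\mathrm T'\to\Lambda$ is $sw\mapsto w$, zero off words of length $1$; $d$ is the bar differential, the coderivation with $d(sv\otimes sw)=(-1)^{|v|+1}s(vw)$; and $\partial$ on $\mathrm T'$, the perturbation determined by the Lie bracket, is given by $\partial 1=0$ and $$\partial(m\cdot sw)=(\partial m)\cdot sw-(-1)^{|m|}\Bigl(m\cdot s(\partial w)+\sum \bigl(m\cdot\tau_{\mathfrak g}(w')\bigr)\cdot s\overline{w''}\Bigr).$$ The tensor product diagonal $\Delta_\otimes$ and counit make $\mathrm B\Lambda_\partial[s\mathfrak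 g]$ into a graded coalgebra. The diagonal $\Delta$ that arises from the simplicial coalgebra structure of the relative bar resolution through the Alexander–Whitney map, together with the same counit and with $D$, makes it into a differential graded coalgebra. Explicitly, $\Delta(1\otimes 1)=(1\otimes 1)\otimes(1\otimes 1)$; $\Delta(b\,a)=\Delta(b)\,a$ for $a\in\Lambda$ acting by right multiplication and, on the right-hand side, diagonally; and $\Delta(hb)=hb\otimes(1\otimes 1)+(\mathrm{Id}\otimes h)\Delta(b)$ for $b=m\otimes w$ with $m\in \mathrm T'$ and $w\in I\Lambda$, where $h(m\otimes a)=(-1)^{|m|}(m\cdot s\bar a)\otimes1$. With the right actions given by the formulas in (i), with $m\in\mathrm T'$ in place of $c$, $\mathrm B\Lambda_\partial[s\mathfrak g]$ is a differential graded right $(C\mathfrak g)$-module. (iii) Let $\overline{\tau^{\mathrm S}}\colon\mathrm S'\to\mathrm T'$ be the adjoint of $\tau^{\mathrm S}$, $c\mapsto\sum_{n}\sum s\tau^{\mathrm S}(c_1)\otimes\cdots\otimes s\tau^{\mathrm S}(c_n)$ (the inner sum being the $n$-fold iterated diagonal), and let $$\iota=\overline{\tau^{\mathrm S}}\otimes\mathrm{Id}\colon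 W'[\mathfrak g]\longrightarrow\mathrm B\Lambda_\partial[s\mathfrak g].$$ Then $\iota$ preserves degrees, commutes with the counits and with the differentials, and is compatible with the diagonal of $W'[\mathfrak g]$ and each of the diagonals $\Delta_\otimes$ and $\Delta$ of $\mathrm B\Lambda_\partial[s\mathfrak g]$. In particular $\iota$ is a morphism of differential graded coalgebras. (iv) $\iota$ is compatible with the right $(C\mathfrak g)$-module structures: it commutes with the actions of all $Y\in\mathfrak g$ and all $sY\in s\mathfrak g$. -/

import Mathlib

open scoped TensorProduct

noncomputable section

namespace WeilBar

/-!
Conventions.  For an `R`-Lie algebra `g`: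

* `ExteriorAlgebra R g` is the exterior algebra `Λ[sg]`, the generator `ι x` being `sx`
  (degree `1`); with the diagonal `extComul` it is the exterior coalgebra `Λ'[sg]`.
* `DividedPowerAlgebra R g` with the diagonal `symComul` is the symmetric coalgebra `S'[s²g]`
  (for projective `g` it is the coalgebra of symmetric tensors, the divided power `dp n x`
  being the symmetric tensor `s²x ⊗ ⋯ ⊗ s²x`); the generator `dp 1 x` is `s²x` (degree `2`).
* `TensorAlgebra R (AugIdeal R g)` with the deconcatenation `barDeconc` is the tensor coalgebra
  `T'[sIΛ[sg]]`; the letter `ι w` stands for `sw`, of degree `|w| + 1`.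
* The cone `Cg = sg ⊕ g` is `g × g`, first component in degree `1`, second in degree `0`.
-/

/-! ### Generalities -/

section General

variable {R : Type*} [CommRing R]

/-- `φ ↦ (a ↦ ∑ φ(a') a'')`. -/
def conv {A : Type*} [Ring A] [Algebra R A] (Δ : A →ₗ[R] A ⊗[R] A) :
    (A →ₗ[R] A) →ₗ[R] (A →ₗ[R] A) where
  toFun φ := LinearMap.mul' R A ∘ₗ LinearMap.rTensor A φ ∘ₗ Δ
  map_add' φ ψ := by
    ext a
    simp [LinearMap.rTensor_add]
  map_smul' r φ := by
    ext a
    simp [LinearMap.rTensor_smul]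

variable {M : Type*} [AddCommGroup M] [Module R M]

/-- One step of the recursion below. -/
def tensorRecStep {Y : Type*} [AddCommGroup Y] [Module R Y]
    (Φ : TensorAlgebra R M →ₗ[R] M →ₗ[R] Y) (Ψ : Y →ₗ[R] M →ₗ[R] Y) :
    (TensorAlgebra R M × Y) →ₗ[R] M →ₗ[R] (TensorAlgebra R M × Y) :=
  LinearMap.mk₂ R (fun p x => (p.1 * TensorAlgebra.ι R x, Φ p.1 x + Ψ p.2 x))
    (by intro p q x; ext <;> simp [add_mul]; abel)
    (by intro r p x; ext <;> simp)
    (by intro p x y; ext <;> simp [mul_add]; abel)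
    (by intro r p x; ext <;> simp)

/-- The recursion as an operation of the tensor algebra on pairs, from the right. -/
def tensorRecPair {Y : Type*} [AddCommGroup Y] [Module R Y]
    (y₀ : Y) (Φ : TensorAlgebra R M →ₗ[R] M →ₗ[R] Y) (Ψ : Y →ₗ[R] M →ₗ[R] Y) :
    TensorAlgebra R M →ₗ[R] (TensorAlgebra R M × Y) :=
  LinearMap.applyₗ ((1, y₀) : TensorAlgebra R M × Y) ∘ₗ
    (MulOpposite.opLinearEquiv R :
      Module.End R (TensorAlgebra R M × Y) ≃ₗ[R] _).symm.toLinearMap ∘ₗ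
    (TensorAlgebra.lift R ((MulOpposite.opLinearEquiv R :
      Module.End R (TensorAlgebra R M × Y) ≃ₗ[R] _).toLinearMap ∘ₗ
        (tensorRecStep Φ Ψ).flip)).toLinearMap

/-- The linear map `F` on the tensor algebra determined by recursion on the last letter:
`F 1 = y₀` and `F (m x) = Φ m x + Ψ (F m) x`. -/
def tensorRec {Y : Type*} [AddCommGroup Y] [Module R Y]
    (y₀ : Y) (Φ : TensorAlgebra R M →ₗ[R] M →ₗ[R] Y) (Ψ : Y →ₗ[R] M →ₗ[R] Y) :
    TensorAlgebra R M →ₗ[R] Y :=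
  LinearMap.snd R _ _ ∘ₗ tensorRecPair y₀ Φ Ψ

theorem tensorRecPair_one {Y : Type*} [AddCommGroup Y] [Module R Y]
    (y₀ : Y) (Φ : TensorAlgebra R M →ₗ[R] M →ₗ[R] Y) (Ψ : Y →ₗ[R] M →ₗ[R] Y) :
    tensorRecPair y₀ Φ Ψ 1 = (1, y₀) := by
  simp [tensorRecPair]

theorem tensorRecPair_mul_ι {Y : Type*} [AddCommGroup Y] [Module R Y]
    (y₀ : Y) (Φ : TensorAlgebra R M →ₗ[R] M →ₗ[R] Y) (Ψ : Y →ₗ[R] M →ₗ[R] Y)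
    (m : TensorAlgebra R M) (x : M) :
    tensorRecPair y₀ Φ Ψ (m * TensorAlgebra.ι R x) =
      tensorRecStep Φ Ψ (tensorRecPair y₀ Φ Ψ m) x := by
  simp [tensorRecPair]

theorem tensorRecPair_fst {Y : Type*} [AddCommGroup Y] [Module R Y]
    (y₀ : Y) (Φ : TensorAlgebra R M →ₗ[R] M →ₗ[R] Y) (Ψ : Y →ₗ[R] M →ₗ[R] Y)
    (m : TensorAlgebra R M) : (tensorRecPair y₀ Φ Ψ m).1 = m := by
  have key : ∀ (a : TensorAlgebra R M) (p : TensorAlgebra R M × Y),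
      ((MulOpposite.unop (TensorAlgebra.lift R ((MulOpposite.opLinearEquiv R :
        Module.End R (TensorAlgebra R M × Y) ≃ₗ[R] _).toLinearMap ∘ₗ
          (tensorRecStep Φ Ψ).flip) a)) p).1 = p.1 * a := by
    intro a
    induction a using TensorAlgebra.induction with
    | algebraMap r =>
      intro p
      simp [Algebra.algebraMap_eq_smul_one]
    | ι x =>
      intro p
      simp [tensorRecStep]
    | mul a b ha hb =>
      intro p
      rw [map_mul, MulOpposite.unop_mul, Module.End.mul_apply, hb, ha, mul_assoc]
    | add a b ha hb =>
      intro p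
      rw [map_add, MulOpposite.unop_add, LinearMap.add_apply, Prod.fst_add, ha, hb, mul_add]
  simpa [tensorRecPair] using key m (1, y₀)

theorem tensorRec_one {Y : Type*} [AddCommGroup Y] [Module R Y]
    (y₀ : Y) (Φ : TensorAlgebra R M →ₗ[R] M →ₗ[R] Y) (Ψ : Y →ₗ[R] M →ₗ[R] Y) :
    tensorRec y₀ Φ Ψ 1 = y₀ := by
  simp [tensorRec, tensorRecPair_one]

theorem tensorRec_mul_ι {Y : Type*} [AddCommGroup Y] [Module R Y]
    (y₀ : Y) (Φ : TensorAlgebra R M →ₗ[R] M →ₗ[R] Y) (Ψ : Y →ₗ[R] M →ₗ[R] Y)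
    (m : TensorAlgebra R M) (x : M) :
    tensorRec y₀ Φ Ψ (m * TensorAlgebra.ι R x) = Φ m x + Ψ (tensorRec y₀ Φ Ψ m) x := by
  have h := tensorRecPair_fst y₀ Φ Ψ m
  simp only [tensorRec, LinearMap.comp_apply, tensorRecPair_mul_ι]
  simp [tensorRecStep, h]

end General

/-! ### The exterior algebra `Λ = Λ[sg]` and its coalgebra structure -/

section Exterior

variable (R : Type*) [CommRing R] (g : Type*) [LieRing g] [LieAlgebra R g]

/-- The Lie bracket as a bilinear map. -/
def lieBilin : g →ₗ[R] g →ₗ[R] g :=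
  LinearMap.mk₂ R (fun x y => ⁅x, y⁆) (by simp) (by simp) (by simp) (by simp)

/-- The sign operator `a ↦ (-1)^|a| a` of `Λ`. -/
def extSign : ExteriorAlgebra R g →ₗ[R] ExteriorAlgebra R g :=
  (ExteriorAlgebra.map (-LinearMap.id : g →ₗ[R] g)).toLinearMap

theorem extSign_ι_mul (v : g) (a : ExteriorAlgebra R g) :
    extSign R g (ExteriorAlgebra.ι R v * a) = -(ExteriorAlgebra.ι R v * extSign R g a) := by
  simp [extSign]

theorem extSign_mul_ι (v : g) (a : ExteriorAlgebra R g) :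
    extSign R g (a * ExteriorAlgebra.ι R v) = -(extSign R g a * ExteriorAlgebra.ι R v) := by
  simp [extSign]

/-- Left multiplication by the element `v ⊗ 1 + 1 ⊗ v` of the graded tensor product algebra
`Λ ⊗ Λ`: `a ⊗ b ↦ v a ⊗ b + (-1)^|a| a ⊗ v b`. -/
def extComulStep :
    g →ₗ[R] Module.End R (ExteriorAlgebra R g ⊗[R] ExteriorAlgebra R g) where
  toFun v := LinearMap.rTensor _ (LinearMap.mulLeft R (ExteriorAlgebra.ι R v)) +
    TensorProduct.map (extSign R g) (LinearMap.mulLeft R (ExteriorAlgebra.ι R v))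
  map_add' v w := by
    refine TensorProduct.ext' fun a b => ?_
    simp [add_mul, TensorProduct.add_tmul, TensorProduct.tmul_add]
    abel
  map_smul' r v := by
    refine TensorProduct.ext' fun a b => ?_
    simp [TensorProduct.smul_tmul']

theorem extComulStep_sq (v : g) : extComulStep R g v * extComulStep R g v = 0 := by
  refine TensorProduct.ext' fun a b => ?_
  simp [extComulStep, ← mul_assoc, extSign_ι_mul, TensorProduct.neg_tmul]

/-- The diagonal of `Λ`: the morphism of algebras from `Λ` to the graded tensor product algebra
`Λ ⊗ Λ` with `v ↦ v ⊗ 1 + 1 ⊗ v` for `v` in `sg`. -/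
def extComul : ExteriorAlgebra R g →ₗ[R] ExteriorAlgebra R g ⊗[R] ExteriorAlgebra R g :=
  LinearMap.applyₗ ((1 : ExteriorAlgebra R g) ⊗ₜ[R] (1 : ExteriorAlgebra R g)) ∘ₗ
    (ExteriorAlgebra.lift R ⟨extComulStep R g, extComulStep_sq R g⟩).toLinearMap

/-- The counit (augmentation) of `Λ`. -/
def extCounit : ExteriorAlgebra R g →ₗ[R] R :=
  (ExteriorAlgebra.algebraMapInv : ExteriorAlgebra R g →ₐ[R] R).toLinearMap

/-- The right action of `g` on `Λ[sg]` induced by the adjoint action, `b · Y = -ad_Y b`: the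
derivation extending `sx · Y = s[x, Y]`. -/
def extAct : g →ₗ[R] ExteriorAlgebra R g →ₗ[R] ExteriorAlgebra R g where
  toFun Y := conv (extComul R g)
    (ExteriorAlgebra.ι R ∘ₗ (lieBilin R g).flip Y ∘ₗ ExteriorAlgebra.ιInv)
  map_add' Y Z := by
    simp only [map_add, LinearMap.add_comp, LinearMap.comp_add]
  map_smul' r Y := by
    simp only [map_smul, LinearMap.smul_comp, LinearMap.comp_smul, RingHom.id_apply]

/-- The alternating map `(sx₁, sx₂) ↦ s[x₂, x₁]`. -/
def brAlt : g [⋀^Fin 2]→ₗ[R] ExteriorAlgebra R g where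
  toFun v := ExteriorAlgebra.ι R ⁅v 1, v 0⁆
  map_update_add' := by
    intro _ v i x y
    fin_cases i <;> simp [Function.update]
  map_update_smul' := by
    intro _ v i r x
    fin_cases i <;> simp [Function.update]
  map_eq_zero_of_eq' := by
    intro v i j h hij
    fin_cases i <;> fin_cases j <;> simp_all

/-- The Chevalley--Eilenberg differential `∂` of `Λ'_∂[sg]`: the coderivation of `Λ'[sg]` whose
component `Λ' → sg` is `sx₁ sx₂ ↦ s[x₂, x₁]` and zero off `Λ'_2`. -/
def extBoundary : ExteriorAlgebra R g →ₗ[R] ExteriorAlgebra R g :=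
  conv (extComul R g)
    (ExteriorAlgebra.liftAlternating
      (Pi.single (M := fun i : ℕ => g [⋀^Fin i]→ₗ[R] ExteriorAlgebra R g) 2 (brAlt R g)))

/-- The augmentation ideal `IΛ`. -/
abbrev AugIdeal : Type _ := ↥(LinearMap.ker (extCounit R g))

/-- The projection `Λ → IΛ` along the unit. -/
def augProj : ExteriorAlgebra R g →ₗ[R] AugIdeal R g :=
  LinearMap.codRestrict _
    (LinearMap.id - Algebra.linearMap R (ExteriorAlgebra R g) ∘ₗ extCounit R g)
    (by intro a; simp [extCounit])

end Exterior

/-! ### The symmetric coalgebra `S' = S'[s²g]` -/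

section Symmetric

variable (R : Type*) [CommRing R] (g : Type*) [AddCommGroup g] [Module R g]

/-- The values of the diagonal on the divided powers, `∑_{i+j=n} dp i x ⊗ dp j x`. -/
def symComulFun (p : ℕ × g) : DividedPowerAlgebra R g ⊗[R] DividedPowerAlgebra R g :=
  ∑ k ∈ Finset.HasAntidiagonal.antidiagonal p.1,
    DividedPowerAlgebra.dp R k.1 p.2 ⊗ₜ[R] DividedPowerAlgebra.dp R k.2 p.2

theorem antidiagonal_mul_mul {A : Type*} [CommSemiring A] (n : ℕ) (a b c d : ℕ → A) :
    ∑ k ∈ Finset.HasAntidiagonal.antidiagonal n,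
      (∑ i ∈ Finset.HasAntidiagonal.antidiagonal k.1, a i.1 * b i.2) *
        (∑ i ∈ Finset.HasAntidiagonal.antidiagonal k.2, c i.1 * d i.2) =
    ∑ k ∈ Finset.HasAntidiagonal.antidiagonal n,
      (∑ i ∈ Finset.HasAntidiagonal.antidiagonal k.1, a i.1 * c i.2) *
        (∑ i ∈ Finset.HasAntidiagonal.antidiagonal k.2, b i.1 * d i.2) := by
  have h := congrArg (PowerSeries.coeff n)
    (mul_mul_mul_comm (PowerSeries.mk a) (PowerSeries.mk b) (PowerSeries.mk c) (PowerSeries.mk d))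
  simpa [PowerSeries.coeff_mul] using h

theorem symComulFun_add (n : ℕ) (x y : g) :
    symComulFun R g (n, x + y) =
      ∑ k ∈ Finset.HasAntidiagonal.antidiagonal n,
        symComulFun R g (k.1, x) * symComulFun R g (k.2, y) := by
  have h := antidiagonal_mul_mul n
    (fun i => DividedPowerAlgebra.dp R i x ⊗ₜ[R] (1 : DividedPowerAlgebra R g))
    (fun i => DividedPowerAlgebra.dp R i y ⊗ₜ[R] (1 : DividedPowerAlgebra R g))
    (fun i => (1 : DividedPowerAlgebra R g) ⊗ₜ[R] DividedPowerAlgebra.dp R i x)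
    (fun i => (1 : DividedPowerAlgebra R g) ⊗ₜ[R] DividedPowerAlgebra.dp R i y)
  simp only [Algebra.TensorProduct.tmul_mul_tmul, one_mul, mul_one, ← TensorProduct.sum_tmul,
    ← TensorProduct.tmul_sum, ← DividedPowerAlgebra.dp_add] at h
  simpa only [symComulFun] using h

theorem symComulFun_mul (m n : ℕ) (x : g) :
    symComulFun R g (m, x) * symComulFun R g (n, x) =
      (m + n).choose m • symComulFun R g (m + n, x) := by
  simp only [symComulFun, Finset.sum_mul_sum, Algebra.TensorProduct.tmul_mul_tmul,
    DividedPowerAlgebra.dp_mul, Finset.smul_sum]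
  have hV : ∀ p ∈ Finset.HasAntidiagonal.antidiagonal (m + n),
      (m + n).choose m • (DividedPowerAlgebra.dp R p.1 x ⊗ₜ[R] DividedPowerAlgebra.dp R p.2 x) =
      ∑ q ∈ Finset.HasAntidiagonal.antidiagonal m, (p.1.choose q.1 * p.2.choose q.2) •
        (DividedPowerAlgebra.dp R p.1 x ⊗ₜ[R] DividedPowerAlgebra.dp R p.2 x) := by
    intro p hp
    rw [← Finset.HasAntidiagonal.mem_antidiagonal.mp hp, Nat.add_choose_eq, Finset.sum_smul]
  refine Eq.trans ?_ (Finset.sum_congr rfl hV).symm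
  refine Eq.trans ?_ Finset.sum_comm
  refine Finset.sum_congr rfl fun q hq => ?_
  have hq' := Finset.HasAntidiagonal.mem_antidiagonal.mp hq
  refine Finset.sum_of_injOn (fun k => (q.1 + k.1, q.2 + k.2)) ?_ ?_ ?_ ?_
  · intro a _ b _ hab
    simp only [Prod.mk.injEq] at hab
    ext <;> omega
  · intro k hk
    have hk' := Finset.HasAntidiagonal.mem_antidiagonal.mp hk
    refine Finset.mem_coe.mpr (Finset.HasAntidiagonal.mem_antidiagonal.mpr ?_)
    simp only
    omega
  · intro p hp hpn
    have hp' := Finset.HasAntidiagonal.mem_antidiagonal.mp hp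
    by_cases h1 : p.1 < q.1
    · simp [Nat.choose_eq_zero_of_lt h1]
    · by_cases h2 : p.2 < q.2
      · simp [Nat.choose_eq_zero_of_lt h2]
      · refine absurd ⟨(p.1 - q.1, p.2 - q.2), ?_, ?_⟩ hpn
        · refine Finset.mem_coe.mpr (Finset.HasAntidiagonal.mem_antidiagonal.mpr ?_)
          simp only
          omega
        · ext <;> simp only <;> omega
  · intro k _
    simp only [← Nat.cast_smul_eq_nsmul R, TensorProduct.smul_tmul_smul, Nat.cast_mul]

/-- The diagonal of `S'`: the morphism of algebras with `dp n x ↦ ∑_{i+j=n} dp i x ⊗ dp j x`. -/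
def symComul : DividedPowerAlgebra R g →ₗ[R] DividedPowerAlgebra R g ⊗[R] DividedPowerAlgebra R g :=
  (DividedPowerAlgebra.lift' (f := symComulFun R g)
    (by intro x; simp [symComulFun, DividedPowerAlgebra.dp_zero, Algebra.TensorProduct.one_def])
    (by
      intro n r x
      simp only [symComulFun, Finset.smul_sum, DividedPowerAlgebra.dp_smul]
      refine Finset.sum_congr rfl fun k hk => ?_
      rw [← Finset.HasAntidiagonal.mem_antidiagonal.mp hk, pow_add, TensorProduct.smul_tmul_smul])
    (symComulFun_mul R g) (symComulFun_add R g)).toLinearMap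

/-- The counit of `S'`, with `dp n x ↦ 0` for `n > 0`. -/
def symCounit : DividedPowerAlgebra R g →ₗ[R] R :=
  (DividedPowerAlgebra.lift' (f := fun p : ℕ × g => if p.1 = 0 then (1 : R) else 0)
    (by simp)
    (by
      intro n r x
      by_cases h : n = 0 <;> simp [h])
    (by
      intro n p x
      by_cases h : n = 0 <;> by_cases h' : p = 0 <;> simp [h, h'])
    (by
      intro n x y
      by_cases h : n = 0
      · simp [h]
      · rw [if_neg (by simpa using h)]
        refine (Finset.sum_eq_zero fun k hk => ?_).symm
        have hk' := Finset.HasAntidiagonal.mem_antidiagonal.mp hk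
        by_cases h1 : k.1 = 0
        · simp [show k.2 ≠ 0 by omega]
        · simp [h1])).toLinearMap

/-- The values on the divided powers of the morphism from `S'` to the square-zero extension
`R ⊕ s²g`. -/
def symLinFun (p : ℕ × g) : TrivSqZeroExt R g :=
  if p.1 = 0 then TrivSqZeroExt.inl 1 else if p.1 = 1 then TrivSqZeroExt.inr p.2 else 0

/-- The projection `π : S'[s²g] → s²g` to the component cogenerating `S'`, with
`dp 1 x ↦ s²x` and `dp n x ↦ 0` for `n ≠ 1`. -/
def symLin : DividedPowerAlgebra R g →ₗ[R] g := by
  letI : Module Rᵐᵒᵖ g := Module.compHom _ ((RingHom.id R).fromOpposite mul_comm)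
  haveI : IsCentralScalar R g := ⟨fun r m => rfl⟩
  exact (TrivSqZeroExt.sndHom R g).comp
    (DividedPowerAlgebra.lift' (f := symLinFun R g)
      (by intro x; simp [symLinFun])
      (by
        intro n r x
        by_cases h : n = 0
        · simp [symLinFun, h]
        · by_cases h1 : n = 1
          · simp [symLinFun, h1]
          · simp [symLinFun, h, h1])
      (by
        intro n p x
        by_cases h : n = 0
        · simp [symLinFun, h]
        · by_cases h' : p = 0
          · simp [symLinFun, h']
          · have h2 : n + p ≠ 1 := by omega
            by_cases h1 : n = 1
            · by_cases h1' : p = 1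
              · simp [symLinFun, h1, h1']
              · simp [symLinFun, h, h', h1', h2]
            · simp [symLinFun, h, h1, h2])
      (by
        intro n x y
        by_cases h : n = 0
        · simp [symLinFun, h]
        · by_cases h1 : n = 1
          · subst h1
            simp [symLinFun, Finset.Nat.antidiagonal_succ, add_comm]
          · refine Eq.trans (b := 0) (by simp [symLinFun, h, h1])
              (Finset.sum_eq_zero fun k hk => ?_).symm
            have hk' := Finset.HasAntidiagonal.mem_antidiagonal.mp hk
            by_cases a : k.1 = 0
            · simp [symLinFun, show k.2 ≠ 0 by omega, show k.2 ≠ 1 by omega]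
            · by_cases a1 : k.1 = 1
              · by_cases b1 : k.2 = 1
                · simp [symLinFun, a1, b1]
                · simp [symLinFun, show k.2 ≠ 0 by omega, b1]
              · simp [symLinFun, a, a1])).toLinearMap

/-- The morphism `S' → S'[X]` of algebras with `dp n x ↦ dp n x Xⁿ`, which records the
decomposition of `S'` into its homogeneous constituents `S'_{2k}`. -/
def symWeight : DividedPowerAlgebra R g →ₗ[R] Polynomial (DividedPowerAlgebra R g) :=
  (DividedPowerAlgebra.lift'
    (f := fun p : ℕ × g => Polynomial.monomial p.1 (DividedPowerAlgebra.dp R p.1 p.2))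
    (by intro x; simp [DividedPowerAlgebra.dp_zero])
    (by intro n r x; simp only [DividedPowerAlgebra.dp_smul, Polynomial.smul_monomial])
    (by
      intro n p x
      simp [Polynomial.monomial_mul_monomial, DividedPowerAlgebra.dp_mul,
        Polynomial.smul_monomial])
    (by
      intro n x y
      rw [DividedPowerAlgebra.dp_add, map_sum]
      refine Finset.sum_congr rfl fun k hk => ?_
      obtain ⟨i, j⟩ := k
      simp only [Polynomial.monomial_mul_monomial,
        Finset.HasAntidiagonal.mem_antidiagonal.mp hk])).toLinearMap

/-- The homogeneous constituent `S'_{2k}[s²g]` (of degree `2k`): the elements `c` with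
`c ↦ c Xᵏ` under the morphism above. -/
def symGr (k : ℕ) : Submodule R (DividedPowerAlgebra R g) :=
  LinearMap.eqLocus (symWeight R g) ((Polynomial.monomial k).restrictScalars R)

end Symmetric

section SymmetricLie

variable (R : Type*) [CommRing R] (g : Type*) [LieRing g] [LieAlgebra R g]

/-- The right action of `g` on `S'[s²g]` induced by the adjoint action: the derivation extending
`s²x · Y = s²[x, Y]`. -/
def symAct : g →ₗ[R] DividedPowerAlgebra R g →ₗ[R] DividedPowerAlgebra R g where
  toFun Y := conv (symComul R g)
    (DividedPowerAlgebra.embed R g ∘ₗ (lieBilin R g).flip Y ∘ₗ symLin R g)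
  map_add' Y Z := by
    simp only [map_add, LinearMap.add_comp, LinearMap.comp_add]
  map_smul' r Y := by
    simp only [map_smul, LinearMap.smul_comp, LinearMap.comp_smul, RingHom.id_apply]

/-- The universal twisting cochain `τ^S : S'[s²g] → Λ[sg]`, `s²x ↦ sx`. -/
def symTwist : DividedPowerAlgebra R g →ₗ[R] ExteriorAlgebra R g :=
  ExteriorAlgebra.ι R ∘ₗ symLin R g

end SymmetricLie

/-! ### The tensor coalgebra `T'[sIΛ]` and the operators of the relative bar construction -/

section Bar

variable (R : Type*) [CommRing R] (g : Type*) [LieRing g] [LieAlgebra R g]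

/-- The tensor coalgebra `T' = T'[sIΛ[sg]]`; the letter `ι w` stands for `sw`. -/
abbrev BarT : Type _ := TensorAlgebra R (AugIdeal R g)

/-- The element `sw̄` of `T'`, where `w̄` is the projection of `w` to `IΛ`. -/
def barLetter : ExteriorAlgebra R g →ₗ[R] BarT R g :=
  TensorAlgebra.ι R ∘ₗ augProj R g

/-- The sign operator `m ↦ (-1)^|m| m` of `T'`, where `|sw| = |w| + 1`. -/
def barSign : BarT R g →ₗ[R] BarT R g :=
  (TensorAlgebra.lift R
    (-(barLetter R g ∘ₗ extSign R g ∘ₗ (LinearMap.ker (extCounit R g)).subtype))).toLinearMap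

/-- The counit of `T'`. -/
def barTCounit : BarT R g →ₗ[R] R :=
  (TensorAlgebra.algebraMapInv : BarT R g →ₐ[R] R).toLinearMap

/-- The diagonal of `T'` (deconcatenation). -/
def barDeconc : BarT R g →ₗ[R] BarT R g ⊗[R] BarT R g :=
  tensorRec (1 ⊗ₜ[R] 1)
    (LinearMap.mk₂ R (fun m x => (m * TensorAlgebra.ι R x) ⊗ₜ[R] 1)
      (by intros; simp [add_mul, TensorProduct.add_tmul])
      (by intros; simp [TensorProduct.smul_tmul'])
      (by intros; simp [mul_add, TensorProduct.add_tmul])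
      (by intros; simp [TensorProduct.smul_tmul']))
    (LinearMap.mk₂ R (fun y x => LinearMap.lTensor _ (LinearMap.mulRight R (TensorAlgebra.ι R x)) y)
      (by intros; simp)
      (by intros; simp)
      (by
        intro y x x'
        rw [map_add, show LinearMap.mulRight R (TensorAlgebra.ι R x + TensorAlgebra.ι R x') =
          LinearMap.mulRight R (TensorAlgebra.ι R x) + LinearMap.mulRight R (TensorAlgebra.ι R x')
          from by ext; simp [mul_add], LinearMap.lTensor_add, LinearMap.add_apply])
      (by
        intro r y x
        rw [map_smul, show LinearMap.mulRight R (r • TensorAlgebra.ι R x) =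
          r • LinearMap.mulRight R (TensorAlgebra.ι R x)
          from by ext; simp, LinearMap.lTensor_smul, LinearMap.smul_apply]))

/-- Splitting off the last letter: `m · sx ↦ m ⊗ x` and `1 ↦ 0`.  This is
`m ↦ ∑ m' ⊗ τ(m'')` for the universal twisting cochain `τ : T' → Λ`, `sx ↦ x`, of the bar
construction. -/
def barSplit : BarT R g →ₗ[R] BarT R g ⊗[R] ExteriorAlgebra R g :=
  tensorRec 0
    (LinearMap.mk₂ R (fun m x => m ⊗ₜ[R] (x : ExteriorAlgebra R g))
      (by intros; simp [TensorProduct.add_tmul])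
      (by intros; simp [TensorProduct.smul_tmul'])
      (by intros; simp [TensorProduct.tmul_add])
      (by intros; simp))
    0

/-- The bilinear map `(y, x) ↦ y · sx` on `T' × IΛ`. -/
def barAppend : BarT R g →ₗ[R] AugIdeal R g →ₗ[R] BarT R g :=
  (LinearMap.mul R (BarT R g)).compl₂ (TensorAlgebra.ι R)

/-- The differential `d` of the bar construction of the algebra `Λ`, the coderivation with
`d (sy ⊗ sx) = (-1)^(|y|+1) s(yx)`.  Recursively `d (m · sx) = (d m) · sx + c`, where
`c = (-1)^|n| (-1)^(|y|+1) n · s(yx)` if `m = n · sy`, and `c = 0` if `m = 1`. -/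
def barD : BarT R g →ₗ[R] BarT R g :=
  tensorRec 0
    (LinearMap.mk₂ R (fun m x => LinearMap.mul' R (BarT R g)
        (TensorProduct.map (barSign R g)
          (barLetter R g ∘ₗ LinearMap.mulRight R (x : ExteriorAlgebra R g) ∘ₗ (-extSign R g))
          (barSplit R g m)))
      (by intros; simp)
      (by intros; simp)
      (by
        intro m x x'
        rw [show LinearMap.mulRight R ((x + x' : AugIdeal R g) : ExteriorAlgebra R g) =
          LinearMap.mulRight R (x : ExteriorAlgebra R g) +
            LinearMap.mulRight R (x' : ExteriorAlgebra R g)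
          from by ext; simp [mul_add], LinearMap.add_comp, LinearMap.comp_add,
          TensorProduct.map_add_right, LinearMap.add_apply, map_add])
      (by
        intro r m x
        rw [show LinearMap.mulRight R ((r • x : AugIdeal R g) : ExteriorAlgebra R g) =
          r • LinearMap.mulRight R (x : ExteriorAlgebra R g)
          from by ext; simp, LinearMap.smul_comp, LinearMap.comp_smul,
          TensorProduct.map_smul_right, LinearMap.smul_apply, map_smul]))
    (barAppend R g)

/-- The diagonal right action of `g` on `T'`, with each letter acted upon through `Λ`. -/
def barTAct : g →ₗ[R] BarT R g →ₗ[R] BarT R g :=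
  (tensorRec (0 : g →ₗ[R] BarT R g)
    (LinearMap.mk₂ R (fun m x =>
        LinearMap.mulLeft R m ∘ₗ barLetter R g ∘ₗ (extAct R g).flip (x : ExteriorAlgebra R g))
      (by intros; ext; simp [add_mul])
      (by intros; ext; simp)
      (by intros; ext; simp [mul_add])
      (by intros; ext; simp))
    (LinearMap.mk₂ R (fun f x => LinearMap.mulRight R (TensorAlgebra.ι R x) ∘ₗ f)
      (by intros; ext; simp [add_mul])
      (by intros; ext; simp)
      (by intros; ext; simp [mul_add])
      (by intros; ext; simp))).flip

/-- The operator `∂` on `T'` determined by the Lie bracket, that is, the differential of the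
iterated twisted tensor products `IΛ'_∂ ⊗_τ ⋯ ⊗_τ IΛ'_∂`, transported through the suspensions.
Recursively
`∂ (m · sx) = (∂ m) · sx - (-1)^|m| (m · s(∂x) + ∑ (m τ_g(x')) · s x'')`,
where `x ↦ ∑ x' ⊗ x''` is the diagonal of `Λ'`, `τ_g : Λ' → g` is the desuspension `sx ↦ x`
(zero off `Λ'_1`), and where `s x''` is zero for `x''` in `Λ_0`. -/
def barBoundary : BarT R g →ₗ[R] BarT R g :=
  tensorRec 0
    (LinearMap.mk₂ R (fun m x =>
        -(barSign R g m * barLetter R g (extBoundary R g x)) -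
          LinearMap.mul' R (BarT R g)
            (TensorProduct.map
              ((barTAct R g).flip (barSign R g m) ∘ₗ ExteriorAlgebra.ιInv)
              (barLetter R g) (extComul R g x)))
      (by
        intros
        simp only [map_add, add_mul, LinearMap.add_comp, TensorProduct.map_add_left,
          LinearMap.add_apply]
        abel)
      (by
        intros
        simp only [map_smul, smul_mul_assoc, LinearMap.smul_comp, TensorProduct.map_smul_left,
          LinearMap.smul_apply, smul_sub, smul_neg])
      (by
        intros
        simp only [Submodule.coe_add, map_add, mul_add]
        abel)
      (by
        intros
        simp only [Submodule.coe_smul, map_smul, mul_smul_comm, smul_sub, smul_neg]))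
    (barAppend R g)

/-- The words in `T'` all of whose letters are homogeneous, with their degrees. -/
inductive IsBarWord : ℕ → BarT R g → Prop
  | nil : IsBarWord 0 1
  | append {n k : ℕ} {m : BarT R g} (hm : IsBarWord n m) (x : AugIdeal R g)
      (hx : (x : ExteriorAlgebra R g) ∈ ⋀[R]^k g) :
      IsBarWord (n + (k + 1)) (m * TensorAlgebra.ι R x)

/-- The component of degree `n` of `T'`. -/
def barTGr (n : ℕ) : Submodule R (BarT R g) :=
  Submodule.span R {m | IsBarWord R g n m}

/-- The component `S' → (sIΛ)^{⊗n}` of the adjoint of a map `τ : S' → Λ`, given by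
`c ↦ ∑ sτ(c₁) ⊗ ⋯ ⊗ sτ(c_n)` in terms of the iterated diagonal `c ↦ ∑ c₁ ⊗ ⋯ ⊗ c_n`. -/
def adjointComponent (τ : DividedPowerAlgebra R g →ₗ[R] ExteriorAlgebra R g) :
    ℕ → (DividedPowerAlgebra R g →ₗ[R] BarT R g)
  | 0 => Algebra.linearMap R (BarT R g) ∘ₗ symCounit R g
  | n + 1 => LinearMap.mul' R (BarT R g) ∘ₗ
      TensorProduct.map (adjointComponent τ n) (barLetter R g ∘ₗ τ) ∘ₗ symComul R g

/-- The adjoint `S' → T'[sIΛ]` of `τ^S`, the morphism of coalgebras with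
`c ↦ ∑_n ∑ sτ(c₁) ⊗ ⋯ ⊗ sτ(c_n)`.  As `τ^S` vanishes off `S'_2`, on the homogeneous constituent
`S'_{2n}` only the `n`-th summand is non-zero; the decomposition of `c` into its
homogeneous constituents is used to form the sum. -/
def symAdjoint : DividedPowerAlgebra R g →ₗ[R] BarT R g :=
  Polynomial.lsum (fun n => adjointComponent R g (symTwist R g) n) ∘ₗ symWeight R g

end Bar

/-! ### Objects of the kind `C ⊗ Λ` -/

section Twisted

variable (R : Type*) [CommRing R] (g : Type*) [LieRing g] [LieAlgebra R g]
variable {C : Type*} [AddCommGroup C] [Module R C]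

/-- The total differential on `C ⊗ Λ`,
`D (c ⊗ a) = (δ c) ⊗ a - τ ∩ (c ⊗ a) + (-1)^|c| (c ⊗ ∂ a + ∑ (c · τ_g(a')) ⊗ a'')`
with the cap product `τ ∩ (c ⊗ a) = ∑ (-1)^|c'| c' ⊗ τ(c'') a`.
Here `σ` is the sign operator, `δ` a differential, and `act` the right `g`-action of `C`; the map
`split` is `c ↦ ∑ c' ⊗ τ(c'')`, for a twisting cochain `τ : C → Λ`. -/
def twistedD (σ δ : C →ₗ[R] C) (split : C →ₗ[R] C ⊗[R] ExteriorAlgebra R g)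
    (act : g →ₗ[R] C →ₗ[R] C) :
    C ⊗[R] ExteriorAlgebra R g →ₗ[R] C ⊗[R] ExteriorAlgebra R g :=
  LinearMap.rTensor _ δ
    - LinearMap.lTensor C (LinearMap.mul' R (ExteriorAlgebra R g)) ∘ₗ
        (TensorProduct.assoc R C (ExteriorAlgebra R g) (ExteriorAlgebra R g)).toLinearMap ∘ₗ
        LinearMap.rTensor _ (LinearMap.rTensor _ σ ∘ₗ split)
    + TensorProduct.map σ (extBoundary R g)
    + LinearMap.rTensor _ (TensorProduct.lift (act.flip.compl₂ ExteriorAlgebra.ιInv)) ∘ₗ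
        (TensorProduct.assoc R C (ExteriorAlgebra R g) (ExteriorAlgebra R g)).symm.toLinearMap ∘ₗ
        TensorProduct.map σ (extComul R g)

/-- The right action of `Y` in `g ⊆ Cg`: `(c ⊗ a) · Y = c · Y ⊗ a + c ⊗ a · Y`. -/
def actEven (act : g →ₗ[R] C →ₗ[R] C) :
    g →ₗ[R] C ⊗[R] ExteriorAlgebra R g →ₗ[R] C ⊗[R] ExteriorAlgebra R g :=
  LinearMap.rTensorHom (ExteriorAlgebra R g) ∘ₗ act + LinearMap.lTensorHom C ∘ₗ extAct R g

/-- The right action of `sY` in `sg ⊆ Cg`: `(c ⊗ a) · sY = c ⊗ a (sY)`. -/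
def actOdd (C : Type*) [AddCommGroup C] [Module R C] :
    g →ₗ[R] C ⊗[R] ExteriorAlgebra R g →ₗ[R] C ⊗[R] ExteriorAlgebra R g :=
  LinearMap.lTensorHom C ∘ₗ (LinearMap.mul R (ExteriorAlgebra R g)).flip ∘ₗ ExteriorAlgebra.ι R

/-- The sign operator of `C ⊗ Λ`. -/
def tensorSign (σ : C →ₗ[R] C) :
    C ⊗[R] ExteriorAlgebra R g →ₗ[R] C ⊗[R] ExteriorAlgebra R g :=
  TensorProduct.map σ (extSign R g)

/-- One step in moving `Λ` past `C`. -/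
def braidStep (σ : C →ₗ[R] C) : g →ₗ[R] Module.End R (ExteriorAlgebra R g ⊗[R] C) :=
  (TensorProduct.mapBilinear (RingHom.id R) _ _ _ _).flip σ ∘ₗ
    LinearMap.mul R (ExteriorAlgebra R g) ∘ₗ ExteriorAlgebra.ι R

theorem braidStep_sq (σ : C →ₗ[R] C) (v : g) :
    braidStep R g σ v * braidStep R g σ v = 0 := by
  refine TensorProduct.ext' fun a c => ?_
  simp [braidStep, ← mul_assoc]

/-- The interchange map `C ⊗ Λ → Λ ⊗ C`, `c ⊗ a ↦ (-1)^(|c||a|) a ⊗ c`. -/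
def braid (σ : C →ₗ[R] C) : C ⊗[R] ExteriorAlgebra R g →ₗ[R] ExteriorAlgebra R g ⊗[R] C :=
  TensorProduct.lift
    ((ExteriorAlgebra.lift R ⟨braidStep R g σ, braidStep_sq R g σ⟩).toLinearMap.flip ∘ₗ
      TensorProduct.mk R (ExteriorAlgebra R g) C 1)

/-- The tensor product diagonal on `C ⊗ Λ'`:
`c ⊗ a ↦ ∑ (-1)^(|c''||a'|) (c' ⊗ a') ⊗ (c'' ⊗ a'')`. -/
def tensorComul (σ : C →ₗ[R] C) (Δ : C →ₗ[R] C ⊗[R] C) :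
    C ⊗[R] ExteriorAlgebra R g →ₗ[R]
      (C ⊗[R] ExteriorAlgebra R g) ⊗[R] (C ⊗[R] ExteriorAlgebra R g) :=
  (TensorProduct.assoc R C (ExteriorAlgebra R g) (C ⊗[R] ExteriorAlgebra R g)).symm.toLinearMap ∘ₗ
    LinearMap.lTensor C
      ((TensorProduct.assoc R (ExteriorAlgebra R g) C (ExteriorAlgebra R g)).toLinearMap ∘ₗ
        LinearMap.rTensor _ (braid R g σ) ∘ₗ
        (TensorProduct.assoc R C (ExteriorAlgebra R g) (ExteriorAlgebra R g)).symm.toLinearMap) ∘ₗ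
    (TensorProduct.assoc R C C (ExteriorAlgebra R g ⊗[R] ExteriorAlgebra R g)).toLinearMap ∘ₗ
    TensorProduct.map Δ (extComul R g)

/-- The tensor product counit on `C ⊗ Λ'`. -/
def tensorCounit (ε : C →ₗ[R] R) : C ⊗[R] ExteriorAlgebra R g →ₗ[R] R :=
  LinearMap.mul' R R ∘ₗ TensorProduct.map ε (extCounit R g)

/-- The tensor product grading on `C ⊗ Λ`, the elements of `𝒞 i` having degree `w i`. -/
def tensorGr (w : ℕ → ℕ) (𝒞 : ℕ → Submodule R C) (n : ℕ) :
    Submodule R (C ⊗[R] ExteriorAlgebra R g) :=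
  ⨆ p : ℕ × ℕ, ⨆ _ : w p.1 + p.2 = n,
    Submodule.map₂ (TensorProduct.mk R C (ExteriorAlgebra R g)) (𝒞 p.1) (⋀[R]^p.2 g)

end Twisted

/-! ### The Weil coalgebra `W'[g]` -/

section Weil

variable (R : Type*) [CommRing R] (g : Type*) [LieRing g] [LieAlgebra R g]

/-- The module `S'[s²g] ⊗ Λ'[sg]` underlying the symmetric coalgebra `S'[sCg]`. -/
abbrev Weil : Type _ := DividedPowerAlgebra R g ⊗[R] ExteriorAlgebra R g

/-- The grading of the Weil coalgebra; `S'_{2k}[s²g]` has degree `2k`. -/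
def weilGr : ℕ → Submodule R (Weil R g) := tensorGr R g (fun k => 2 * k) (symGr R g)

/-- The diagonal of the Weil coalgebra. -/
def weilComul : Weil R g →ₗ[R] Weil R g ⊗[R] Weil R g :=
  tensorComul R g LinearMap.id (symComul R g)

/-- The counit of the Weil coalgebra. -/
def weilCounit : Weil R g →ₗ[R] R := tensorCounit R g (symCounit R g)

/-- The differential `d + ∂` of the Weil coalgebra:
`(d + ∂) (c ⊗ a) = -∑ c' ⊗ τ^S(c'') a + c ⊗ ∂ a + ∑ (c · τ_g(a')) ⊗ a''`. -/
def weilD : Weil R g →ₗ[R] Weil R g :=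
  twistedD R g LinearMap.id 0 (LinearMap.lTensor _ (symTwist R g) ∘ₗ symComul R g) (symAct R g)

/-- The right action of `g ⊆ Cg` on the Weil coalgebra. -/
def weilActEven : g →ₗ[R] Weil R g →ₗ[R] Weil R g := actEven R g (symAct R g)

/-- The right action of `sg ⊆ Cg` on the Weil coalgebra. -/
def weilActOdd : g →ₗ[R] Weil R g →ₗ[R] Weil R g := actOdd R g (DividedPowerAlgebra R g)

/-- The universal map `τ_{Cg} : S'[sCg] → Cg`, the projection to `sCg = s²g ⊕ sg` followed by the
desuspension. -/
def coneTwist : Weil R g →ₗ[R] g × g :=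
  LinearMap.prod
    (TensorProduct.lift ((LinearMap.lsmul R g).flip.compl₁₂ (symLin R g) (extCounit R g)))
    (TensorProduct.lift ((LinearMap.lsmul R g).compl₁₂ (symCounit R g) ExteriorAlgebra.ιInv))

/-- The differential of the cone `Cg = sg ⊕ g`, `sx ↦ x`. -/
def coneD : g × g →ₗ[R] g × g := LinearMap.inr R g g ∘ₗ LinearMap.fst R g g

/-- The graded Lie bracket of the cone `Cg = sg ⊕ g`:
`[x, y]` as in `g`, `[sx, y] = [x, sy] = s[x, y]`, `[sx, sy] = 0`. -/
def coneBracket : g × g →ₗ[R] g × g →ₗ[R] g × g :=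
  LinearMap.mk₂ R (fun p q => (⁅p.1, q.2⁆ + ⁅p.2, q.1⁆, ⁅p.2, q.2⁆))
    (by intros; ext <;> (simp; try abel))
    (by intros; ext <;> simp)
    (by intros; ext <;> (simp; try abel))
    (by intros; ext <;> simp)

/-- The cup bracket `[a, b]` of two maps `W'[g] → Cg`, with `b` of odd degree:
`[a, b](c) = ∑ (-1)^|c'| [a(c'), b(c'')]`. -/
def cupBracket (a b : Weil R g →ₗ[R] g × g) : Weil R g →ₗ[R] g × g :=
  TensorProduct.lift (coneBracket R g) ∘ₗ
    TensorProduct.map (a ∘ₗ tensorSign R g LinearMap.id) b ∘ₗ weilComul R g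

/-- The coalgebra differential `D` is that of the Chevalley--Eilenberg coalgebra `S'_∂[sCg]` of
the differential graded Lie algebra `Cg`: `τ_{Cg}` is a Lie algebra twisting cochain,
`d τ + τ D = ½ [τ, τ]`. -/
def IsConeCE (D : Weil R g →ₗ[R] Weil R g) : Prop :=
  (2 : R) • (coneD R g ∘ₗ coneTwist R g + coneTwist R g ∘ₗ D) =
    cupBracket R g (coneTwist R g) (coneTwist R g)

end Weil

/-! ### The relative bar construction `BΛ_∂[sg]` -/

section RelBar

variable (R : Type*) [CommRing R] (g : Type*) [LieRing g] [LieAlgebra R g]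

/-- The module `T'[sIΛ] ⊗ Λ` underlying `BΛ_∂[sg]`. -/
abbrev RelBar : Type _ := BarT R g ⊗[R] ExteriorAlgebra R g

/-- The grading of `BΛ_∂[sg]`. -/
def relBarGr : ℕ → Submodule R (RelBar R g) := tensorGr R g id (barTGr R g)

/-- The tensor product diagonal of `T'[sIΛ] ⊗ Λ'[sg]`. -/
def relBarComul : RelBar R g →ₗ[R] RelBar R g ⊗[R] RelBar R g :=
  tensorComul R g (barSign R g) (barDeconc R g)

/-- The counit of `T'[sIΛ] ⊗ Λ'[sg]`. -/
def relBarCounit : RelBar R g →ₗ[R] R := tensorCounit R g (barTCounit R g)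

/-- The differential `d ⊗ Id - τ^B ∩ · + ∂` of `BΛ_∂[sg]`, where
`∂ (m ⊗ a) = (∂ m) ⊗ a + (-1)^|m| (m ⊗ ∂ a + ∑ (m · τ_g(a')) ⊗ a'')`. -/
def relBarD : RelBar R g →ₗ[R] RelBar R g :=
  twistedD R g (barSign R g) (barD R g + barBoundary R g) (barSplit R g) (barTAct R g)

/-- The right action of `g ⊆ Cg` on `BΛ_∂[sg]`. -/
def relBarActEven : g →ₗ[R] RelBar R g →ₗ[R] RelBar R g := actEven R g (barTAct R g)

/-- The right action of `sg ⊆ Cg` on `BΛ_∂[sg]`. -/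
def relBarActOdd : g →ₗ[R] RelBar R g →ₗ[R] RelBar R g := actOdd R g (BarT R g)

/-- The sign operator of `BΛ_∂[sg]`. -/
def relBarSign : RelBar R g →ₗ[R] RelBar R g := tensorSign R g (barSign R g)

theorem extSign_extSign (a : ExteriorAlgebra R g) : extSign R g (extSign R g a) = a := by
  have h : (ExteriorAlgebra.map (-LinearMap.id : g →ₗ[R] g)).comp
      (ExteriorAlgebra.map (-LinearMap.id : g →ₗ[R] g)) = AlgHom.id R _ := by
    ext; simp
  exact DFunLike.congr_fun h a

/-- The diagonal right action of `sv` on `BΛ ⊗ BΛ`: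
`(b ⊗ c) · sv = (-1)^|c| (b · sv) ⊗ c + b ⊗ (c · sv)`. -/
def diagStep : g →ₗ[R] Module.End R (RelBar R g ⊗[R] RelBar R g) :=
  (TensorProduct.mapBilinear (RingHom.id R) _ _ _ _).flip (relBarSign R g) ∘ₗ relBarActOdd R g +
    LinearMap.lTensorHom (RelBar R g) ∘ₗ relBarActOdd R g

theorem diagStep_sq (v : g) : diagStep R g v * diagStep R g v = 0 := by
  have h1 : relBarActOdd R g v ∘ₗ relBarActOdd R g v = 0 := by
    refine TensorProduct.ext' fun m a => ?_
    simp [relBarActOdd, actOdd, mul_assoc]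
  have h2 : relBarSign R g ∘ₗ relBarActOdd R g v = -(relBarActOdd R g v ∘ₗ relBarSign R g) := by
    refine TensorProduct.ext' fun m a => ?_
    simp [relBarSign, tensorSign, relBarActOdd, actOdd, extSign_mul_ι, TensorProduct.tmul_neg]
  refine TensorProduct.ext' fun b c => ?_
  have h1b := fun b => DFunLike.congr_fun h1 b
  have h2c := DFunLike.congr_fun h2 c
  simp only [LinearMap.comp_apply, LinearMap.zero_apply, LinearMap.neg_apply] at h1b h2c
  simp [diagStep, h1b, h2c, TensorProduct.tmul_neg]
  exact neg_add_cancel (G := RelBar R g ⊗[R] RelBar R g) _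

/-- The diagonal right action of `Λ` on `BΛ ⊗ BΛ`, through the diagonal of the Hopf algebra `Λ`:
`(b ⊗ c) · a = ∑ (-1)^(|c||a'|) (b a') ⊗ (c a'')`. -/
def diagAct : ExteriorAlgebra R g →ₗ[R] Module.End R (RelBar R g ⊗[R] RelBar R g) :=
  (MulOpposite.opLinearEquiv R :
      Module.End R (RelBar R g ⊗[R] RelBar R g) ≃ₗ[R] _).symm.toLinearMap ∘ₗ
    (ExteriorAlgebra.lift R ⟨(MulOpposite.opLinearEquiv R :
      Module.End R (RelBar R g ⊗[R] RelBar R g) ≃ₗ[R] _).toLinearMap ∘ₗ diagStep R g, by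
        intro v
        exact MulOpposite.unop_injective (diagStep_sq R g v)⟩).toLinearMap

/-- The contracting homotopy `h (m ⊗ a) = (-1)^|m| m · sa ⊗ 1` of the bar construction. -/
def barHomotopy : RelBar R g →ₗ[R] RelBar R g :=
  (TensorProduct.mk R (BarT R g) (ExteriorAlgebra R g)).flip 1 ∘ₗ
    LinearMap.mul' R (BarT R g) ∘ₗ TensorProduct.map (barSign R g) (barLetter R g)

/-- The restriction to `T'` of the diagonal below, by recursion on the length of words:
`Δ 1 = 1 ⊗ 1` and `Δ (h b) = h b ⊗ 1 + (Id ⊗ h) (Δ b)` for `b = m ⊗ x`, where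
`m · sx ⊗ 1 = (-1)^|m| h b`, `Δ b = (Δ m) · x` and `(Id ⊗ h) (b' ⊗ b'') = (-1)^|b'| b' ⊗ h b''`. -/
def awComulT : BarT R g →ₗ[R] RelBar R g ⊗[R] RelBar R g :=
  tensorRec ((1 ⊗ₜ[R] 1) ⊗ₜ[R] (1 ⊗ₜ[R] 1))
    (LinearMap.mk₂ R
      (fun (m : BarT R g) (x : AugIdeal R g) => ((m * TensorAlgebra.ι R x) ⊗ₜ[R] (1 : ExteriorAlgebra R g)) ⊗ₜ[R]
        ((1 : BarT R g) ⊗ₜ[R] (1 : ExteriorAlgebra R g)))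
      (by intros; simp [add_mul, TensorProduct.add_tmul])
      (by intros; simp [TensorProduct.smul_tmul'])
      (by intros; simp [mul_add, TensorProduct.add_tmul])
      (by intros; simp [TensorProduct.smul_tmul']))
    (LinearMap.mk₂ R
      (fun (y : RelBar R g ⊗[R] RelBar R g) (x : AugIdeal R g) => TensorProduct.map (relBarSign R g) (barHomotopy R g)
        (diagAct R g (x : ExteriorAlgebra R g)
          (TensorProduct.map (relBarSign R g) (relBarSign R g) y)))
      (by intros; simp)
      (by intros; simp)
      (by intros; simp)
      (by intros; simp))

/-- The diagonal of `BΛ_∂[sg]` that arises, by normalization and condensation (that is, through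
the Alexander--Whitney map), from the diagonals of the simplicial constituents
`Λ' ⊗_τ ⋯ ⊗_τ Λ'` of the relative bar resolution:
`Δ ([w₁|…|wₙ] w) = ∑ᵢ ∑ ± [w₁|…|wᵢ] w'ᵢ₊₁ ⋯ w'ₙ w' ⊗ [w''ᵢ₊₁|…|w''ₙ] w''`. -/
def awComul : RelBar R g →ₗ[R] RelBar R g ⊗[R] RelBar R g :=
  TensorProduct.lift ((diagAct R g).flip ∘ₗ awComulT R g)

/-- The canonical map `ι`, the tensor product of the adjoint of `τ^S` with the identity
of `Λ[sg]`. -/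
def weilToBar : Weil R g →ₗ[R] RelBar R g :=
  LinearMap.rTensor (ExteriorAlgebra R g) (symAdjoint R g)

end RelBar

/-! ### Differential graded coalgebras and `Cg`-modules -/

section Structures

variable {R : Type*} [CommRing R] {C : Type*} [AddCommGroup C] [Module R C]

/-- `(C, Δ, ε)` is a graded coalgebra with respect to the grading `𝒞`. -/
structure IsGradedCoalgebra (𝒞 : ℕ → Submodule R C) (Δ : C →ₗ[R] C ⊗[R] C) (ε : C →ₗ[R] R) :
    Prop where
  internal : DirectSum.IsInternal 𝒞
  comul_mem : ∀ n, ∀ c ∈ 𝒞 n, Δ c ∈ ⨆ p : ℕ × ℕ, ⨆ _ : p.1 + p.2 = n,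
    Submodule.map₂ (TensorProduct.mk R C C) (𝒞 p.1) (𝒞 p.2)
  counit_eq_zero : ∀ n, n ≠ 0 → ∀ c ∈ 𝒞 n, ε c = 0
  coassoc : ∀ c, TensorProduct.assoc R C C C (LinearMap.rTensor C Δ (Δ c)) =
    LinearMap.lTensor C Δ (Δ c)
  counit_left : ∀ c, TensorProduct.lid R C (LinearMap.rTensor C ε (Δ c)) = c
  counit_right : ∀ c, TensorProduct.rid R C (LinearMap.lTensor C ε (Δ c)) = c

/-- `(C, Δ, ε, D)` is a differential graded coalgebra (with differential of degree `-1`) with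
respect to the grading `𝒞`. -/
structure IsDGCoalgebra (𝒞 : ℕ → Submodule R C) (Δ : C →ₗ[R] C ⊗[R] C) (ε : C →ₗ[R] R)
    (D : C →ₗ[R] C) : Prop extends IsGradedCoalgebra 𝒞 Δ ε where
  d_mem : ∀ n, ∀ c ∈ 𝒞 (n + 1), D c ∈ 𝒞 n
  d_zero : ∀ c ∈ 𝒞 0, D c = 0
  d_d : ∀ c, D (D c) = 0
  counit_d : ∀ c, ε (D c) = 0
  coderivation : ∃ σ : C →ₗ[R] C, (∀ n, ∀ c ∈ 𝒞 n, σ c = (-1 : R) ^ n • c) ∧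
    ∀ c, Δ (D c) = LinearMap.rTensor C D (Δ c) + TensorProduct.map σ D (Δ c)

/-- `(C, D)` is a differential graded right module over the differential graded Lie algebra
`Cg`, the elements `Y` of `g` and `sY` of `sg` acting through `actY` and `actS`. -/
structure IsDGConeModule {g : Type*} [LieRing g] [LieAlgebra R g] (𝒞 : ℕ → Submodule R C)
    (D : C →ₗ[R] C) (actY actS : g →ₗ[R] C →ₗ[R] C) : Prop where
  even_mem : ∀ Y n, ∀ c ∈ 𝒞 n, actY Y c ∈ 𝒞 n
  odd_mem : ∀ Y n, ∀ c ∈ 𝒞 n, actS Y c ∈ 𝒞 (n + 1)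
  even_even : ∀ Y Z c, actY Z (actY Y c) - actY Y (actY Z c) = actY ⁅Y, Z⁆ c
  odd_even : ∀ Y Z c, actY Z (actS Y c) - actS Y (actY Z c) = actS ⁅Y, Z⁆ c
  odd_odd : ∀ Y Z c, actS Z (actS Y c) + actS Y (actS Z c) = 0
  d_even : ∀ Y c, D (actY Y c) = actY Y (D c)
  d_odd : ∀ Y n, ∀ c ∈ 𝒞 n, D (actS Y c) = actS Y (D c) + (-1 : R) ^ n • actY Y c

/-- `f` is a morphism of differential graded coalgebras. -/
structure IsDGCoalgebraHom {C' : Type*} [AddCommGroup C'] [Module R C']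
    (𝒞 : ℕ → Submodule R C) (Δ : C →ₗ[R] C ⊗[R] C) (ε : C →ₗ[R] R) (D : C →ₗ[R] C)
    (𝒞' : ℕ → Submodule R C') (Δ' : C' →ₗ[R] C' ⊗[R] C') (ε' : C' →ₗ[R] R) (D' : C' →ₗ[R] C')
    (f : C →ₗ[R] C') : Prop where
  map_mem : ∀ n, ∀ c ∈ 𝒞 n, f c ∈ 𝒞' n
  map_comul : ∀ c, Δ' (f c) = TensorProduct.map f f (Δ c)
  map_counit : ∀ c, ε' (f c) = ε c
  map_d : ∀ c, D' (f c) = f (D c)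

end Structures

end WeilBar
end

open scoped TensorProduct

noncomputable section

/-! All the modules have the form C ⊗ Λ, and the proof rests on a small set of operators that
generate them. Let r_v be right multiplication by sv, Y_v the action of v in g, s the sign operator,
e = 1 ⊗ 1. Then C ⊗ Λ is generated from C ⊗ 1 by the r_v (`tensor_hom`), and the relative bar module
is generated from e alone by the r_v and the homotopy h (`relBar_hom`).

The structure maps obey simple rules on these operators. Every differential satisfies D r_v = r_v D
+ Y_v s (`twistedD_actOdd`), every diagonal satisfies Δ r_v = (r_v ⊗ s + Id ⊗ r_v) Δ, and on the
relative bar module D h = -Id + ε e - h D (`relBarD_barHomotopy`) and, for the Alexander–Whitney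
diagonal, Δ h = h ⊗ e + (s ⊗ h) Δ (`awComul_barHomotopy`). An identity such as D D = 0,
coassociativity or the coderivation property therefore only has to be checked on the generating part
and propagated along r_v and h. The propagation is formal and is proved once, for operators on an
arbitrary module E. In particular D D = 0 on the relative bar module requires no separate study of
d, of ∂ or of the twisting cochain.

For the Weil coalgebra there is no homotopy, and the identities have to be checked on S' ⊗ 1. With π
the projection to the cogenerators, they reduce to ∑ sπ(c') sπ(c'') = 0 and ∑ c' · π(c'') = 0. Both
follow from `sym_alternating`: an alternating form vanishes on the linear part of the cocommutative
diagonal.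

The adjoint κ of the twisting cochain satisfies κ(c) = ε(c) 1 + ∑ κ(c') · s(sπ(c''))
(`symAdjoint_rec`). Since π is concentrated in weight one, a recursion of this shape has only one
solution (`sym_rec_unique`). This gives d κ = 0, ∂ κ = 0, equivariance under g, and compatibility
with deconcatenation. On κ(c) ⊗ 1 the Alexander–Whitney recursion loses the terms in which Λ acts on
the left factor (`awStep_symAdjoint`), so both diagonals take the same value there. The statements
about ι then spread over S' ⊗ Λ along the r_v. -/

namespace WeilBar

/-! ### Operators on a tensor square: propagation of coalgebra identities -/

section DiagOp

variable {R : Type*} [CommRing R] {E : Type*} [AddCommGroup E] [Module R E]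

/-- The operator `x ⊗ y ↦ r x ⊗ s y + x ⊗ r y`. -/
def diagOp (r s : E →ₗ[R] E) : E ⊗[R] E →ₗ[R] E ⊗[R] E :=
  TensorProduct.map r s + LinearMap.lTensor E r

/-- The operator `x ⊗ y ↦ D x ⊗ y + s x ⊗ D y`. -/
def codiffOp (s D : E →ₗ[R] E) : E ⊗[R] E →ₗ[R] E ⊗[R] E :=
  LinearMap.rTensor E D + TensorProduct.map s D

@[simp]
theorem diagOp_tmul (r s : E →ₗ[R] E) (x y : E) :
    diagOp r s (x ⊗ₜ[R] y) = r x ⊗ₜ[R] s y + x ⊗ₜ[R] r y := rfl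

@[simp]
theorem codiffOp_tmul (s D : E →ₗ[R] E) (x y : E) :
    codiffOp s D (x ⊗ₜ[R] y) = D x ⊗ₜ[R] y + s x ⊗ₜ[R] D y := rfl

/-- Two linear maps that agree on pure tensors agree. -/
theorem eq_of_tmul {M N P : Type*} [AddCommMonoid M] [Module R M] [AddCommMonoid N]
    [Module R N] [AddCommMonoid P] [Module R P] (f f' : M ⊗[R] N →ₗ[R] P)
    (h : ∀ x y, f (x ⊗ₜ y) = f' (x ⊗ₜ y)) (z : M ⊗[R] N) : f z = f' z :=
  LinearMap.congr_fun (TensorProduct.ext' h) z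

variable {Δ : E →ₗ[R] E ⊗[R] E} {r s h D : E →ₗ[R] E} {e : E} {ε : E →ₗ[R] R}

/-- Either way of splitting a factor turns `diagOp r s` into the same operator r ⊗ s ⊗ s + Id ⊗ r ⊗
s + Id ⊗ Id ⊗ r on the triple tensor product. Here the left factor is split, and it never carries
`s`. -/
theorem assoc_rTensor_diagOp (hr : ∀ b, Δ (r b) = diagOp r s (Δ b)) (z : E ⊗[R] E) :
    TensorProduct.assoc R E E E (LinearMap.rTensor E Δ (diagOp r s z)) =
      (TensorProduct.map r (TensorProduct.map s s) + LinearMap.lTensor E (diagOp r s))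
        (TensorProduct.assoc R E E E (LinearMap.rTensor E Δ z)) := by
  refine eq_of_tmul ((TensorProduct.assoc R E E E).toLinearMap ∘ₗ LinearMap.rTensor E Δ ∘ₗ
    diagOp r s) ((TensorProduct.map r (TensorProduct.map s s) + LinearMap.lTensor E (diagOp r s)) ∘ₗ
      (TensorProduct.assoc R E E E).toLinearMap ∘ₗ LinearMap.rTensor E Δ) (fun x y => ?_) z
  simp only [LinearMap.comp_apply, diagOp_tmul, map_add, LinearMap.rTensor_tmul, hr]
  generalize Δ x = w
  refine eq_of_tmul ((TensorProduct.assoc R E E E).toLinearMap ∘ₗ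
      (TensorProduct.mk R _ E).flip (s y) ∘ₗ diagOp r s +
    (TensorProduct.assoc R E E E).toLinearMap ∘ₗ (TensorProduct.mk R _ E).flip (r y))
    ((TensorProduct.map r (TensorProduct.map s s) + LinearMap.lTensor E (diagOp r s)) ∘ₗ
      (TensorProduct.assoc R E E E).toLinearMap ∘ₗ (TensorProduct.mk R _ E).flip y)
    (fun u v => ?_) w
  simp [TensorProduct.tmul_add, add_assoc]

/-- Companion for splitting the right factor. That factor can carry `s`, so compatibility of the
diagonal with `s` enters. -/
theorem lTensor_diagOp (hr : ∀ b, Δ (r b) = diagOp r s (Δ b))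
    (hs : ∀ b, Δ (s b) = TensorProduct.map s s (Δ b)) (z : E ⊗[R] E) :
    LinearMap.lTensor E Δ (diagOp r s z) =
      (TensorProduct.map r (TensorProduct.map s s) + LinearMap.lTensor E (diagOp r s))
        (LinearMap.lTensor E Δ z) := by
  refine eq_of_tmul (LinearMap.lTensor E Δ ∘ₗ diagOp r s)
    ((TensorProduct.map r (TensorProduct.map s s) + LinearMap.lTensor E (diagOp r s)) ∘ₗ
      LinearMap.lTensor E Δ) (fun x y => ?_) z
  simp [hr, hs]

theorem coassoc_diagOp (hr : ∀ b, Δ (r b) = diagOp r s (Δ b))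
    (hs : ∀ b, Δ (s b) = TensorProduct.map s s (Δ b)) {b : E}
    (hb : TensorProduct.assoc R E E E (LinearMap.rTensor E Δ (Δ b)) = LinearMap.lTensor E Δ (Δ b)) :
    TensorProduct.assoc R E E E (LinearMap.rTensor E Δ (Δ (r b))) =
      LinearMap.lTensor E Δ (Δ (r b)) := by
  rw [hr, assoc_rTensor_diagOp hr, lTensor_diagOp hr hs, hb]

/-- The counit kills the values of `r`, so only the summand with `r` on the second factor survives.
For the right counit it is the other summand, and the counit then meets `s`. -/
theorem counit_left_diagOp (hεr : ∀ b, ε (r b) = 0) (hr : ∀ b, Δ (r b) = diagOp r s (Δ b)) {b : E}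
    (hb : TensorProduct.lid R E (LinearMap.rTensor E ε (Δ b)) = b) :
    TensorProduct.lid R E (LinearMap.rTensor E ε (Δ (r b))) = r b := by
  conv_rhs => rw [← hb]
  rw [hr]
  refine eq_of_tmul ((TensorProduct.lid R E).toLinearMap ∘ₗ LinearMap.rTensor E ε ∘ₗ diagOp r s)
    (r ∘ₗ (TensorProduct.lid R E).toLinearMap ∘ₗ LinearMap.rTensor E ε) (fun x y => ?_) (Δ b)
  simp [hεr]

theorem counit_right_diagOp (hεr : ∀ b, ε (r b) = 0) (hεs : ∀ b, ε (s b) = ε b)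
    (hr : ∀ b, Δ (r b) = diagOp r s (Δ b)) {b : E}
    (hb : TensorProduct.rid R E (LinearMap.lTensor E ε (Δ b)) = b) :
    TensorProduct.rid R E (LinearMap.lTensor E ε (Δ (r b))) = r b := by
  conv_rhs => rw [← hb]
  rw [hr]
  refine eq_of_tmul ((TensorProduct.rid R E).toLinearMap ∘ₗ LinearMap.lTensor E ε ∘ₗ diagOp r s)
    (r ∘ₗ (TensorProduct.rid R E).toLinearMap ∘ₗ LinearMap.lTensor E ε) (fun x y => ?_) (Δ b)
  simp [hεr, hεs]

/-- Coassociativity propagates along a homotopy `h` with `Δ (h b) = h b ⊗ e + (s ⊗ h) (Δ b)`. -/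
theorem coassoc_homotopy (he : Δ e = e ⊗ₜ e)
    (hh : ∀ b, Δ (h b) = h b ⊗ₜ e + TensorProduct.map s h (Δ b))
    (hs : ∀ b, Δ (s b) = TensorProduct.map s s (Δ b)) {b : E}
    (hb : TensorProduct.assoc R E E E (LinearMap.rTensor E Δ (Δ b)) = LinearMap.lTensor E Δ (Δ b)) :
    TensorProduct.assoc R E E E (LinearMap.rTensor E Δ (Δ (h b))) =
      LinearMap.lTensor E Δ (Δ (h b)) := by
  have h1 : ∀ z : E ⊗[R] E, TensorProduct.assoc R E E E
      (LinearMap.rTensor E Δ (TensorProduct.map s h z)) = TensorProduct.map s (TensorProduct.map s h)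
        (TensorProduct.assoc R E E E (LinearMap.rTensor E Δ z)) := by
    intro z
    refine eq_of_tmul ((TensorProduct.assoc R E E E).toLinearMap ∘ₗ LinearMap.rTensor E Δ ∘ₗ
      TensorProduct.map s h) (TensorProduct.map s (TensorProduct.map s h) ∘ₗ
        (TensorProduct.assoc R E E E).toLinearMap ∘ₗ LinearMap.rTensor E Δ) (fun x y => ?_) z
    simp only [LinearMap.comp_apply, TensorProduct.map_tmul, LinearMap.rTensor_tmul, hs]
    generalize Δ x = w
    refine eq_of_tmul ((TensorProduct.assoc R E E E).toLinearMap ∘ₗ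
        (TensorProduct.mk R _ E).flip (h y) ∘ₗ TensorProduct.map s s)
      (TensorProduct.map s (TensorProduct.map s h) ∘ₗ
        (TensorProduct.assoc R E E E).toLinearMap ∘ₗ (TensorProduct.mk R _ E).flip y)
      (fun u v => ?_) w
    simp
  -- The term h y ⊗ e of Δ (h y) yields the extra summand (s ⊗ h) z ⊗ e. In the other bracketing it
  -- comes from splitting h b in h b ⊗ e.
  have h2 : ∀ z : E ⊗[R] E, LinearMap.lTensor E Δ (TensorProduct.map s h z) =
      TensorProduct.assoc R E E E (TensorProduct.map s h z ⊗ₜ e) +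
        TensorProduct.map s (TensorProduct.map s h) (LinearMap.lTensor E Δ z) := by
    intro z
    refine eq_of_tmul (LinearMap.lTensor E Δ ∘ₗ TensorProduct.map s h)
      ((TensorProduct.assoc R E E E).toLinearMap ∘ₗ (TensorProduct.mk R _ E).flip e ∘ₗ
        TensorProduct.map s h + TensorProduct.map s (TensorProduct.map s h) ∘ₗ
          LinearMap.lTensor E Δ) (fun x y => ?_) z
    simp [hh, TensorProduct.tmul_add]
  rw [hh, map_add, map_add, map_add, h1, h2, hb, LinearMap.rTensor_tmul, LinearMap.lTensor_tmul,
    hh, he, TensorProduct.add_tmul, map_add, TensorProduct.assoc_tmul, add_assoc]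

theorem counit_left_homotopy (hεh : ∀ b, ε (h b) = 0) (hεs : ∀ b, ε (s b) = ε b)
    (hh : ∀ b, Δ (h b) = h b ⊗ₜ e + TensorProduct.map s h (Δ b)) {b : E}
    (hb : TensorProduct.lid R E (LinearMap.rTensor E ε (Δ b)) = b) :
    TensorProduct.lid R E (LinearMap.rTensor E ε (Δ (h b))) = h b := by
  conv_rhs => rw [← hb]
  rw [hh, map_add, LinearMap.rTensor_tmul, hεh, TensorProduct.zero_tmul, zero_add]
  refine eq_of_tmul ((TensorProduct.lid R E).toLinearMap ∘ₗ LinearMap.rTensor E ε ∘ₗ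
    TensorProduct.map s h)
    (h ∘ₗ (TensorProduct.lid R E).toLinearMap ∘ₗ LinearMap.rTensor E ε) (fun x y => ?_) (Δ b)
  simp [hεs]

/-- The counit kills every second factor of the form h y, so h b ⊗ e alone contributes. No induction
hypothesis on `b` is involved. -/
theorem counit_right_homotopy (hεh : ∀ b, ε (h b) = 0) (hεe : ε e = 1)
    (hh : ∀ b, Δ (h b) = h b ⊗ₜ e + TensorProduct.map s h (Δ b)) (b : E) :
    TensorProduct.rid R E (LinearMap.lTensor E ε (Δ (h b))) = h b := by
  rw [hh, map_add, LinearMap.lTensor_tmul, hεe, map_add, TensorProduct.rid_tmul, one_smul,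
    add_eq_left]
  refine eq_of_tmul ((TensorProduct.rid R E).toLinearMap ∘ₗ LinearMap.lTensor E ε ∘ₗ
    TensorProduct.map s h) 0 (fun x y => ?_) (Δ b)
  simp [hεh]

/-- The Cartan type identity `D r = r D + Y s` passes to the tensor square. -/
theorem codiffOp_diagOp {Y : E →ₗ[R] E} (hD : ∀ b, D (r b) = r (D b) + Y (s b))
    (hsr : ∀ b, s (r b) = -r (s b)) (hsD : ∀ b, D (s b) = -s (D b)) (z : E ⊗[R] E) :
    codiffOp s D (diagOp r s z) =
      diagOp r s (codiffOp s D z) + diagOp Y LinearMap.id (TensorProduct.map s s z) := by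
  refine eq_of_tmul (codiffOp s D ∘ₗ diagOp r s) (diagOp r s ∘ₗ codiffOp s D +
    diagOp Y LinearMap.id ∘ₗ TensorProduct.map s s) (fun x y => ?_) z
  simp only [LinearMap.comp_apply, LinearMap.add_apply, diagOp_tmul, codiffOp_tmul, map_add,
    TensorProduct.map_tmul, hD, hsr, hsD, TensorProduct.add_tmul, TensorProduct.tmul_add,
    TensorProduct.neg_tmul, TensorProduct.tmul_neg, LinearMap.id_apply]
  abel

/-- The relation D r = r D + Y s holds on E and, by `codiffOp_diagOp`, for the diagonal operators on
the tensor square. Since Δ intertwines r, s and Y with their diagonal versions, the two expansions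
match term by term. -/
theorem coderivation_diagOp {Y : E →ₗ[R] E} (hD : ∀ b, D (r b) = r (D b) + Y (s b))
    (hsr : ∀ b, s (r b) = -r (s b)) (hsD : ∀ b, D (s b) = -s (D b))
    (hr : ∀ b, Δ (r b) = diagOp r s (Δ b))
    (hs : ∀ b, Δ (s b) = TensorProduct.map s s (Δ b))
    (hY : ∀ b, Δ (Y b) = diagOp Y LinearMap.id (Δ b)) {b : E}
    (hb : Δ (D b) = codiffOp s D (Δ b)) : Δ (D (r b)) = codiffOp s D (Δ (r b)) := by
  rw [hD, map_add, hr, hr, hY, hs, codiffOp_diagOp hD hsr hsD, hb]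

/-- If -h contracts E onto the span of e, then s ⊗ h satisfies a similar relation on the tensor
square, with the counit applied to the second factor only. By the right counit law the correction on
Δ b is b ⊗ e, which cancels the -b ⊗ e coming from D (h b) ⊗ e. -/
theorem coderivation_homotopy (hD : ∀ b, D (h b) = -b + ε b • e - h (D b))
    (hs2 : ∀ b, s (s b) = b) (hsD : ∀ b, D (s b) = -s (D b))
    (he : Δ e = e ⊗ₜ e) (hh : ∀ b, Δ (h b) = h b ⊗ₜ e + TensorProduct.map s h (Δ b))
    (hDe : D e = 0)
    (hε : ∀ b, TensorProduct.rid R E (LinearMap.lTensor E ε (Δ b)) = b) {b : E}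
    (hb : Δ (D b) = codiffOp s D (Δ b)) : Δ (D (h b)) = codiffOp s D (Δ (h b)) := by
  -- Here s s = Id leaves x unchanged in x ⊗ D (h y), and D s = -s D gives the sign of the first
  -- summand.
  have h1 : ∀ z : E ⊗[R] E, codiffOp s D (TensorProduct.map s h z) =
      -TensorProduct.map s h (codiffOp s D z) - z +
        TensorProduct.rid R E (LinearMap.lTensor E ε z) ⊗ₜ e := by
    intro z
    refine eq_of_tmul (codiffOp s D ∘ₗ TensorProduct.map s h)
      (-TensorProduct.map s h ∘ₗ codiffOp s D - LinearMap.id +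
        (TensorProduct.mk R E E).flip e ∘ₗ (TensorProduct.rid R E).toLinearMap ∘ₗ
          LinearMap.lTensor E ε) (fun x y => ?_) z
    simp only [LinearMap.comp_apply, LinearMap.add_apply, LinearMap.sub_apply, LinearMap.neg_apply,
      codiffOp_tmul, map_add, TensorProduct.map_tmul, hD, hsD, hs2, TensorProduct.tmul_add,
      TensorProduct.tmul_sub, TensorProduct.neg_tmul, TensorProduct.tmul_neg, LinearMap.id_apply,
      LinearMap.lTensor_tmul, LinearEquiv.coe_coe, TensorProduct.rid_tmul, LinearMap.flip_apply,
      TensorProduct.mk_apply, TensorProduct.tmul_smul, TensorProduct.smul_tmul']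
    abel
  rw [hh, map_add, h1, ← hb, hε, codiffOp_tmul, hDe, TensorProduct.tmul_zero, add_zero, hD,
    map_sub, map_add, map_neg, map_smul, he, hh]
  simp only [TensorProduct.add_tmul, TensorProduct.sub_tmul, TensorProduct.neg_tmul,
    TensorProduct.smul_tmul']
  abel

end DiagOp

/-! ### The exterior Hopf algebra: rules for multiplication by a generator -/

section ExteriorRules

variable {R : Type*} [CommRing R] {g : Type*} [LieRing g] [LieAlgebra R g]

open ExteriorAlgebra (ι ιInv)

theorem ext_left_induction {P : ExteriorAlgebra R g → Prop} (h1 : P 1)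
    (hadd : ∀ a b, P a → P b → P (a + b)) (hsmul : ∀ (r : R) a, P a → P (r • a))
    (hmul : ∀ v a, P a → P (ι R v * a)) (a : ExteriorAlgebra R g) : P a := by
  induction a using CliffordAlgebra.left_induction with
  | algebraMap r => rw [Algebra.algebraMap_eq_smul_one]; exact hsmul r 1 h1
  | add a b ha hb => exact hadd a b ha hb
  | ι_mul a v ha => exact hmul v a ha

theorem ext_right_induction {P : ExteriorAlgebra R g → Prop} (h1 : P 1)
    (hadd : ∀ a b, P a → P b → P (a + b)) (hsmul : ∀ (r : R) a, P a → P (r • a))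
    (hmul : ∀ v a, P a → P (a * ι R v)) (a : ExteriorAlgebra R g) : P a := by
  induction a using CliffordAlgebra.right_induction with
  | algebraMap r => rw [Algebra.algebraMap_eq_smul_one]; exact hsmul r 1 h1
  | add a b ha hb => exact hadd a b ha hb
  | mul_ι v a ha => exact hmul v a ha

theorem ext_left_hom {X : Type*} [AddCommMonoid X] [Module R X] (f f' : ExteriorAlgebra R g →ₗ[R] X)
    (h1 : f 1 = f' 1) (hmul : ∀ v a, f a = f' a → f (ι R v * a) = f' (ι R v * a))
    (a : ExteriorAlgebra R g) : f a = f' a :=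
  ext_left_induction (P := fun a => f a = f' a) h1 (fun a b ha hb => by simp [ha, hb])
    (fun r a ha => by simp [ha]) hmul a

theorem ext_right_hom {X : Type*} [AddCommMonoid X] [Module R X]
    (f f' : ExteriorAlgebra R g →ₗ[R] X)
    (h1 : f 1 = f' 1) (hmul : ∀ v a, f a = f' a → f (a * ι R v) = f' (a * ι R v))
    (a : ExteriorAlgebra R g) : f a = f' a :=
  ext_right_induction (P := fun a => f a = f' a) h1 (fun a b ha hb => by simp [ha, hb])
    (fun r a ha => by simp [ha]) hmul a

@[simp]
theorem extSign_one : extSign R g 1 = 1 := by simp [extSign]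

@[simp]
theorem extSign_mul (a b : ExteriorAlgebra R g) :
    extSign R g (a * b) = extSign R g a * extSign R g b := by simp [extSign]

@[simp]
theorem extSign_ι (v : g) : extSign R g (ι R v) = -ι R v := by simp [extSign]

@[simp]
theorem extCounit_one : extCounit R g 1 = 1 := by simp [extCounit]

@[simp]
theorem extCounit_mul (a b : ExteriorAlgebra R g) :
    extCounit R g (a * b) = extCounit R g a * extCounit R g b := by simp [extCounit]

@[simp]
theorem extCounit_ι (v : g) : extCounit R g (ι R v) = 0 := by
  simp [extCounit, ExteriorAlgebra.algebraMapInv]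

@[simp]
theorem extCounit_extSign (a : ExteriorAlgebra R g) :
    extCounit R g (extSign R g a) = extCounit R g a := by
  refine ext_left_hom (extCounit R g ∘ₗ extSign R g) (extCounit R g) (by simp) (fun v a _ => ?_) a
  simp

@[simp]
theorem ιInv_ι (v : g) : ιInv (ι R v) = v := ExteriorAlgebra.ι_leftInverse v

/-- The map to the square-zero extension R ⊕ g is multiplicative; its components are the
augmentation and `ιInv`, so `ιInv` is a derivation over the augmentation. -/
theorem ιInv_mul (a b : ExteriorAlgebra R g) :
    ιInv (a * b) = extCounit R g a • ιInv b + extCounit R g b • ιInv a := by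
  let _ : Module Rᵐᵒᵖ g := Module.compHom _ ((RingHom.id R).fromOpposite mul_comm)
  have _ : IsCentralScalar R g := ⟨fun r m => rfl⟩
  have h : (TrivSqZeroExt.fstHom R R g).comp (ExteriorAlgebra.toTrivSqZeroExt (R := R) (M := g)) =
      ExteriorAlgebra.algebraMapInv := by
    ext x
    simp [ExteriorAlgebra.algebraMapInv]
  have h' : ∀ a : ExteriorAlgebra R g,
      (ExteriorAlgebra.toTrivSqZeroExt (R := R) (M := g) a).fst = extCounit R g a :=
    fun a => DFunLike.congr_fun h a
  change (ExteriorAlgebra.toTrivSqZeroExt (R := R) (M := g) (a * b)).snd =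
    extCounit R g a • (ExteriorAlgebra.toTrivSqZeroExt (R := R) (M := g) b).snd +
    extCounit R g b • (ExteriorAlgebra.toTrivSqZeroExt (R := R) (M := g) a).snd
  rw [map_mul, TrivSqZeroExt.snd_mul, h', h']
  simp

@[simp]
theorem ιInv_one : ιInv (1 : ExteriorAlgebra R g) = 0 := by
  have h := ιInv_mul (1 : ExteriorAlgebra R g) 1
  simpa using h

@[simp]
theorem ιInv_ι_mul (v : g) (a : ExteriorAlgebra R g) :
    ιInv (ι R v * a) = extCounit R g a • v := by simp [ιInv_mul]

@[simp]
theorem ιInv_mul_ι (v : g) (a : ExteriorAlgebra R g) :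
    ιInv (a * ι R v) = extCounit R g a • v := by simp [ιInv_mul]

theorem ι_mul_comm_extSign (v : g) (a : ExteriorAlgebra R g) :
    ι R v * a = extSign R g a * ι R v := by
  refine ext_left_hom (LinearMap.mulLeft R (ι R v)) (LinearMap.mulRight R (ι R v) ∘ₗ extSign R g)
    (by simp) (fun w a h => ?_) a
  simp only [LinearMap.mulLeft_apply, LinearMap.comp_apply, LinearMap.mulRight_apply] at h ⊢
  rw [extSign_mul, mul_assoc, ← h, extSign_ι, ← mul_assoc, ← mul_assoc,
    eq_neg_of_add_eq_zero_left (ExteriorAlgebra.ι_add_mul_swap v w), neg_mul, neg_mul,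
    neg_mul]

@[simp]
theorem extComul_one : extComul R g 1 = 1 ⊗ₜ 1 := by simp [extComul]

theorem extComul_ι_mul (v : g) (a : ExteriorAlgebra R g) :
    extComul R g (ι R v * a) = extComulStep R g v (extComul R g a) := by simp [extComul]

@[simp]
theorem extComulStep_tmul (v : g) (a b : ExteriorAlgebra R g) :
    extComulStep R g v (a ⊗ₜ b) = (ι R v * a) ⊗ₜ b + extSign R g a ⊗ₜ (ι R v * b) := rfl

theorem extComul_ι (v : g) : extComul R g (ι R v) = ι R v ⊗ₜ 1 + 1 ⊗ₜ ι R v := by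
  rw [← mul_one (ι R v), extComul_ι_mul]; simp

/-- The diagonal is built from left multiplications. On Λ ⊗ Λ the left operator of one generator
commutes with the right operator of another, so induction from the left yields the rule on the
right. -/
theorem extComul_mul_ι (v : g) (a : ExteriorAlgebra R g) :
    extComul R g (a * ι R v) =
      diagOp (LinearMap.mulRight R (ι R v)) (extSign R g) (extComul R g a) := by
  refine ext_left_hom (extComul R g ∘ₗ LinearMap.mulRight R (ι R v))
    (diagOp (LinearMap.mulRight R (ι R v)) (extSign R g) ∘ₗ extComul R g) ?_ (fun w a h => ?_) a
  · simp [extComul_ι]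
  simp only [LinearMap.comp_apply, LinearMap.mulRight_apply] at h ⊢
  rw [mul_assoc, extComul_ι_mul, h, extComul_ι_mul]
  refine eq_of_tmul (extComulStep R g w ∘ₗ diagOp (LinearMap.mulRight R (ι R v)) (extSign R g))
    (diagOp (LinearMap.mulRight R (ι R v)) (extSign R g) ∘ₗ extComulStep R g w)
    (fun x y => ?_) _
  simp [mul_assoc, TensorProduct.neg_tmul, TensorProduct.tmul_neg]
  abel

theorem extComul_extSign (a : ExteriorAlgebra R g) :
    extComul R g (extSign R g a) =
      TensorProduct.map (extSign R g) (extSign R g) (extComul R g a) := by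
  refine ext_left_hom (extComul R g ∘ₗ extSign R g)
    (TensorProduct.map (extSign R g) (extSign R g) ∘ₗ extComul R g) (by simp) (fun w a h => ?_) a
  simp only [LinearMap.comp_apply] at h ⊢
  rw [extSign_mul, extSign_ι, neg_mul, map_neg, extComul_ι_mul, extComul_ι_mul, h]
  refine eq_of_tmul (-(extComulStep R g w ∘ₗ TensorProduct.map (extSign R g) (extSign R g)))
    (TensorProduct.map (extSign R g) (extSign R g) ∘ₗ extComulStep R g w) (fun x y => ?_) _
  simp [TensorProduct.neg_tmul, TensorProduct.tmul_neg]
  abel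

theorem extComul_counit_left (a : ExteriorAlgebra R g) :
    TensorProduct.lid R _ (LinearMap.rTensor _ (extCounit R g) (extComul R g a)) = a := by
  refine ext_right_hom ((TensorProduct.lid R _).toLinearMap ∘ₗ
    LinearMap.rTensor _ (extCounit R g) ∘ₗ extComul R g) LinearMap.id (by simp) (fun v a h => ?_) a
  simp only [LinearMap.comp_apply, LinearMap.id_apply, LinearEquiv.coe_coe] at h ⊢
  exact counit_left_diagOp (r := LinearMap.mulRight R (ι R v)) (s := extSign R g) (by simp)
    (extComul_mul_ι v) h

theorem ιInv_extSign (a : ExteriorAlgebra R g) : ιInv (extSign R g a) = -ιInv a := by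
  refine ext_left_hom (ιInv ∘ₗ extSign R g) (-ιInv) (by simp) (fun w a _ => ?_) a
  simp

@[simp]
theorem extAct_one (Y : g) : extAct R g Y 1 = 0 := by simp [extAct, conv]

/-- In the diagonal of v a, the summand with v on the left contributes the bracket weighted by the
counit. The other summand contributes the recursive term: its sign from `extSign` cancels the one
from anticommuting two generators. -/
theorem extAct_ι_mul (Y v : g) (a : ExteriorAlgebra R g) :
    extAct R g Y (ι R v * a) = ι R ⁅v, Y⁆ * a + ι R v * extAct R g Y a := by
  conv_rhs => rw [← extComul_counit_left a]
  simp only [extAct, conv, LinearMap.coe_mk, AddHom.coe_mk, LinearMap.comp_apply,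
    extComul_counit_left a, extComul_ι_mul]
  -- Writing `a` through the counit makes both sides linear maps applied to the diagonal of `a`, so
  -- pure tensors suffice.
  conv_rhs => enter [1]; rw [← extComul_counit_left a]
  refine eq_of_tmul (LinearMap.mul' R _ ∘ₗ LinearMap.rTensor _ (ι R ∘ₗ (lieBilin R g).flip Y ∘ₗ
      ιInv) ∘ₗ extComulStep R g v)
    (LinearMap.mulLeft R (ι R ⁅v, Y⁆) ∘ₗ (TensorProduct.lid R _).toLinearMap ∘ₗ
      LinearMap.rTensor _ (extCounit R g) + LinearMap.mulLeft R (ι R v) ∘ₗ LinearMap.mul' R _ ∘ₗ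
      LinearMap.rTensor _ (ι R ∘ₗ (lieBilin R g).flip Y ∘ₗ ιInv)) (fun x y => ?_) _
  simp [ιInv_extSign, lieBilin, ← mul_assoc,
    eq_neg_of_add_eq_zero_left (ExteriorAlgebra.ι_add_mul_swap v ⁅ιInv x, Y⁆)]
  rw [← lie_skew Y (ιInv x), map_neg, neg_mul, neg_mul]

theorem extAct_ι (Y v : g) : extAct R g Y (ι R v) = ι R ⁅v, Y⁆ := by
  rw [← mul_one (ι R v), extAct_ι_mul]; simp

theorem extAct_mul (Y : g) (a b : ExteriorAlgebra R g) :
    extAct R g Y (a * b) = extAct R g Y a * b + a * extAct R g Y b := by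
  refine ext_left_hom (extAct R g Y ∘ₗ LinearMap.mulRight R b)
    (LinearMap.mulRight R b ∘ₗ extAct R g Y + LinearMap.mulRight R (extAct R g Y b)) (by simp)
    (fun v a h => ?_) a
  simp only [LinearMap.comp_apply, LinearMap.add_apply, LinearMap.mulRight_apply] at h ⊢
  rw [mul_assoc, extAct_ι_mul, h, extAct_ι_mul]
  noncomm_ring

theorem extAct_mul_ι (Y v : g) (a : ExteriorAlgebra R g) :
    extAct R g Y (a * ι R v) = extAct R g Y a * ι R v + a * ι R ⁅v, Y⁆ := by
  rw [extAct_mul, extAct_ι]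

theorem extCounit_extAct (Y : g) (a : ExteriorAlgebra R g) :
    extCounit R g (extAct R g Y a) = 0 := by
  refine ext_left_hom (extCounit R g ∘ₗ extAct R g Y) 0 (by simp) (fun v a h => ?_) a
  simp [extAct_ι_mul]

theorem extAct_extSign (Y : g) (a : ExteriorAlgebra R g) :
    extAct R g Y (extSign R g a) = extSign R g (extAct R g Y a) := by
  refine ext_left_hom (extAct R g Y ∘ₗ extSign R g) (extSign R g ∘ₗ extAct R g Y) (by simp)
    (fun v a h => ?_) a
  simp only [LinearMap.comp_apply] at h ⊢
  simp [extAct_ι_mul, h]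
  abel

theorem extAct_comm (Y Z : g) (a : ExteriorAlgebra R g) :
    extAct R g Z (extAct R g Y a) - extAct R g Y (extAct R g Z a) = extAct R g ⁅Y, Z⁆ a := by
  refine ext_left_hom (extAct R g Z ∘ₗ extAct R g Y - extAct R g Y ∘ₗ extAct R g Z)
    (extAct R g ⁅Y, Z⁆) (by simp) (fun v a h => ?_) a
  simp only [LinearMap.comp_apply, LinearMap.sub_apply] at h ⊢
  simp only [extAct_ι_mul, map_add, ← h, mul_sub, leibniz_lie v Y Z, add_mul]
  rw [show ⁅Y, ⁅v, Z⁆⁆ = -⁅⁅v, Z⁆, Y⁆ from (lie_skew _ _).symm, map_neg]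
  noncomm_ring

@[simp]
theorem extBoundary_one : extBoundary R g 1 = 0 := by
  simp [extBoundary, conv]

/-- Cartan type recursion for ∂. The component β of the coderivation sees only words of length two,
so contracting it with v leaves the bracket of v with the linear part of the rest, which is the
convolution kernel of the action of v. -/
theorem extBoundary_ι_mul (v : g) (a : ExteriorAlgebra R g) :
    extBoundary R g (ι R v * a) = -(ι R v * extBoundary R g a) + extAct R g v a := by
  set β : ExteriorAlgebra R g →ₗ[R] ExteriorAlgebra R g := ExteriorAlgebra.liftAlternating
      (Pi.single (M := fun i : ℕ => g [⋀^Fin i]→ₗ[R] ExteriorAlgebra R g) 2 (brAlt R g)) with hβ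
  have h0 : β 1 = 0 := by simp [hβ]
  have hvw : ∀ (v w : g) b, β (ι R v * (ι R w * b)) = extCounit R g b • ι R ⁅w, v⁆ := by
    intro v w b
    rw [hβ, ExteriorAlgebra.liftAlternating_ι_mul, ExteriorAlgebra.liftAlternating_ι_mul]
    refine ext_left_hom _ ((extCounit R g).smulRight (ι R ⁅w, v⁆)) ?_ (fun u b _ => ?_) b
    · simp [brAlt]
    · rw [ExteriorAlgebra.liftAlternating_ι_mul]
      -- Three contractions shift the index by three, past the only non-zero entry at index 2.
      have hz : (fun i : ℕ => (((((Pi.single (M := fun i : ℕ => g [⋀^Fin i]→ₗ[R]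
          ExteriorAlgebra R g) 2 (brAlt R g)) i.succ.succ.succ).curryLeft v).curryLeft w).curryLeft
          u)) = 0 := by
        funext i
        rw [Pi.single_eq_of_ne (by omega)]
        ext
        simp
      rw [hz]
      simp
  have hv : ∀ (v : g) b, β (ι R v * b) = ι R ⁅ιInv b, v⁆ := by
    intro v b
    refine ext_left_hom (β ∘ₗ LinearMap.mulLeft R (ι R v)) (ι R ∘ₗ (lieBilin R g).flip v ∘ₗ ιInv)
      ?_ (fun u b _ => ?_) b
    · simp [hβ]
    · simp [hvw, lieBilin]
  -- β lives on even words, so it does not see the sign operator.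
  have hσ : ∀ b, β (extSign R g b) = β b := by
    intro b
    refine ext_left_hom (β ∘ₗ extSign R g) β (by simp) (fun u b _ => ?_) b
    simp [hv, ιInv_extSign]
    rw [← lie_skew u (ιInv b), map_neg, neg_neg]
  -- The values of β lie in sg, hence anticommute with sv.
  have hcomm : ∀ b, β b * ι R v = -(ι R v * β b) := by
    intro b
    refine ext_left_hom (LinearMap.mulRight R (ι R v) ∘ₗ β) (-LinearMap.mulLeft R (ι R v) ∘ₗ β)
      (by simp [h0]) (fun u b _ => ?_) b
    simp [hv, eq_neg_of_add_eq_zero_left (ExteriorAlgebra.ι_add_mul_swap ⁅ιInv b, u⁆ v)]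
  change LinearMap.mul' R _ (LinearMap.rTensor _ β (extComul R g (ι R v * a))) =
    -(ι R v * LinearMap.mul' R _ (LinearMap.rTensor _ β (extComul R g a))) +
      LinearMap.mul' R _ (LinearMap.rTensor _ (ι R ∘ₗ (lieBilin R g).flip v ∘ₗ ιInv)
        (extComul R g a))
  rw [extComul_ι_mul]
  refine eq_of_tmul (LinearMap.mul' R _ ∘ₗ LinearMap.rTensor _ β ∘ₗ extComulStep R g v)
    (-(LinearMap.mulLeft R (ι R v) ∘ₗ LinearMap.mul' R _ ∘ₗ LinearMap.rTensor _ β) +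
      LinearMap.mul' R _ ∘ₗ LinearMap.rTensor _ (ι R ∘ₗ (lieBilin R g).flip v ∘ₗ ιInv))
    (fun x y => ?_) _
  simp only [LinearMap.comp_apply, extComulStep_tmul, map_add, LinearMap.rTensor_tmul,
    LinearMap.mul'_apply, hv, hσ, LinearMap.add_apply, LinearMap.neg_apply,
    LinearMap.mulLeft_apply, ← mul_assoc, hcomm, lieBilin, LinearMap.flip_apply,
    LinearMap.mk₂_apply]
  noncomm_ring

theorem extBoundary_ι (v : g) : extBoundary R g (ι R v) = 0 := by
  rw [← mul_one (ι R v), extBoundary_ι_mul]; simp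

/-- The form of the recursion that fits right modules; through `twistedD_actOdd` it governs every
differential below. -/
theorem extBoundary_mul_ι (v : g) (a : ExteriorAlgebra R g) :
    extBoundary R g (a * ι R v) =
      extBoundary R g a * ι R v + extAct R g v (extSign R g a) := by
  refine ext_left_hom (extBoundary R g ∘ₗ LinearMap.mulRight R (ι R v))
    (LinearMap.mulRight R (ι R v) ∘ₗ extBoundary R g + extAct R g v ∘ₗ extSign R g)
    (by simp [extBoundary_ι]) (fun w a h => ?_) a
  simp only [LinearMap.comp_apply, LinearMap.add_apply, LinearMap.mulRight_apply] at h ⊢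
  -- The terms left over are a s[v, w] and -s[w, v] σ(a), with σ the sign operator; graded
  -- commutativity and antisymmetry of the bracket identify them.
  rw [mul_assoc, extBoundary_ι_mul, h, extBoundary_ι_mul, extAct_mul_ι, extSign_mul, extSign_ι,
    neg_mul, map_neg, extAct_ι_mul, ← lie_skew v w, map_neg, mul_neg,
    ι_mul_comm_extSign ⁅w, v⁆, extSign_extSign]
  noncomm_ring

theorem extBoundary_extSign (a : ExteriorAlgebra R g) :
    extBoundary R g (extSign R g a) = -extSign R g (extBoundary R g a) := by
  refine ext_left_hom (extBoundary R g ∘ₗ extSign R g) (-(extSign R g ∘ₗ extBoundary R g))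
    (by simp) (fun w a h => ?_) a
  simp only [LinearMap.comp_apply, LinearMap.neg_apply] at h ⊢
  rw [extSign_mul, extSign_ι, neg_mul, map_neg, extBoundary_ι_mul, h, extBoundary_ι_mul, map_add,
    map_neg, extSign_mul, extSign_ι, extAct_extSign]
  noncomm_ring

theorem ιInv_extAct (Y : g) (a : ExteriorAlgebra R g) :
    ιInv (extAct R g Y a) = ⁅ιInv a, Y⁆ := by
  refine ext_left_hom (ιInv ∘ₗ extAct R g Y) ((lieBilin R g).flip Y ∘ₗ ιInv) (by simp)
    (fun v a h => ?_) a
  simp [extAct_ι_mul, extCounit_extAct, lieBilin]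

end ExteriorRules

/-! ### Further propagation steps: signs, the action of g, the square of D -/

section DiagOpSteps

variable {R : Type*} [CommRing R] {E : Type*} [AddCommGroup E] [Module R E]
  {Δ : E →ₗ[R] E ⊗[R] E} {r r' s D Y Y' Z : E →ₗ[R] E}

theorem comul_sign_diagOp (hr : ∀ b, Δ (r b) = diagOp r s (Δ b)) (hsr : ∀ b, s (r b) = -r (s b))
    {b : E} (hb : Δ (s b) = TensorProduct.map s s (Δ b)) :
    Δ (s (r b)) = TensorProduct.map s s (Δ (r b)) := by
  rw [hsr, map_neg, hr, hr, hb]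
  refine eq_of_tmul (-(diagOp r s ∘ₗ TensorProduct.map s s)) (TensorProduct.map s s ∘ₗ diagOp r s)
    (fun x y => ?_) _
  simp only [LinearMap.neg_apply, LinearMap.comp_apply, TensorProduct.map_tmul, diagOp_tmul, hsr,
    map_add, TensorProduct.neg_tmul, TensorProduct.tmul_neg]
  abel

/-- In use, `r` and `r'` are right multiplication by v and by [v, Y]. The commutator of the diagonal
operators of Y and r is then the diagonal operator of r'. -/
theorem comul_act_diagOp (hr : ∀ b, Δ (r b) = diagOp r s (Δ b))
    (hr' : ∀ b, Δ (r' b) = diagOp r' s (Δ b)) (hYr : ∀ b, Y (r b) = r (Y b) + r' b)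
    (hsY : ∀ b, s (Y b) = Y (s b)) {b : E} (hb : Δ (Y b) = diagOp Y LinearMap.id (Δ b)) :
    Δ (Y (r b)) = diagOp Y LinearMap.id (Δ (r b)) := by
  rw [hYr, map_add, hr, hr, hr', hb]
  refine eq_of_tmul (diagOp r s ∘ₗ diagOp Y LinearMap.id + diagOp r' s)
    (diagOp Y LinearMap.id ∘ₗ diagOp r s) (fun x y => ?_) _
  simp only [LinearMap.add_apply, LinearMap.comp_apply, diagOp_tmul, hsY, hYr,
    map_add, TensorProduct.add_tmul, TensorProduct.tmul_add, LinearMap.id_apply]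
  abel

theorem map_sign_diagOp (hsr : ∀ b, s (r b) = -r (s b)) (z : E ⊗[R] E) :
    TensorProduct.map s s (diagOp r s z) = diagOp (-r) s (TensorProduct.map s s z) := by
  refine eq_of_tmul (TensorProduct.map s s ∘ₗ diagOp r s)
    (diagOp (-r) s ∘ₗ TensorProduct.map s s) (fun x y => ?_) z
  simp [hsr]

/-- Serves `awComulT_barSign`: both summands of the recursion for the Alexander–Whitney diagonal
change sign in the same way, because h anticommutes with s. -/
theorem smul_homotopy_step {h : E →ₗ[R] E} (hsh : ∀ b, s (h b) = -h (s b)) {e x y : E}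
    (he : s e = e) (hx : s x = (-1 : R) • y) (z : E ⊗[R] E) :
    (-1 : R) • (y ⊗ₜ e + TensorProduct.map s h (TensorProduct.map s s z)) =
      TensorProduct.map s s (x ⊗ₜ e + TensorProduct.map s h z) := by
  rw [map_add, TensorProduct.map_tmul, hx, he, smul_add, TensorProduct.smul_tmul']
  congr 1
  refine eq_of_tmul ((-1 : R) • TensorProduct.map s h ∘ₗ TensorProduct.map s s)
    (TensorProduct.map s s ∘ₗ TensorProduct.map s h) (fun x y => ?_) z
  simp [hsh, TensorProduct.tmul_neg]

theorem comul_act_homotopy {h : E →ₗ[R] E} {e : E} (hYe : Y e = 0)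
    (hYh : ∀ b, Y (h b) = h (Y b)) (hsY : ∀ b, s (Y b) = Y (s b))
    (hh : ∀ b, Δ (h b) = h b ⊗ₜ e + TensorProduct.map s h (Δ b)) {b : E}
    (hb : Δ (Y b) = diagOp Y LinearMap.id (Δ b)) :
    Δ (Y (h b)) = diagOp Y LinearMap.id (Δ (h b)) := by
  rw [hYh, hh, hh, hb, map_add, diagOp_tmul, hYe, TensorProduct.tmul_zero, add_zero,
    LinearMap.id_apply, hYh]
  congr 1
  refine eq_of_tmul (TensorProduct.map s h ∘ₗ diagOp Y LinearMap.id)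
    (diagOp Y LinearMap.id ∘ₗ TensorProduct.map s h) (fun x y => ?_) _
  simp [hsY, hYh]

/-- The cross terms Y s D b and Y D s b cancel because D and s anticommute. -/
theorem sq_diff_step (hD : ∀ b, D (r b) = r (D b) + Y (s b)) (hsD : ∀ b, D (s b) = -s (D b))
    (hDY : ∀ b, D (Y b) = Y (D b)) {b : E} (hb : D (D b) = 0) : D (D (r b)) = 0 := by
  rw [hD, map_add, hD, hb, hDY, hsD]
  simp

theorem diff_sign_step (hD : ∀ b, D (r b) = r (D b) + Y (s b)) (hsr : ∀ b, s (r b) = -r (s b))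
    (hsY : ∀ b, s (Y b) = Y (s b)) {b : E} (hb : D (s b) = -s (D b)) :
    D (s (r b)) = -s (D (r b)) := by
  rw [hsr, map_neg, hD, hb, hD, map_add, hsr, hsY, map_neg]

/-- Commuting `Z` past D r = r D + Y s produces the same relation for the pair `r'`, `Y'` attached
to the bracketed generator; `hZY`, the module property of the action, makes the error terms agree.
-/
theorem diff_act_step (hD : ∀ b, D (r b) = r (D b) + Y (s b))
    (hD' : ∀ b, D (r' b) = r' (D b) + Y' (s b)) (hZr : ∀ b, Z (r b) = r (Z b) + r' b)
    (hsZ : ∀ b, s (Z b) = Z (s b)) (hZY : ∀ b, Z (Y b) - Y (Z b) = Y' b) {b : E}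
    (hb : D (Z b) = Z (D b)) : D (Z (r b)) = Z (D (r b)) := by
  rw [hZr, map_add, hD, hD', hD, map_add, hZr, hb, hsZ, ← hZY]
  abel

end DiagOpSteps

/-! ### Modules C ⊗ Λ: actions, differential and diagonal -/

section TwistedRules

variable {R : Type*} [CommRing R] {g : Type*} [LieRing g] [LieAlgebra R g]
variable {C : Type*} [AddCommGroup C] [Module R C]

open ExteriorAlgebra (ι ιInv)

@[simp]
theorem actOdd_tmul (v : g) (c : C) (a : ExteriorAlgebra R g) :
    actOdd R g C v (c ⊗ₜ a) = c ⊗ₜ (a * ι R v) := rfl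

@[simp]
theorem actEven_tmul (act : g →ₗ[R] C →ₗ[R] C) (Y : g) (c : C) (a : ExteriorAlgebra R g) :
    actEven R g act Y (c ⊗ₜ a) = act Y c ⊗ₜ a + c ⊗ₜ extAct R g Y a := rfl

@[simp]
theorem tensorSign_tmul (σ : C →ₗ[R] C) (c : C) (a : ExteriorAlgebra R g) :
    tensorSign R g σ (c ⊗ₜ a) = σ c ⊗ₜ extSign R g a := rfl

@[simp]
theorem tensorCounit_tmul (ε : C →ₗ[R] R) (c : C) (a : ExteriorAlgebra R g) :
    tensorCounit R g ε (c ⊗ₜ a) = ε c * extCounit R g a := rfl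

/-- Linear maps on `C ⊗ Λ` agree if they agree on `C ⊗ 1` and agreement is preserved by the
right multiplications with the generators of `Λ`. -/
theorem tensor_hom {X : Type*} [AddCommMonoid X] [Module R X]
    (f f' : C ⊗[R] ExteriorAlgebra R g →ₗ[R] X) (h1 : ∀ c : C, f (c ⊗ₜ 1) = f' (c ⊗ₜ 1))
    (hmul : ∀ v b, f b = f' b → f (actOdd R g C v b) = f' (actOdd R g C v b))
    (b : C ⊗[R] ExteriorAlgebra R g) : f b = f' b := by
  refine eq_of_tmul f f' (fun c a => ?_) b
  exact ext_right_hom (f ∘ₗ TensorProduct.mk R C _ c) (f' ∘ₗ TensorProduct.mk R C _ c) (h1 c)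
    (fun v a h => hmul v _ h) a

theorem actEven_actOdd (act : g →ₗ[R] C →ₗ[R] C) (Y Z : g) (b : C ⊗[R] ExteriorAlgebra R g) :
    actEven R g act Z (actOdd R g C Y b) =
      actOdd R g C Y (actEven R g act Z b) + actOdd R g C ⁅Y, Z⁆ b := by
  refine eq_of_tmul (actEven R g act Z ∘ₗ actOdd R g C Y)
    (actOdd R g C Y ∘ₗ actEven R g act Z + actOdd R g C ⁅Y, Z⁆) (fun c a => ?_) b
  simp [extAct_mul_ι, TensorProduct.tmul_add, add_assoc]

theorem actOdd_anticomm (Y Z : g) (b : C ⊗[R] ExteriorAlgebra R g) :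
    actOdd R g C Z (actOdd R g C Y b) + actOdd R g C Y (actOdd R g C Z b) = 0 := by
  refine eq_of_tmul (actOdd R g C Z ∘ₗ actOdd R g C Y + actOdd R g C Y ∘ₗ actOdd R g C Z) 0
    (fun c a => ?_) b
  simp [mul_assoc, ← TensorProduct.tmul_add, ← mul_add, ExteriorAlgebra.ι_add_mul_swap]

theorem tensorSign_actOdd (σ : C →ₗ[R] C) (v : g) (b : C ⊗[R] ExteriorAlgebra R g) :
    tensorSign R g σ (actOdd R g C v b) = -actOdd R g C v (tensorSign R g σ b) := by
  refine eq_of_tmul (tensorSign R g σ ∘ₗ actOdd R g C v) (-(actOdd R g C v ∘ₗ tensorSign R g σ))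
    (fun c a => ?_) b
  simp [TensorProduct.tmul_neg]

theorem tensorSign_tensorSign {σ : C →ₗ[R] C} (hσ : ∀ c, σ (σ c) = c)
    (b : C ⊗[R] ExteriorAlgebra R g) : tensorSign R g σ (tensorSign R g σ b) = b := by
  refine eq_of_tmul (tensorSign R g σ ∘ₗ tensorSign R g σ) LinearMap.id (fun c a => ?_) b
  simp [hσ, extSign_extSign]

theorem tensorSign_actEven {σ : C →ₗ[R] C} {act : g →ₗ[R] C →ₗ[R] C} {Y : g}
    (h : ∀ c, σ (act Y c) = act Y (σ c)) (b : C ⊗[R] ExteriorAlgebra R g) :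
    tensorSign R g σ (actEven R g act Y b) = actEven R g act Y (tensorSign R g σ b) := by
  refine eq_of_tmul (tensorSign R g σ ∘ₗ actEven R g act Y)
    (actEven R g act Y ∘ₗ tensorSign R g σ) (fun c a => ?_) b
  simp [h, extAct_extSign]

theorem actEven_comm {act : g →ₗ[R] C →ₗ[R] C}
    (h : ∀ Y Z c, act Z (act Y c) - act Y (act Z c) = act ⁅Y, Z⁆ c) (Y Z : g)
    (b : C ⊗[R] ExteriorAlgebra R g) :
    actEven R g act Z (actEven R g act Y b) - actEven R g act Y (actEven R g act Z b) =
      actEven R g act ⁅Y, Z⁆ b := by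
  refine eq_of_tmul (actEven R g act Z ∘ₗ actEven R g act Y -
    actEven R g act Y ∘ₗ actEven R g act Z) (actEven R g act ⁅Y, Z⁆) (fun c a => ?_) b
  simp only [LinearMap.sub_apply, LinearMap.comp_apply, actEven_tmul, map_add, ← h, ← extAct_comm,
    TensorProduct.sub_tmul, TensorProduct.tmul_sub]
  abel

section Differential

variable (σ δ : C →ₗ[R] C) (split : C →ₗ[R] C ⊗[R] ExteriorAlgebra R g)
  (act : g →ₗ[R] C →ₗ[R] C)

theorem twistedD_tmul (c : C) (a : ExteriorAlgebra R g) :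
    twistedD R g σ δ split act (c ⊗ₜ a) = δ c ⊗ₜ a -
      LinearMap.lTensor C (LinearMap.mulRight R a) (LinearMap.rTensor _ σ (split c)) +
      σ c ⊗ₜ extBoundary R g a + TensorProduct.lift ((TensorProduct.mk R C _).compl₁₂
        (act.flip (σ c) ∘ₗ ιInv) LinearMap.id) (extComul R g a) := by
  simp only [twistedD, LinearMap.add_apply, LinearMap.sub_apply, LinearMap.rTensor_tmul,
    TensorProduct.map_tmul, LinearMap.comp_apply]
  congr 1
  · congr 2
    generalize LinearMap.rTensor _ σ (split c) = z
    refine eq_of_tmul (LinearMap.lTensor C (LinearMap.mul' R (ExteriorAlgebra R g)) ∘ₗ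
      (TensorProduct.assoc R C (ExteriorAlgebra R g) (ExteriorAlgebra R g)).toLinearMap ∘ₗ
      (TensorProduct.mk R _ _).flip a) (LinearMap.lTensor C (LinearMap.mulRight R a))
      (fun x y => ?_) z
    simp
  · generalize extComul R g a = z
    refine eq_of_tmul (LinearMap.rTensor _ (TensorProduct.lift (act.flip.compl₂ ιInv)) ∘ₗ
      (TensorProduct.assoc R C (ExteriorAlgebra R g) (ExteriorAlgebra R g)).symm.toLinearMap ∘ₗ
      TensorProduct.mk R _ _ (σ c)) _ (fun x y => ?_) z
    simp

theorem twistedD_tmul_one (c : C) :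
    twistedD R g σ δ split act (c ⊗ₜ 1) = δ c ⊗ₜ 1 - LinearMap.rTensor _ σ (split c) := by
  rw [twistedD_tmul]
  simp [LinearMap.mulRight_one]

/-- The cap product and δ commute with right multiplication. The rule for ∂ contributes the action
of v on Λ, and the summand of the diagonal in which v alone reaches g contributes the action of v on
C. The argument works for arbitrary σ, δ, `split` and `act`. -/
theorem twistedD_actOdd (v : g) (b : C ⊗[R] ExteriorAlgebra R g) :
    twistedD R g σ δ split act (actOdd R g C v b) =
      actOdd R g C v (twistedD R g σ δ split act b) +
        actEven R g act v (tensorSign R g σ b) := by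
  refine eq_of_tmul (twistedD R g σ δ split act ∘ₗ actOdd R g C v)
    (actOdd R g C v ∘ₗ twistedD R g σ δ split act + actEven R g act v ∘ₗ tensorSign R g σ)
    (fun c a => ?_) b
  simp only [LinearMap.comp_apply, actOdd_tmul, LinearMap.add_apply, tensorSign_tmul,
    actEven_tmul, twistedD_tmul, map_add, map_sub, extBoundary_mul_ι, TensorProduct.tmul_add,
    extComul_mul_ι]
  have h1 : ∀ z : C ⊗[R] ExteriorAlgebra R g,
      LinearMap.lTensor C (LinearMap.mulRight R (a * ι R v)) z =
      actOdd R g C v (LinearMap.lTensor C (LinearMap.mulRight R a) z) := by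
    refine eq_of_tmul _ (actOdd R g C v ∘ₗ LinearMap.lTensor C (LinearMap.mulRight R a))
      (fun x y => ?_)
    simp [mul_assoc]
  set T := TensorProduct.lift ((TensorProduct.mk R C (ExteriorAlgebra R g)).compl₁₂
        (act.flip (σ c) ∘ₗ ιInv) LinearMap.id) with hT
  have h2 : ∀ z, T (diagOp (LinearMap.mulRight R (ι R v)) (extSign R g) z) =
      actOdd R g C v (T z) + act v (σ c) ⊗ₜ extSign R g
        (TensorProduct.lid R _ (LinearMap.rTensor _ (extCounit R g) z)) := by
    refine eq_of_tmul (T ∘ₗ diagOp (LinearMap.mulRight R (ι R v)) (extSign R g))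
      (actOdd R g C v ∘ₗ T + TensorProduct.mk R C _ (act v (σ c)) ∘ₗ extSign R g ∘ₗ
        (TensorProduct.lid R _).toLinearMap ∘ₗ LinearMap.rTensor _ (extCounit R g))
      (fun x y => ?_)
    simp [hT, TensorProduct.smul_tmul']
    abel
  rw [h1, h2, extComul_counit_left]
  abel

end Differential

section Comul

variable (σ : C →ₗ[R] C)

@[simp]
theorem braid_tmul_one (c : C) : braid R g σ (c ⊗ₜ 1) = 1 ⊗ₜ c := by
  simp [braid]

/-- Each generator that moves past C applies σ once, whether it is taken from the left or from the
right end of the word. -/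
theorem braid_mul_ι (c : C) (a : ExteriorAlgebra R g) (v : g) :
    braid R g σ (c ⊗ₜ (a * ι R v)) =
      TensorProduct.map (LinearMap.mulRight R (ι R v)) σ (braid R g σ (c ⊗ₜ a)) := by
  -- Left braiding steps commute with right multiplication by v; on 1 ⊗ c, left and right
  -- multiplication by v agree.
  have key : ∀ z : ExteriorAlgebra R g ⊗[R] C,
      ExteriorAlgebra.lift R ⟨braidStep R g σ, braidStep_sq R g σ⟩ a
        (TensorProduct.map (LinearMap.mulRight R (ι R v)) σ z) =
      TensorProduct.map (LinearMap.mulRight R (ι R v)) σ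
        (ExteriorAlgebra.lift R ⟨braidStep R g σ, braidStep_sq R g σ⟩ a z) := by
    induction a using ext_left_induction with
    | h1 => intro z; simp
    | hadd a b ha hb => intro z; simp [ha, hb]
    | hsmul r a ha => intro z; simp [ha]
    | hmul w a ha =>
      intro z
      rw [map_mul, Module.End.mul_apply, ha, ExteriorAlgebra.lift_ι_apply, Module.End.mul_apply]
      generalize ExteriorAlgebra.lift R ⟨braidStep R g σ, braidStep_sq R g σ⟩ a z = z
      refine eq_of_tmul (braidStep R g σ w ∘ₗ TensorProduct.map (LinearMap.mulRight R (ι R v)) σ)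
        (TensorProduct.map (LinearMap.mulRight R (ι R v)) σ ∘ₗ braidStep R g σ w)
        (fun x y => ?_) z
      simp [braidStep, mul_assoc]
  have h := key (1 ⊗ₜ c)
  simp only [braid, TensorProduct.lift.tmul, LinearMap.comp_apply, LinearMap.flip_apply,
    TensorProduct.mk_apply, AlgHom.toLinearMap_apply, map_mul, ExteriorAlgebra.lift_ι_apply,
    Module.End.mul_apply] at h ⊢
  rw [← h]
  simp [braidStep]

/-- The inclusion `c ↦ c ⊗ 1`. -/
def inclOne (R : Type*) [CommRing R] (g : Type*) [LieRing g] [LieAlgebra R g]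
    (C : Type*) [AddCommGroup C] [Module R C] : C →ₗ[R] C ⊗[R] ExteriorAlgebra R g :=
  (TensorProduct.mk R C (ExteriorAlgebra R g)).flip 1

@[simp]
theorem inclOne_apply (c : C) : inclOne R g C c = c ⊗ₜ 1 := rfl

variable (Δ : C →ₗ[R] C ⊗[R] C)

theorem tensorComul_tmul_one (c : C) :
    tensorComul R g σ Δ (c ⊗ₜ 1) = TensorProduct.map (inclOne R g C) (inclOne R g C) (Δ c) := by
  simp only [tensorComul, LinearMap.comp_apply, TensorProduct.map_tmul, extComul_one]
  generalize Δ c = z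
  refine eq_of_tmul ((TensorProduct.assoc R C (ExteriorAlgebra R g)
    (C ⊗[R] ExteriorAlgebra R g)).symm.toLinearMap ∘ₗ
    LinearMap.lTensor C
      ((TensorProduct.assoc R (ExteriorAlgebra R g) C (ExteriorAlgebra R g)).toLinearMap ∘ₗ
        LinearMap.rTensor _ (braid R g σ) ∘ₗ
        (TensorProduct.assoc R C (ExteriorAlgebra R g) (ExteriorAlgebra R g)).symm.toLinearMap) ∘ₗ
    (TensorProduct.assoc R C C (ExteriorAlgebra R g ⊗[R] ExteriorAlgebra R g)).toLinearMap ∘ₗ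
      (TensorProduct.mk R _ _).flip (1 ⊗ₜ 1)) _ (fun x y => ?_) z
  simp

/-- The interchange puts σ on c'' and the diagonal of Λ puts `extSign` on a''; together they form
the sign operator of the second factor c'' ⊗ a''. -/
theorem tensorComul_actOdd (v : g) (b : C ⊗[R] ExteriorAlgebra R g) :
    tensorComul R g σ Δ (actOdd R g C v b) =
      diagOp (actOdd R g C v) (tensorSign R g σ) (tensorComul R g σ Δ b) := by
  refine eq_of_tmul (tensorComul R g σ Δ ∘ₗ actOdd R g C v)
    (diagOp (actOdd R g C v) (tensorSign R g σ) ∘ₗ tensorComul R g σ Δ) (fun c a => ?_) b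
  simp only [tensorComul, LinearMap.comp_apply, actOdd_tmul, TensorProduct.map_tmul,
    extComul_mul_ι]
  generalize Δ c = z
  generalize extComul R g a = w
  set F := (TensorProduct.assoc R C (ExteriorAlgebra R g)
    (C ⊗[R] ExteriorAlgebra R g)).symm.toLinearMap ∘ₗ
    LinearMap.lTensor C
      ((TensorProduct.assoc R (ExteriorAlgebra R g) C (ExteriorAlgebra R g)).toLinearMap ∘ₗ
        LinearMap.rTensor _ (braid R g σ) ∘ₗ
        (TensorProduct.assoc R C (ExteriorAlgebra R g) (ExteriorAlgebra R g)).symm.toLinearMap) ∘ₗ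
    (TensorProduct.assoc R C C (ExteriorAlgebra R g ⊗[R] ExteriorAlgebra R g)).toLinearMap with hF
  suffices h : ∀ z w, F (z ⊗ₜ diagOp (LinearMap.mulRight R (ι R v)) (extSign R g) w) =
      diagOp (actOdd R g C v) (tensorSign R g σ) (F (z ⊗ₜ w)) from h z w
  clear z w
  intro z w
  refine eq_of_tmul (F ∘ₗ (TensorProduct.mk R _ _).flip
    (diagOp (LinearMap.mulRight R (ι R v)) (extSign R g) w))
    (diagOp (actOdd R g C v) (tensorSign R g σ) ∘ₗ F ∘ₗ (TensorProduct.mk R _ _).flip w)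
    (fun x y => ?_) z
  refine eq_of_tmul (F ∘ₗ TensorProduct.mk R _ _ (x ⊗ₜ y) ∘ₗ
      diagOp (LinearMap.mulRight R (ι R v)) (extSign R g))
    (diagOp (actOdd R g C v) (tensorSign R g σ) ∘ₗ F ∘ₗ TensorProduct.mk R _ _ (x ⊗ₜ y))
    (fun a a' => ?_) w
  have hFt : ∀ a a', F ((x ⊗ₜ y) ⊗ₜ (a ⊗ₜ a')) =
      (TensorProduct.assoc R C (ExteriorAlgebra R g) (C ⊗[R] ExteriorAlgebra R g)).symm
        (x ⊗ₜ TensorProduct.assoc R (ExteriorAlgebra R g) C (ExteriorAlgebra R g)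
          (braid R g σ (y ⊗ₜ a) ⊗ₜ a')) := fun a a' => rfl
  simp only [LinearMap.comp_apply, diagOp_tmul, TensorProduct.mk_apply, map_add, hFt, LinearMap.mulRight_apply, braid_mul_ι]
  generalize braid R g σ (y ⊗ₜ a) = u
  set G : ExteriorAlgebra R g → (ExteriorAlgebra R g ⊗[R] C →ₗ[R]
      (C ⊗[R] ExteriorAlgebra R g) ⊗[R] (C ⊗[R] ExteriorAlgebra R g)) := fun a' =>
    (TensorProduct.assoc R C (ExteriorAlgebra R g)
      (C ⊗[R] ExteriorAlgebra R g)).symm.toLinearMap ∘ₗ TensorProduct.mk R _ _ x ∘ₗ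
      (TensorProduct.assoc R (ExteriorAlgebra R g) C (ExteriorAlgebra R g)).toLinearMap ∘ₗ
      (TensorProduct.mk R _ _).flip a' with hG
  refine eq_of_tmul (G (extSign R g a') ∘ₗ TensorProduct.map (LinearMap.mulRight R (ι R v)) σ +
    G (a' * ι R v)) (diagOp (actOdd R g C v) (tensorSign R g σ) ∘ₗ G a') (fun p q => ?_) u
  simp [hG]

end Comul

end TwistedRules

/-! ### The tensor product coalgebra C ⊗ Λ' -/

section TensorCoalgebra

variable {R : Type*} [CommRing R] {g : Type*} [LieRing g] [LieAlgebra R g]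
variable {C : Type*} [AddCommGroup C] [Module R C]
  {σ : C →ₗ[R] C} {Δ : C →ₗ[R] C ⊗[R] C} {ε : C →ₗ[R] R}

open ExteriorAlgebra (ι ιInv)

theorem tensorComul_tensorSign (hσ : ∀ c, Δ (σ c) = TensorProduct.map σ σ (Δ c))
    (b : C ⊗[R] ExteriorAlgebra R g) :
    tensorComul R g σ Δ (tensorSign R g σ b) =
      TensorProduct.map (tensorSign R g σ) (tensorSign R g σ) (tensorComul R g σ Δ b) := by
  refine tensor_hom (tensorComul R g σ Δ ∘ₗ tensorSign R g σ)
    (TensorProduct.map (tensorSign R g σ) (tensorSign R g σ) ∘ₗ tensorComul R g σ Δ)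
    (fun c => ?_) (fun v b h => ?_) b
  · simp only [LinearMap.comp_apply, tensorSign_tmul, extSign_one, tensorComul_tmul_one, hσ]
    refine eq_of_tmul (TensorProduct.map (inclOne R g C) (inclOne R g C) ∘ₗ
      TensorProduct.map σ σ) (TensorProduct.map (tensorSign R g σ) (tensorSign R g σ) ∘ₗ
        TensorProduct.map (inclOne R g C) (inclOne R g C)) (fun x y => ?_) _
    simp
  · exact comul_sign_diagOp (tensorComul_actOdd σ Δ v) (tensorSign_actOdd σ v) h

/-- On C ⊗ 1 this is coassociativity of C, as c ↦ c ⊗ 1 respects the diagonals; `coassoc_diagOp`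
carries it along the generators of Λ. -/
theorem tensorComul_coassoc (hσ : ∀ c, Δ (σ c) = TensorProduct.map σ σ (Δ c))
    (h : ∀ c, TensorProduct.assoc R C C C (LinearMap.rTensor C Δ (Δ c)) =
      LinearMap.lTensor C Δ (Δ c)) (b : C ⊗[R] ExteriorAlgebra R g) :
    TensorProduct.assoc R _ _ _ (LinearMap.rTensor _ (tensorComul R g σ Δ)
      (tensorComul R g σ Δ b)) =
    LinearMap.lTensor _ (tensorComul R g σ Δ) (tensorComul R g σ Δ b) := by
  refine tensor_hom ((TensorProduct.assoc R _ _ _).toLinearMap ∘ₗ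
      LinearMap.rTensor _ (tensorComul R g σ Δ) ∘ₗ tensorComul R g σ Δ)
    (LinearMap.lTensor _ (tensorComul R g σ Δ) ∘ₗ tensorComul R g σ Δ)
    (fun c => ?_) (fun v b hb => ?_) b
  · simp only [LinearMap.comp_apply, tensorComul_tmul_one, LinearEquiv.coe_coe]
    set j := inclOne R g C
    have h1 : ∀ z : C ⊗[R] C, TensorProduct.assoc R _ _ _ (LinearMap.rTensor _
        (tensorComul R g σ Δ) (TensorProduct.map j j z)) = TensorProduct.map j
          (TensorProduct.map j j) (TensorProduct.assoc R C C C (LinearMap.rTensor C Δ z)) := by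
      refine eq_of_tmul ((TensorProduct.assoc R _ _ _).toLinearMap ∘ₗ
        LinearMap.rTensor _ (tensorComul R g σ Δ) ∘ₗ TensorProduct.map j j)
        (TensorProduct.map j (TensorProduct.map j j) ∘ₗ
          (TensorProduct.assoc R C C C).toLinearMap ∘ₗ LinearMap.rTensor C Δ) (fun x y => ?_)
      simp only [LinearMap.comp_apply, TensorProduct.map_tmul, LinearMap.rTensor_tmul, j,
        inclOne_apply, tensorComul_tmul_one, LinearEquiv.coe_coe]
      generalize Δ x = w
      refine eq_of_tmul ((TensorProduct.assoc R _ _ _).toLinearMap ∘ₗ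
          (TensorProduct.mk R _ _).flip (y ⊗ₜ 1) ∘ₗ TensorProduct.map j j)
        (TensorProduct.map j (TensorProduct.map j j) ∘ₗ
          (TensorProduct.assoc R C C C).toLinearMap ∘ₗ (TensorProduct.mk R _ _).flip y)
        (fun u v => ?_) w
      simp [j]
    have h2 : ∀ z : C ⊗[R] C, LinearMap.lTensor _ (tensorComul R g σ Δ)
        (TensorProduct.map j j z) =
          TensorProduct.map j (TensorProduct.map j j) (LinearMap.lTensor C Δ z) := by
      refine eq_of_tmul (LinearMap.lTensor _ (tensorComul R g σ Δ) ∘ₗ TensorProduct.map j j)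
        (TensorProduct.map j (TensorProduct.map j j) ∘ₗ LinearMap.lTensor C Δ) (fun x y => ?_)
      simp [j, tensorComul_tmul_one]
    rw [h1, h2, h]
  · exact coassoc_diagOp (tensorComul_actOdd σ Δ v) (tensorComul_tensorSign hσ) hb

theorem tensorCounit_actOdd (v : g) (b : C ⊗[R] ExteriorAlgebra R g) :
    tensorCounit R g ε (actOdd R g C v b) = 0 := by
  refine eq_of_tmul (tensorCounit R g ε ∘ₗ actOdd R g C v) 0 (fun c a => ?_) b
  simp

theorem tensorCounit_tensorSign (hε : ∀ c, ε (σ c) = ε c) (b : C ⊗[R] ExteriorAlgebra R g) :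
    tensorCounit R g ε (tensorSign R g σ b) = tensorCounit R g ε b := by
  refine eq_of_tmul (tensorCounit R g ε ∘ₗ tensorSign R g σ) _ (fun c a => ?_) b
  simp [hε]

theorem tensorCounit_actEven {act : g →ₗ[R] C →ₗ[R] C} {Y : g} (hε : ∀ c, ε (act Y c) = 0)
    (b : C ⊗[R] ExteriorAlgebra R g) : tensorCounit R g ε (actEven R g act Y b) = 0 := by
  refine eq_of_tmul (tensorCounit R g ε ∘ₗ actEven R g act Y) 0 (fun c a => ?_) b
  simp [hε, extCounit_extAct]

theorem tensorComul_counit_left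
    (h : ∀ c, TensorProduct.lid R C (LinearMap.rTensor C ε (Δ c)) = c)
    (b : C ⊗[R] ExteriorAlgebra R g) :
    TensorProduct.lid R _ (LinearMap.rTensor _ (tensorCounit R g ε) (tensorComul R g σ Δ b)) =
      b := by
  refine tensor_hom ((TensorProduct.lid R _).toLinearMap ∘ₗ
    LinearMap.rTensor _ (tensorCounit R g ε) ∘ₗ tensorComul R g σ Δ) LinearMap.id
    (fun c => ?_) (fun v b hb => ?_) b
  · simp only [LinearMap.comp_apply, tensorComul_tmul_one, LinearEquiv.coe_coe,
      LinearMap.id_apply]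
    conv_rhs => rw [← h c]
    refine eq_of_tmul ((TensorProduct.lid R _).toLinearMap ∘ₗ
      LinearMap.rTensor _ (tensorCounit R g ε) ∘ₗ
        TensorProduct.map (inclOne R g C) (inclOne R g C))
      (inclOne R g C ∘ₗ (TensorProduct.lid R C).toLinearMap ∘ₗ LinearMap.rTensor C ε)
      (fun x y => ?_) _
    simp [TensorProduct.smul_tmul']
  · exact counit_left_diagOp (tensorCounit_actOdd v) (tensorComul_actOdd σ Δ v) hb

theorem tensorComul_counit_right (hε : ∀ c, ε (σ c) = ε c)
    (h : ∀ c, TensorProduct.rid R C (LinearMap.lTensor C ε (Δ c)) = c)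
    (b : C ⊗[R] ExteriorAlgebra R g) :
    TensorProduct.rid R _ (LinearMap.lTensor _ (tensorCounit R g ε) (tensorComul R g σ Δ b)) =
      b := by
  refine tensor_hom ((TensorProduct.rid R _).toLinearMap ∘ₗ
    LinearMap.lTensor _ (tensorCounit R g ε) ∘ₗ tensorComul R g σ Δ) LinearMap.id
    (fun c => ?_) (fun v b hb => ?_) b
  · simp only [LinearMap.comp_apply, tensorComul_tmul_one, LinearEquiv.coe_coe,
      LinearMap.id_apply]
    conv_rhs => rw [← h c]
    refine eq_of_tmul ((TensorProduct.rid R _).toLinearMap ∘ₗ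
      LinearMap.lTensor _ (tensorCounit R g ε) ∘ₗ
        TensorProduct.map (inclOne R g C) (inclOne R g C))
      (inclOne R g C ∘ₗ (TensorProduct.rid R C).toLinearMap ∘ₗ LinearMap.lTensor C ε)
      (fun x y => ?_) _
    simp [TensorProduct.smul_tmul']
  · exact counit_right_diagOp (tensorCounit_actOdd v) (tensorCounit_tensorSign hε)
      (tensorComul_actOdd σ Δ v) hb

theorem tensorComul_actEven {act : g →ₗ[R] C →ₗ[R] C}
    (hσ : ∀ Y c, σ (act Y c) = act Y (σ c))
    (h : ∀ Y c, Δ (act Y c) = diagOp (act Y) LinearMap.id (Δ c)) (Y : g)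
    (b : C ⊗[R] ExteriorAlgebra R g) :
    tensorComul R g σ Δ (actEven R g act Y b) =
      diagOp (actEven R g act Y) LinearMap.id (tensorComul R g σ Δ b) := by
  refine tensor_hom (tensorComul R g σ Δ ∘ₗ actEven R g act Y)
    (diagOp (actEven R g act Y) LinearMap.id ∘ₗ tensorComul R g σ Δ)
    (fun c => ?_) (fun v b hb => ?_) b
  · simp only [LinearMap.comp_apply, actEven_tmul, extAct_one, TensorProduct.tmul_zero, add_zero,
      tensorComul_tmul_one, h]
    refine eq_of_tmul (TensorProduct.map (inclOne R g C) (inclOne R g C) ∘ₗ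
      diagOp (act Y) LinearMap.id) (diagOp (actEven R g act Y) LinearMap.id ∘ₗ
        TensorProduct.map (inclOne R g C) (inclOne R g C)) (fun x y => ?_) _
    simp
  · exact comul_act_diagOp (tensorComul_actOdd σ Δ v) (tensorComul_actOdd σ Δ ⁅v, Y⁆)
      (actEven_actOdd act v Y) (tensorSign_actEven (hσ Y)) hb

end TensorCoalgebra

/-! ### The symmetric coalgebra S' and the action of g on it -/

section SymRules

variable {R : Type*} [CommRing R] {g : Type*} [LieRing g] [LieAlgebra R g]

open DividedPowerAlgebra (dp)

theorem sym_induction {P : DividedPowerAlgebra R g → Prop} (h1 : P 1)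
    (hadd : ∀ a b, P a → P b → P (a + b)) (hsmul : ∀ (r : R) a, P a → P (r • a))
    (hmul : ∀ c n x, P c → P (c * dp R n x)) (c : DividedPowerAlgebra R g) : P c := by
  induction c using DividedPowerAlgebra.induction_on with
  | C r => rw [Algebra.algebraMap_eq_smul_one]; exact hsmul r 1 h1
  | add a b ha hb => exact hadd a b ha hb
  | dp a n x ha => exact hmul a n x ha

theorem sym_hom {X : Type*} [AddCommMonoid X] [Module R X]
    (f f' : DividedPowerAlgebra R g →ₗ[R] X) (h1 : f 1 = f' 1)
    (hmul : ∀ c n x, f c = f' c → f (c * dp R n x) = f' (c * dp R n x))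
    (c : DividedPowerAlgebra R g) : f c = f' c :=
  sym_induction (P := fun c => f c = f' c) h1 (fun a b ha hb => by simp [ha, hb])
    (fun r a ha => by simp [ha]) hmul c

@[simp]
theorem symComul_one : symComul R g 1 = 1 := by simp [symComul]

@[simp]
theorem symComul_mul (a b : DividedPowerAlgebra R g) :
    symComul R g (a * b) = symComul R g a * symComul R g b := by simp [symComul]

theorem symComul_dp (n : ℕ) (x : g) : symComul R g (dp R n x) =
    ∑ k ∈ Finset.HasAntidiagonal.antidiagonal n, dp R k.1 x ⊗ₜ[R] dp R k.2 x := by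
  simp [symComul, symComulFun]

@[simp]
theorem symCounit_one : symCounit R g 1 = 1 := by simp [symCounit]

@[simp]
theorem symCounit_mul (a b : DividedPowerAlgebra R g) :
    symCounit R g (a * b) = symCounit R g a * symCounit R g b := by simp [symCounit]

@[simp]
theorem symCounit_dp (n : ℕ) (x : g) :
    symCounit R g (dp R n x) = if n = 0 then 1 else 0 := by
  simp [symCounit]

/-- As for `ιInv`: the projection to the cogenerators is the second component of an algebra morphism
to a square-zero extension whose first component is the counit. -/
theorem symLin_mul (a b : DividedPowerAlgebra R g) :
    symLin R g (a * b) = symCounit R g a • symLin R g b + symCounit R g b • symLin R g a := by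
  let _ : Module Rᵐᵒᵖ g := Module.compHom _ ((RingHom.id R).fromOpposite mul_comm)
  have _ : IsCentralScalar R g := ⟨fun r m => rfl⟩
  -- The algebra morphism inside `symLin` is recovered through an existential statement, with only
  -- its values on divided powers kept.
  obtain ⟨L, hL, hdp⟩ : ∃ L : DividedPowerAlgebra R g →ₐ[R] TrivSqZeroExt R g,
      (∀ a, (L a).snd = symLin R g a) ∧ ∀ n x, L (dp R n x) = symLinFun R g (n, x) := by
    obtain ⟨L, hL, hdp⟩ : ∃ L : DividedPowerAlgebra R g →ₐ[R] TrivSqZeroExt R g,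
        symLin R g = (TrivSqZeroExt.sndHom R g).comp L.toLinearMap ∧
          ∀ n x, L (dp R n x) = symLinFun R g (n, x) :=
      ⟨_, rfl, fun n x => DividedPowerAlgebra.lift'_apply_dp _ _ _ _ n x⟩
    exact ⟨L, fun a => by rw [hL]; rfl, hdp⟩
  have h : ∀ a, (L a).fst = symCounit R g a := by
    refine sym_hom ((TrivSqZeroExt.fstHom R R g).toLinearMap ∘ₗ L.toLinearMap) (symCounit R g)
      (by simp) (fun c n x hc => ?_)
    simp only [LinearMap.comp_apply, AlgHom.toLinearMap_apply, TrivSqZeroExt.fstHom_apply] at hc ⊢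
    rw [map_mul, TrivSqZeroExt.fst_mul, hc, hdp, symCounit_mul, symCounit_dp]
    by_cases h0 : n = 0
    · simp [symLinFun, h0]
    · by_cases h1 : n = 1 <;> simp [symLinFun, h0, h1]
  rw [← hL, ← hL, ← hL, map_mul, TrivSqZeroExt.snd_mul, h, h]
  simp

@[simp]
theorem symLin_one : symLin R g 1 = 0 := by
  have h := symLin_mul (R := R) (g := g) 1 1
  simpa using h

@[simp]
theorem symLin_dp (n : ℕ) (x : g) : symLin R g (dp R n x) = if n = 1 then x else 0 := by
  let _ : Module Rᵐᵒᵖ g := Module.compHom _ ((RingHom.id R).fromOpposite mul_comm)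
  have _ : IsCentralScalar R g := ⟨fun r m => rfl⟩
  obtain ⟨L, hL, hdp⟩ : ∃ L : DividedPowerAlgebra R g →ₐ[R] TrivSqZeroExt R g,
      symLin R g = (TrivSqZeroExt.sndHom R g).comp L.toLinearMap ∧
        ∀ n x, L (dp R n x) = symLinFun R g (n, x) :=
    ⟨_, rfl, fun n x => DividedPowerAlgebra.lift'_apply_dp _ _ _ _ n x⟩
  rw [hL]
  change (L (dp R n x)).snd = _
  rw [hdp]
  by_cases h0 : n = 0
  · simp [symLinFun, h0]
  · by_cases h1 : n = 1 <;> simp [symLinFun, h0, h1]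

/-- The diagonal of `S'` as a morphism of algebras. -/
def symComulHom (R : Type*) [CommRing R] (g : Type*) [LieRing g] [LieAlgebra R g] :
    DividedPowerAlgebra R g →ₐ[R] DividedPowerAlgebra R g ⊗[R] DividedPowerAlgebra R g :=
  AlgHom.ofLinearMap (symComul R g) symComul_one symComul_mul

/-- Coassociativity of a multiplicative diagonal is inherited by products. -/
theorem coassoc_mul {A : Type*} [CommRing A] [Algebra R A] (Δ : A →ₐ[R] A ⊗[R] A) {a b : A}
    (ha : TensorProduct.assoc R A A A (LinearMap.rTensor A Δ.toLinearMap (Δ a)) =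
      LinearMap.lTensor A Δ.toLinearMap (Δ a))
    (hb : TensorProduct.assoc R A A A (LinearMap.rTensor A Δ.toLinearMap (Δ b)) =
      LinearMap.lTensor A Δ.toLinearMap (Δ b)) :
    TensorProduct.assoc R A A A (LinearMap.rTensor A Δ.toLinearMap (Δ (a * b))) =
      LinearMap.lTensor A Δ.toLinearMap (Δ (a * b)) := by
  let F : A →ₐ[R] A ⊗[R] (A ⊗[R] A) := (Algebra.TensorProduct.assoc R R R A A A).toAlgHom.comp
    ((Algebra.TensorProduct.map Δ (AlgHom.id R A)).comp Δ)
  let G : A →ₐ[R] A ⊗[R] (A ⊗[R] A) := (Algebra.TensorProduct.map (AlgHom.id R A) Δ).comp Δ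
  change F a = G a at ha
  change F b = G b at hb
  change F (a * b) = G (a * b)
  rw [map_mul, map_mul, ha, hb]

theorem symComul_coassoc (c : DividedPowerAlgebra R g) :
    TensorProduct.assoc R _ _ _ (LinearMap.rTensor _ (symComul R g) (symComul R g c)) =
      LinearMap.lTensor _ (symComul R g) (symComul R g c) := by
  refine sym_hom ((TensorProduct.assoc R _ _ _).toLinearMap ∘ₗ
    LinearMap.rTensor _ (symComul R g) ∘ₗ symComul R g)
    (LinearMap.lTensor _ (symComul R g) ∘ₗ symComul R g)
    (by simp [Algebra.TensorProduct.one_def]) (fun c n x hc => ?_) c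
  refine coassoc_mul (symComulHom R g) hc ?_
  change TensorProduct.assoc R _ _ _ (LinearMap.rTensor _ (symComul R g) (symComul R g (dp R n x))) =
      LinearMap.lTensor _ (symComul R g) (symComul R g (dp R n x))
  simp only [symComul_dp, map_sum, LinearMap.rTensor_tmul, LinearMap.lTensor_tmul,
    TensorProduct.sum_tmul, TensorProduct.tmul_sum, TensorProduct.assoc_tmul]
  rw [Finset.sum_sigma', Finset.sum_sigma']
  -- Both sums run over triples of total n, grouped once as (p + q) + r and once as p + (q + r).
  refine Finset.sum_bij' (fun p _ => ⟨(p.2.1, p.2.2 + p.1.2), (p.2.2, p.1.2)⟩)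
    (fun p _ => ⟨(p.1.1 + p.2.1, p.2.2), (p.1.1, p.2.1)⟩) ?_ ?_ ?_ ?_ ?_
  · rintro ⟨⟨i, j⟩, ⟨k, l⟩⟩ h
    simp only [Finset.mem_sigma, Finset.HasAntidiagonal.mem_antidiagonal] at h ⊢
    obtain ⟨rfl, rfl⟩ := h
    simp [add_assoc]
  · rintro ⟨⟨i, j⟩, ⟨k, l⟩⟩ h
    simp only [Finset.mem_sigma, Finset.HasAntidiagonal.mem_antidiagonal] at h ⊢
    obtain ⟨rfl, rfl⟩ := h
    simp [add_assoc]
  · rintro ⟨⟨i, j⟩, ⟨k, l⟩⟩ h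
    simp only [Finset.mem_sigma, Finset.HasAntidiagonal.mem_antidiagonal] at h
    obtain ⟨_, rfl⟩ := h
    rfl
  · rintro ⟨⟨i, j⟩, ⟨k, l⟩⟩ h
    simp only [Finset.mem_sigma, Finset.HasAntidiagonal.mem_antidiagonal] at h
    obtain ⟨_, rfl⟩ := h
    rfl
  · rintro ⟨⟨i, j⟩, ⟨k, l⟩⟩ h
    rfl

theorem symComul_comm (c : DividedPowerAlgebra R g) :
    TensorProduct.comm R _ _ (symComul R g c) = symComul R g c := by
  have h : (Algebra.TensorProduct.comm R (DividedPowerAlgebra R g) (DividedPowerAlgebra R g)).toAlgHom.comp (symComulHom R g) =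
      symComulHom R g := by
    refine DividedPowerAlgebra.algHom_ext (A := DividedPowerAlgebra R g ⊗[R] DividedPowerAlgebra R g) fun n x => ?_
    simp only [AlgHom.comp_apply, symComulHom, AlgHom.ofLinearMap_apply, symComul_dp, map_sum]
    rw [← Finset.Nat.sum_antidiagonal_swap]
    simp
  exact DFunLike.congr_fun h c

theorem symComul_counit_left (c : DividedPowerAlgebra R g) :
    TensorProduct.lid R _ (LinearMap.rTensor _ (symCounit R g) (symComul R g c)) = c := by
  have h : ((Algebra.TensorProduct.lid R (DividedPowerAlgebra R g)).toAlgHom.comp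
      ((Algebra.TensorProduct.map (S := R) (AlgHom.ofLinearMap (symCounit R g) symCounit_one symCounit_mul)
        (AlgHom.id R (DividedPowerAlgebra R g))).comp (symComulHom R g))) =
        AlgHom.id R (DividedPowerAlgebra R g) := by
    refine DividedPowerAlgebra.algHom_ext (A := DividedPowerAlgebra R g) fun n x => ?_
    simp only [AlgHom.comp_apply, symComulHom, AlgHom.ofLinearMap_apply, symComul_dp, map_sum,
      Algebra.TensorProduct.map_tmul, AlgHom.id_apply]
    rw [Finset.sum_eq_single (0, n)]
    · simp
    · rintro ⟨i, j⟩ hij hne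
      have : i ≠ 0 := by
        rintro rfl
        simp at hij
        exact hne (by simp [hij])
      simp [this]
    · simp
  exact DFunLike.congr_fun h c

theorem symComul_counit_right (c : DividedPowerAlgebra R g) :
    TensorProduct.rid R _ (LinearMap.lTensor _ (symCounit R g) (symComul R g c)) = c := by
  conv_rhs => rw [← symComul_counit_left c]
  conv_lhs => rw [← symComul_comm c]
  refine eq_of_tmul ((TensorProduct.rid R _).toLinearMap ∘ₗ
    LinearMap.lTensor _ (symCounit R g) ∘ₗ (TensorProduct.comm R _ _).toLinearMap)
    ((TensorProduct.lid R _).toLinearMap ∘ₗ LinearMap.rTensor _ (symCounit R g))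
    (fun x y => ?_) _
  simp

/-- An alternating bilinear form evaluated on the linear part of the diagonal of the cocommutative
coalgebra `S'` vanishes. -/
theorem sym_alternating {X : Type*} [AddCommGroup X] [Module R X] (B : g →ₗ[R] g →ₗ[R] X)
    (hB : ∀ x, B x x = 0) (c : DividedPowerAlgebra R g) :
    TensorProduct.lift (B.compl₁₂ (symLin R g) (symLin R g)) (symComul R g c) = 0 := by
  have hB' : ∀ x y, B x y + B y x = 0 := by
    intro x y
    have := hB (x + y)
    simpa [hB, add_comm] using this
  set G := TensorProduct.lift (B.compl₁₂ (symLin R g) (symLin R g)) with hG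
  set p₁ := symLin R g ∘ₗ (TensorProduct.lid R _).toLinearMap ∘ₗ
    LinearMap.rTensor (DividedPowerAlgebra R g) (symCounit R g) with hp₁
  set p₂ := symLin R g ∘ₗ (TensorProduct.rid R _).toLinearMap ∘ₗ
    LinearMap.lTensor (DividedPowerAlgebra R g) (symCounit R g) with hp₂
  set e := symCounit R g ∘ₗ (TensorProduct.lid R _).toLinearMap ∘ₗ
    LinearMap.rTensor (DividedPowerAlgebra R g) (symCounit R g) with he
  -- The derivation rule for `symLin` gives two terms with a counit factor and two mixed terms. On
  -- diagonals p₁ and p₂ both become `symLin`, so the mixed terms cancel by antisymmetry of B.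
  have key : ∀ z w, G (z * w) = e z • G w + e w • G z + B (p₂ w) (p₁ z) + B (p₂ z) (p₁ w) := by
    intro z w
    induction z using TensorProduct.induction_on with
    | zero => simp
    | add z z' h h' =>
      simp only [add_mul, map_add, h, h', add_smul, smul_add, LinearMap.add_apply]
      abel
    | tmul x y =>
      induction w using TensorProduct.induction_on with
      | zero => simp
      | add w w' h h' =>
        simp only [mul_add, map_add, h, h', add_smul, smul_add, LinearMap.add_apply]
        abel
      | tmul x' y' =>
        simp only [Algebra.TensorProduct.tmul_mul_tmul, hG, hp₁, hp₂, he, TensorProduct.lift.tmul,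
          LinearMap.compl₁₂_apply, symLin_mul, LinearMap.comp_apply, LinearMap.rTensor_tmul,
          LinearMap.lTensor_tmul, LinearEquiv.coe_coe, TensorProduct.lid_tmul,
          TensorProduct.rid_tmul, map_smul, map_add, LinearMap.add_apply, LinearMap.smul_apply]
        module
  have hp₁' : ∀ c, p₁ (symComul R g c) = symLin R g c := fun c => by
    simp [hp₁, symComul_counit_left]
  have hp₂' : ∀ c, p₂ (symComul R g c) = symLin R g c := fun c => by
    simp [hp₂, symComul_counit_right]
  refine sym_hom (G ∘ₗ symComul R g) 0 (by simp [hG, Algebra.TensorProduct.one_def])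
    (fun c n x hc => ?_) c
  simp only [LinearMap.comp_apply, LinearMap.zero_apply] at hc ⊢
  rw [symComul_mul, key, hc, smul_zero, add_zero, hp₁', hp₂', hp₁', hp₂', add_assoc, hB',
    add_zero, symComul_dp, map_sum, Finset.sum_eq_zero, smul_zero]
  -- For a divided power only k = (1, 1) could contribute, with value B x x. The alternating
  -- property is used as such, so no division by 2 occurs.
  intro k _
  simp only [hG, TensorProduct.lift.tmul, LinearMap.compl₁₂_apply, symLin_dp]
  split_ifs <;> simp [hB]

/-- Since `symLin` is a derivation over the counit and the diagonal is multiplicative, convolution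
against `symLin` is a derivation of the algebra. -/
theorem symAct_mul (Y : g) (a b : DividedPowerAlgebra R g) :
    symAct R g Y (a * b) = symAct R g Y a * b + a * symAct R g Y b := by
  set f := DividedPowerAlgebra.embed R g ∘ₗ (lieBilin R g).flip Y ∘ₗ symLin R g with hf
  set M := LinearMap.mul' R (DividedPowerAlgebra R g) ∘ₗ LinearMap.rTensor _ f with hM
  set N := (TensorProduct.lid R _).toLinearMap ∘ₗ
    LinearMap.rTensor (DividedPowerAlgebra R g) (symCounit R g) with hN
  have key : ∀ z w, M (z * w) = M z * N w + N z * M w := by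
    intro z w
    induction z using TensorProduct.induction_on with
    | zero => simp
    | add z z' h h' =>
      simp only [add_mul, map_add, h, h']
      ring
    | tmul x y =>
      induction w using TensorProduct.induction_on with
      | zero => simp
      | add w w' h h' =>
        simp only [mul_add, map_add, h, h']
        ring
      | tmul x' y' =>
        simp only [Algebra.TensorProduct.tmul_mul_tmul, hM, hN, hf, LinearMap.comp_apply,
          LinearMap.rTensor_tmul, LinearEquiv.coe_coe, TensorProduct.lid_tmul,
          LinearMap.mul'_apply, symLin_mul, map_add, map_smul]
        simp only [Algebra.smul_def]
        ring
  have hN' : ∀ c, N (symComul R g c) = c := symComul_counit_left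
  change M (symComul R g (a * b)) = M (symComul R g a) * b + a * M (symComul R g b)
  rw [symComul_mul, key, hN', hN']

@[simp]
theorem symAct_one (Y : g) : symAct R g Y 1 = 0 := by
  have h := symAct_mul (R := R) Y 1 1
  simpa using h

/-- In the diagonal of a divided power only the summand whose first index is 1 has a linear part in
the first factor. -/
theorem symAct_dp_succ (Y : g) (n : ℕ) (x : g) :
    symAct R g Y (dp R (n + 1) x) = dp R 1 ⁅x, Y⁆ * dp R n x := by
  change LinearMap.mul' R (DividedPowerAlgebra R g) (LinearMap.rTensor _
    (DividedPowerAlgebra.embed R g ∘ₗ (lieBilin R g).flip Y ∘ₗ symLin R g)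
      (symComul R g (dp R (n + 1) x))) = _
  rw [symComul_dp, map_sum, map_sum, Finset.sum_eq_single (1, n)]
  · simp [lieBilin, DividedPowerAlgebra.embed_def]
  · rintro ⟨i, j⟩ hij hne
    have : i ≠ 1 := by
      rintro rfl
      simp at hij
      exact hne (by simp; omega)
    simp [this]
  · simp [add_comm]

theorem symAct_dp_one (Y x : g) : symAct R g Y (dp R 1 x) = dp R 1 ⁅x, Y⁆ := by
  rw [← zero_add 1, symAct_dp_succ, DividedPowerAlgebra.dp_zero, mul_one]

theorem symAct_comm (Y Z : g) (c : DividedPowerAlgebra R g) :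
    symAct R g Z (symAct R g Y c) - symAct R g Y (symAct R g Z c) = symAct R g ⁅Y, Z⁆ c := by
  refine sym_hom (symAct R g Z ∘ₗ symAct R g Y - symAct R g Y ∘ₗ symAct R g Z)
    (symAct R g ⁅Y, Z⁆) (by simp) (fun c n x h => ?_) c
  simp only [LinearMap.comp_apply, LinearMap.sub_apply] at h ⊢
  have hdp : symAct R g Z (symAct R g Y (dp R n x)) - symAct R g Y (symAct R g Z (dp R n x)) =
      symAct R g ⁅Y, Z⁆ (dp R n x) := by
    have hj : ⁅x, ⁅Y, Z⁆⁆ = ⁅⁅x, Y⁆, Z⁆ - ⁅⁅x, Z⁆, Y⁆ := by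
      rw [leibniz_lie x Y Z, ← lie_skew Y ⁅x, Z⁆]
      abel
    have hd : ∀ u v : g, dp R 1 (u - v) = dp R 1 u - dp R 1 v :=
      fun u v => map_sub (DividedPowerAlgebra.embed R g) u v
    -- Two actions in a row strip off up to two factors, so n = 0 and n = 1 are separate.
    rcases n with _ | _ | n
    · simp [DividedPowerAlgebra.dp_zero]
    · simp only [zero_add, symAct_dp_one, hj, hd]
    · rw [symAct_dp_succ, symAct_dp_succ, symAct_dp_succ, symAct_mul, symAct_mul, symAct_dp_one,
        symAct_dp_one, symAct_dp_succ, symAct_dp_succ, hj, hd]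
      ring
  simp only [symAct_mul, map_add, ← h, ← hdp]
  ring

/-- Both sides are derivations along the algebra morphism `symComul`, which leaves the divided
powers to be checked. -/
theorem symComul_symAct (Y : g) (c : DividedPowerAlgebra R g) :
    symComul R g (symAct R g Y c) = diagOp (symAct R g Y) LinearMap.id (symComul R g c) := by
  have key : ∀ z w, diagOp (symAct R g Y) LinearMap.id (z * w) =
      diagOp (symAct R g Y) LinearMap.id z * w + z * diagOp (symAct R g Y) LinearMap.id w := by
    intro z w
    induction z using TensorProduct.induction_on with
    | zero => simp
    | add z z' h h' =>
      simp only [add_mul, map_add, h, h']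
      ring
    | tmul x y =>
      induction w using TensorProduct.induction_on with
      | zero => simp
      | add w w' h h' =>
        simp only [mul_add, map_add, h, h']
        ring
      | tmul x' y' =>
        simp only [Algebra.TensorProduct.tmul_mul_tmul, diagOp_tmul, symAct_mul, add_mul, mul_add,
          TensorProduct.add_tmul, TensorProduct.tmul_add, LinearMap.id_apply]
        abel
  refine sym_hom (symComul R g ∘ₗ symAct R g Y)
    (diagOp (symAct R g Y) LinearMap.id ∘ₗ symComul R g)
    (by simp [Algebra.TensorProduct.one_def]) (fun c n x h => ?_) c
  simp only [LinearMap.comp_apply] at h ⊢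
  rw [symAct_mul, map_add, symComul_mul, symComul_mul, symComul_mul, key, h]
  congr 2
  rcases n with _ | n
  · simp [DividedPowerAlgebra.dp_zero, Algebra.TensorProduct.one_def]
  · rw [symAct_dp_succ, symComul_mul, symComul_dp, symComul_dp, symComul_dp]
    simp only [map_sum, diagOp_tmul, LinearMap.id_apply, Finset.sum_add_distrib]
    -- In each half of the Leibniz rule the summand whose acted-on factor is `dp 0` vanishes. The
    -- remaining sums over the antidiagonal of n are the product of a primitive element with the
    -- diagonal of `dp n`.
    rw [Finset.Nat.sum_antidiagonal_succ (n := n), Finset.Nat.sum_antidiagonal_succ' (n := n)]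
    simp [symAct_dp_succ, DividedPowerAlgebra.dp_zero, Finset.Nat.antidiagonal_succ, add_mul,
      Finset.mul_sum, Finset.sum_add_distrib, add_comm]

theorem symCounit_symAct (Y : g) (c : DividedPowerAlgebra R g) :
    symCounit R g (symAct R g Y c) = 0 := by
  refine sym_hom (symCounit R g ∘ₗ symAct R g Y) 0 (by simp) (fun c n x h => ?_) c
  simp only [LinearMap.comp_apply, LinearMap.zero_apply] at h ⊢
  rw [symAct_mul, map_add, symCounit_mul, h]
  rcases n with _ | n
  · simp [DividedPowerAlgebra.dp_zero]
  · simp [symAct_dp_succ]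

theorem symLin_symAct (Y : g) (c : DividedPowerAlgebra R g) :
    symLin R g (symAct R g Y c) = ⁅symLin R g c, Y⁆ := by
  refine sym_hom (symLin R g ∘ₗ symAct R g Y) ((lieBilin R g).flip Y ∘ₗ symLin R g) (by simp)
    (fun c n x h => ?_) c
  simp only [LinearMap.comp_apply, LinearMap.flip_apply, lieBilin, LinearMap.mk₂_apply] at h ⊢
  rw [symAct_mul, map_add, symLin_mul, symLin_mul, symLin_mul, h, symCounit_symAct,
    symCounit_symAct]
  rcases n with _ | _ | n
  · simp [DividedPowerAlgebra.dp_zero]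
  · simp [symAct_dp_one]
  · simp [symAct_dp_succ, symLin_mul]

end SymRules

/-! ### Gradings of Λ and of tensor products -/

section Gradings

variable {R : Type*} [CommRing R]

/-- A family of submodules that spans and admits projections is a direct sum decomposition. -/
theorem isInternal_of_proj {C : Type*} [AddCommGroup C] [Module R C] (𝒞 : ℕ → Submodule R C)
    (π : ℕ → C →ₗ[R] C) (hπ : ∀ m n, ∀ c ∈ 𝒞 n, π m c = if m = n then c else 0)
    (htop : ⨆ n, 𝒞 n = ⊤) : DirectSum.IsInternal 𝒞 := by
  refine DirectSum.isInternal_submodule_of_iSupIndep_of_iSup_eq_top ?_ htop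
  rw [iSupIndep_def]
  intro n
  rw [Submodule.disjoint_def]
  intro c hc hc'
  have h0 : (⨆ j, ⨆ _ : j ≠ n, 𝒞 j) ≤ LinearMap.ker (π n) := by
    refine iSup₂_le fun j hj c hc => ?_
    rw [LinearMap.mem_ker, hπ n j c hc, if_neg (Ne.symm hj)]
  have h1 := hπ n n c hc
  rw [if_pos rfl, LinearMap.mem_ker.mp (h0 hc')] at h1
  exact h1.symm

section Tensor

variable {A B : Type*} [AddCommGroup A] [Module R A] [AddCommGroup B] [Module R B]

/-- The tensor product of two gradings. -/
def grTensor (𝒜 : ℕ → Submodule R A) (ℬ : ℕ → Submodule R B) (n : ℕ) : Submodule R (A ⊗[R] B) :=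
  ⨆ p : ℕ × ℕ, ⨆ _ : p.1 + p.2 = n, Submodule.map₂ (TensorProduct.mk R A B) (𝒜 p.1) (ℬ p.2)

variable {𝒜 : ℕ → Submodule R A} {ℬ : ℕ → Submodule R B}

theorem tmul_mem_grTensor {i j n : ℕ} {a : A} {b : B} (ha : a ∈ 𝒜 i) (hb : b ∈ ℬ j)
    (h : i + j = n) : a ⊗ₜ b ∈ grTensor 𝒜 ℬ n :=
  (le_iSup₂_of_le (f := fun (p : ℕ × ℕ) (_ : p.1 + p.2 = n) =>
    Submodule.map₂ (TensorProduct.mk R A B) (𝒜 p.1) (ℬ p.2)) (i, j) h le_rfl)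
    (Submodule.apply_mem_map₂ _ ha hb)

theorem grTensor_le {n : ℕ} {P : Submodule R (A ⊗[R] B)}
    (h : ∀ i j, i + j = n → ∀ a ∈ 𝒜 i, ∀ b ∈ ℬ j, a ⊗ₜ b ∈ P) : grTensor 𝒜 ℬ n ≤ P :=
  iSup₂_le fun p hp => Submodule.map₂_le.mpr fun a ha b hb => h p.1 p.2 hp a ha b hb

theorem map_mem_of_mem_grTensor {X : Type*} [AddCommMonoid X] [Module R X] {n : ℕ}
    {z : A ⊗[R] B} (hz : z ∈ grTensor 𝒜 ℬ n) (f : A ⊗[R] B →ₗ[R] X) (P : Submodule R X)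
    (h : ∀ i j, i + j = n → ∀ a ∈ 𝒜 i, ∀ b ∈ ℬ j, f (a ⊗ₜ b) ∈ P) : f z ∈ P :=
  grTensor_le (P := P.comap f) h hz

end Tensor

section ExteriorPowers

variable {g : Type*} [LieRing g] [LieAlgebra R g]

open ExteriorAlgebra (ι ιInv)

theorem one_mem_extPower : (1 : ExteriorAlgebra R g) ∈ ⋀[R]^0 g := by
  rw [ExteriorAlgebra.exteriorPower, pow_zero]
  exact Submodule.one_le.mp le_rfl

theorem ι_mem_extPower (v : g) : ι R v ∈ ⋀[R]^1 g := by
  rw [ExteriorAlgebra.exteriorPower, pow_one]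
  exact ⟨v, rfl⟩

theorem mul_ι_mem_extPower {n : ℕ} {a : ExteriorAlgebra R g} (ha : a ∈ ⋀[R]^n g) (v : g) :
    a * ι R v ∈ ⋀[R]^(n + 1) g := by
  rw [ExteriorAlgebra.exteriorPower, pow_succ]
  exact Submodule.mul_mem_mul ha ⟨v, rfl⟩

/-- Graded induction along right multiplication by generators. The family `Q` may change its shape
with the degree, for instance ⊤ in degree 0 and a kernel elsewhere. -/
theorem extPower_le (Q : ℕ → Submodule R (ExteriorAlgebra R g)) (h1 : 1 ∈ Q 0)
    (hmul : ∀ v n, ∀ a ∈ Q n, a * ι R v ∈ Q (n + 1)) (n : ℕ) (a : ExteriorAlgebra R g)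
    (ha : a ∈ ⋀[R]^n g) : a ∈ Q n := by
  induction ha using Submodule.pow_induction_on_right' with
  | algebraMap r => rw [Algebra.algebraMap_eq_smul_one]; exact (Q 0).smul_mem r h1
  | add x y i hx hy h h' => exact (Q i).add_mem h h'
  | mul_mem i x hx h m hm =>
    obtain ⟨v, rfl⟩ := hm
    exact hmul v i x h

theorem extSign_of_mem {n : ℕ} {a : ExteriorAlgebra R g} (ha : a ∈ ⋀[R]^n g) :
    extSign R g a = (-1 : R) ^ n • a := by
  refine extPower_le (fun n => LinearMap.eqLocus (extSign R g) ((-1 : R) ^ n • LinearMap.id))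
    (by simp) (fun v n a h => ?_) n a ha
  simp only [LinearMap.mem_eqLocus, LinearMap.smul_apply, LinearMap.id_apply] at h ⊢
  rw [extSign_mul, h, extSign_ι, pow_succ]
  simp

theorem extCounit_of_mem {n : ℕ} (hn : n ≠ 0) {a : ExteriorAlgebra R g} (ha : a ∈ ⋀[R]^n g) :
    extCounit R g a = 0 := by
  have h := extPower_le (fun n => if n = 0 then ⊤ else LinearMap.ker (extCounit R g))
    (by simp) (fun v n a h => by simp) n a ha
  simpa [hn] using h

theorem extAct_mem (Y : g) {n : ℕ} {a : ExteriorAlgebra R g} (ha : a ∈ ⋀[R]^n g) :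
    extAct R g Y a ∈ ⋀[R]^n g := by
  refine (extPower_le (fun n => ⋀[R]^n g ⊓ (⋀[R]^n g).comap (extAct R g Y))
    ⟨one_mem_extPower, by simp⟩ (fun v n a h => ?_) n a ha).2
  refine ⟨mul_ι_mem_extPower h.1 v, ?_⟩
  change extAct R g Y (a * ι R v) ∈ ⋀[R]^(n + 1) g
  rw [extAct_mul_ι]
  exact Submodule.add_mem _ (mul_ι_mem_extPower h.2 v) (mul_ι_mem_extPower h.1 _)

/-- The projection of the exterior algebra to its homogeneous constituents. -/
def extProj (R : Type*) [CommRing R] (g : Type*) [LieRing g] [LieAlgebra R g] (m : ℕ) :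
    ExteriorAlgebra R g →ₗ[R] ExteriorAlgebra R g :=
  GradedAlgebra.proj (fun i => ⋀[R]^i g) m

theorem extProj_of_mem (m n : ℕ) (a : ExteriorAlgebra R g) (ha : a ∈ ⋀[R]^n g) :
    extProj R g m a = if m = n then a else 0 := by
  split_ifs with h
  · subst h
    exact DirectSum.decompose_of_mem_same (fun i : ℕ => ⋀[R]^i g) ha
  · exact DirectSum.decompose_of_mem_ne (fun i : ℕ => ⋀[R]^i g) ha (Ne.symm h)

theorem iSup_extPower : ⨆ n : ℕ, (⋀[R]^n g : Submodule R (ExteriorAlgebra R g)) = ⊤ :=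
  (DirectSum.Decomposition.isInternal (fun i : ℕ => ⋀[R]^i g)).submodule_iSup_eq_top

end ExteriorPowers

section TensorGr

variable {g : Type*} [LieRing g] [LieAlgebra R g] {C : Type*} [AddCommGroup C] [Module R C]
  {w : ℕ → ℕ} {𝒞 : ℕ → Submodule R C}

open ExteriorAlgebra (ι ιInv)

theorem tmul_mem_tensorGr {i j n : ℕ} {c : C} {a : ExteriorAlgebra R g} (hc : c ∈ 𝒞 i)
    (ha : a ∈ ⋀[R]^j g) (h : w i + j = n) : c ⊗ₜ a ∈ tensorGr R g w 𝒞 n :=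
  (le_iSup₂_of_le (f := fun (p : ℕ × ℕ) (_ : w p.1 + p.2 = n) =>
    Submodule.map₂ (TensorProduct.mk R C (ExteriorAlgebra R g)) (𝒞 p.1) (⋀[R]^p.2 g)) (i, j) h
    le_rfl) (Submodule.apply_mem_map₂ _ hc ha)

theorem tensorGr_le {n : ℕ} {P : Submodule R (C ⊗[R] ExteriorAlgebra R g)}
    (h : ∀ i j, w i + j = n → ∀ c ∈ 𝒞 i, ∀ a ∈ ⋀[R]^j g, c ⊗ₜ a ∈ P) : tensorGr R g w 𝒞 n ≤ P :=
  iSup₂_le fun p hp => Submodule.map₂_le.mpr fun a ha b hb => h p.1 p.2 hp a ha b hb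

theorem actOdd_mem_tensorGr (v : g) {n : ℕ} {b : C ⊗[R] ExteriorAlgebra R g}
    (hb : b ∈ tensorGr R g w 𝒞 n) : actOdd R g C v b ∈ tensorGr R g w 𝒞 (n + 1) := by
  refine tensorGr_le (P := (tensorGr R g w 𝒞 (n + 1)).comap (actOdd R g C v))
    (fun i j hij c hc a ha => ?_) hb
  exact tmul_mem_tensorGr hc (mul_ι_mem_extPower ha v) (by omega)

/-- Generation of `C ⊗ Λ` in the graded sense. -/
theorem tensorGr_generation (Q : ℕ → Submodule R (C ⊗[R] ExteriorAlgebra R g))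
    (h1 : ∀ i, ∀ c ∈ 𝒞 i, c ⊗ₜ 1 ∈ Q (w i))
    (hmul : ∀ v n, ∀ b ∈ Q n, actOdd R g C v b ∈ Q (n + 1)) {n : ℕ}
    {b : C ⊗[R] ExteriorAlgebra R g} (hb : b ∈ tensorGr R g w 𝒞 n) : b ∈ Q n := by
  refine tensorGr_le (fun i j hij c hc a ha => ?_) hb
  subst hij
  exact extPower_le (fun j => (Q (w i + j)).comap (TensorProduct.mk R C (ExteriorAlgebra R g) c))
    (h1 i c hc) (fun v n a h => hmul v _ _ h) j a ha

theorem tensorSign_of_mem {σ : C →ₗ[R] C} (hσ : ∀ i, ∀ c ∈ 𝒞 i, σ c = (-1 : R) ^ w i • c) {n : ℕ}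
    {b : C ⊗[R] ExteriorAlgebra R g} (hb : b ∈ tensorGr R g w 𝒞 n) :
    tensorSign R g σ b = (-1 : R) ^ n • b := by
  refine tensorGr_le (P := LinearMap.eqLocus (tensorSign R g σ) ((-1 : R) ^ n • LinearMap.id))
    (fun i j hij c hc a ha => ?_) hb
  subst hij
  simp only [LinearMap.mem_eqLocus, tensorSign_tmul, hσ i c hc, extSign_of_mem ha,
    LinearMap.smul_apply, LinearMap.id_apply, TensorProduct.smul_tmul_smul, pow_add]

theorem tensorCounit_of_mem {ε : C →ₗ[R] R}
    (hε : ∀ i, i ≠ 0 → ∀ c ∈ 𝒞 i, ε c = 0) (hw0 : w 0 = 0) {n : ℕ} (hn : n ≠ 0)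
    {b : C ⊗[R] ExteriorAlgebra R g} (hb : b ∈ tensorGr R g w 𝒞 n) :
    tensorCounit R g ε b = 0 := by
  refine tensorGr_le (P := LinearMap.ker (tensorCounit R g ε)) (fun i j hij c hc a ha => ?_) hb
  rw [LinearMap.mem_ker, tensorCounit_tmul]
  by_cases hi : i = 0
  · have hj : j ≠ 0 := by
      subst hi
      omega
    rw [extCounit_of_mem hj ha, mul_zero]
  · rw [hε i hi c hc, zero_mul]

theorem actEven_mem_tensorGr {act : g →ₗ[R] C →ₗ[R] C} (Y : g)
    (hact : ∀ i, ∀ c ∈ 𝒞 i, act Y c ∈ 𝒞 i) {n : ℕ}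
    {b : C ⊗[R] ExteriorAlgebra R g} (hb : b ∈ tensorGr R g w 𝒞 n) :
    actEven R g act Y b ∈ tensorGr R g w 𝒞 n := by
  refine tensorGr_le (P := (tensorGr R g w 𝒞 n).comap (actEven R g act Y))
    (fun i j hij c hc a ha => ?_) hb
  exact Submodule.add_mem _ (tmul_mem_tensorGr (hact i c hc) ha hij)
    (tmul_mem_tensorGr hc (extAct_mem Y ha) hij)

/-- The projection to degree m is the sum of the products of projections over the pairs with w i + j
= m. The bound i ≤ w i confines those pairs to a finite square. -/
theorem tensorGr_isInternal (hw : ∀ i, i ≤ w i) (π : ℕ → C →ₗ[R] C)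
    (hπ : ∀ m n, ∀ c ∈ 𝒞 n, π m c = if m = n then c else 0) (htop : ⨆ n, 𝒞 n = ⊤) :
    DirectSum.IsInternal (tensorGr R g w 𝒞) := by
  refine isInternal_of_proj _ (fun m => ∑ p ∈ Finset.range (m + 1) ×ˢ Finset.range (m + 1),
    if w p.1 + p.2 = m then TensorProduct.map (π p.1) (extProj R g p.2) else 0)
    (fun m n b hb => ?_) ?_
  · refine tensorGr_le (P := LinearMap.eqLocus _ (if m = n then LinearMap.id else 0))
      (fun i j hij c hc a ha => ?_) hb |>.trans (by split_ifs <;> rfl)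
    simp only [LinearMap.mem_eqLocus, LinearMap.sum_apply]
    have hterm : ∀ p : ℕ × ℕ, p ≠ (i, j) → (if w p.1 + p.2 = m then
        TensorProduct.map (π p.1) (extProj R g p.2) else 0) (c ⊗ₜ[R] a) = 0 := by
      rintro ⟨p, q⟩ hpq
      split_ifs
      · rw [TensorProduct.map_tmul, hπ p i c hc, extProj_of_mem q j a ha]
        by_cases hp : p = i
        · rw [if_neg (fun hq : q = j => hpq (by rw [hp, hq])), TensorProduct.tmul_zero]
        · rw [if_neg hp, TensorProduct.zero_tmul]
      · rfl
    rw [Finset.sum_eq_single (i, j) (fun p _ hp => hterm p hp)]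
    · subst hij
      by_cases hmn : m = w i + j
      · rw [if_pos hmn.symm, if_pos hmn, TensorProduct.map_tmul, hπ i i c hc,
          extProj_of_mem j j a ha, if_pos rfl, if_pos rfl]
        rfl
      · rw [if_neg (Ne.symm hmn), if_neg hmn]
    -- A pair outside the square has total weight different from m, so its summand is zero anyway.
    · intro hnot
      have := hw i
      have hne : w i + j ≠ m := by
        rintro rfl
        simp at hnot
        omega
      rw [if_neg hne]
      rfl
  · rw [eq_top_iff]
    rintro b -
    induction b using TensorProduct.induction_on with
    | zero => exact Submodule.zero_mem _
    | add x y hx hy => exact Submodule.add_mem _ hx hy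
    | tmul c a =>
      have hc : c ∈ ⨆ n, 𝒞 n := htop ▸ Submodule.mem_top
      have ha : a ∈ ⨆ n : ℕ, (⋀[R]^n g : Submodule R (ExteriorAlgebra R g)) :=
        iSup_extPower (R := R) (g := g) ▸ Submodule.mem_top
      have hle : Submodule.map₂ (TensorProduct.mk R C (ExteriorAlgebra R g)) (⨆ n, 𝒞 n)
          (⨆ n : ℕ, ⋀[R]^n g) ≤ ⨆ n, tensorGr R g w 𝒞 n := by
        simp only [Submodule.map₂_iSup_left, Submodule.map₂_iSup_right]
        refine iSup_le fun i => iSup_le fun j => Submodule.map₂_le.mpr fun c hc a ha => ?_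
        exact Submodule.mem_iSup_of_mem _ (tmul_mem_tensorGr hc ha rfl)
      exact hle (Submodule.apply_mem_map₂ _ hc ha)

/-- The tensor product diagonal preserves the grading. -/
theorem tensorComul_mem {σ : C →ₗ[R] C} {Δ : C →ₗ[R] C ⊗[R] C}
    (hσ : ∀ i, ∀ c ∈ 𝒞 i, σ c = (-1 : R) ^ w i • c)
    (hΔ : ∀ i, ∀ c ∈ 𝒞 i, Δ c ∈ grTensor 𝒞 𝒞 i) (hw : ∀ i j, w (i + j) = w i + w j) {n : ℕ}
    {b : C ⊗[R] ExteriorAlgebra R g} (hb : b ∈ tensorGr R g w 𝒞 n) :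
    tensorComul R g σ Δ b ∈ grTensor (tensorGr R g w 𝒞) (tensorGr R g w 𝒞) n := by
  refine tensorGr_generation (fun n => (grTensor (tensorGr R g w 𝒞) (tensorGr R g w 𝒞) n).comap
    (tensorComul R g σ Δ)) (fun i c hc => ?_) (fun v n b h => ?_) hb
  · rw [Submodule.mem_comap, tensorComul_tmul_one]
    refine map_mem_of_mem_grTensor (hΔ i c hc) _ _ (fun p q hpq a ha b hb => ?_)
    exact tmul_mem_grTensor (tmul_mem_tensorGr ha one_mem_extPower rfl)
      (tmul_mem_tensorGr hb one_mem_extPower rfl) (by rw [← hpq, hw]; omega)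
  · rw [Submodule.mem_comap, tensorComul_actOdd]
    refine map_mem_of_mem_grTensor h _ _ (fun p q hpq a ha b hb => ?_)
    rw [diagOp_tmul, tensorSign_of_mem hσ hb]
    exact Submodule.add_mem _ (tmul_mem_grTensor (actOdd_mem_tensorGr v ha)
      (Submodule.smul_mem _ _ hb) (by omega))
      (tmul_mem_grTensor ha (actOdd_mem_tensorGr v hb) (by omega))

end TensorGr

end Gradings

/-! ### The weight grading of S' and recursions along its diagonal -/

section SymGrading

variable {R : Type*} [CommRing R] {g : Type*} [LieRing g] [LieAlgebra R g]

open DividedPowerAlgebra (dp)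

theorem symWeight_one : symWeight R g 1 = 1 := by simp [symWeight]

theorem symWeight_mul (a b : DividedPowerAlgebra R g) :
    symWeight R g (a * b) = symWeight R g a * symWeight R g b := by simp [symWeight]

theorem symWeight_dp (n : ℕ) (x : g) :
    symWeight R g (dp R n x) = Polynomial.monomial n (dp R n x) := by
  simp [symWeight]

theorem mem_symGr {n : ℕ} {c : DividedPowerAlgebra R g} :
    c ∈ symGr R g n ↔ symWeight R g c = Polynomial.monomial n c := Iff.rfl

theorem one_mem_symGr : (1 : DividedPowerAlgebra R g) ∈ symGr R g 0 := by
  rw [mem_symGr, symWeight_one]; rfl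

theorem mul_mem_symGr {m n : ℕ} {a b : DividedPowerAlgebra R g} (ha : a ∈ symGr R g m)
    (hb : b ∈ symGr R g n) : a * b ∈ symGr R g (m + n) := by
  rw [mem_symGr] at ha hb ⊢
  rw [symWeight_mul, ha, hb, Polynomial.monomial_mul_monomial]

theorem dp_mem_symGr (n : ℕ) (x : g) : dp R n x ∈ symGr R g n := symWeight_dp n x

/-- The projection of `S'` to its homogeneous constituents. -/
def symProj (R : Type*) [CommRing R] (g : Type*) [LieRing g] [LieAlgebra R g] (m : ℕ) :
    DividedPowerAlgebra R g →ₗ[R] DividedPowerAlgebra R g :=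
  (Polynomial.lcoeff (DividedPowerAlgebra R g) m).restrictScalars R ∘ₗ symWeight R g

theorem symProj_apply (m : ℕ) (c : DividedPowerAlgebra R g) :
    symProj R g m c = (symWeight R g c).coeff m := rfl

theorem symProj_of_mem (m n : ℕ) (c : DividedPowerAlgebra R g) (hc : c ∈ symGr R g n) :
    symProj R g m c = if m = n then c else 0 := by
  rw [symProj_apply, mem_symGr.mp hc, Polynomial.coeff_monomial]
  simp [eq_comm]

/-- Generation of `S'` by the divided powers in the graded sense. -/
theorem symGr_generation (Q : ℕ → Submodule R (DividedPowerAlgebra R g)) (h1 : 1 ∈ Q 0)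
    (hmul : ∀ m n x, ∀ c ∈ Q m, c * dp R n x ∈ Q (m + n)) {n : ℕ} {c : DividedPowerAlgebra R g}
    (hc : c ∈ symGr R g n) : c ∈ Q n := by
  -- A homogeneous element may be written with inhomogeneous terms, so the claim is proved for all
  -- homogeneous parts of an arbitrary element.
  have key : ∀ (c : DividedPowerAlgebra R g) (n : ℕ), symProj R g n c ∈ Q n := by
    intro c
    induction c using sym_induction with
    | h1 =>
      intro n
      rw [symProj_of_mem n 0 1 one_mem_symGr]
      split_ifs with h
      · exact h ▸ h1
      · exact Submodule.zero_mem _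
    | hadd a b ha hb => intro n; rw [map_add]; exact Submodule.add_mem _ (ha n) (hb n)
    | hsmul r a ha => intro n; rw [map_smul]; exact Submodule.smul_mem _ _ (ha n)
    | hmul c k x hc =>
      intro n
      rw [symProj_apply, symWeight_mul, symWeight_dp, ← Polynomial.C_mul_X_pow_eq_monomial, ← mul_assoc,
        Polynomial.coeff_mul_X_pow', Polynomial.coeff_mul_C]
      split_ifs with h
      · have := hmul (n - k) k x _ (hc (n - k))
        rwa [Nat.sub_add_cancel h] at this
      · exact Submodule.zero_mem _
  have h := key c n
  rwa [symProj_of_mem n n c hc, if_pos rfl] at h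

theorem iSup_symGr : ⨆ n, symGr R g n = ⊤ := by
  rw [eq_top_iff]
  rintro c -
  induction c using sym_induction with
  | h1 => exact Submodule.mem_iSup_of_mem 0 one_mem_symGr
  | hadd a b ha hb => exact Submodule.add_mem _ ha hb
  | hsmul r a ha => exact Submodule.smul_mem _ _ ha
  | hmul c k x hc =>
    suffices h : (⨆ n, symGr R g n) ≤ (⨆ n, symGr R g n).comap
      (LinearMap.mulRight R (dp R k x)) from h hc
    exact iSup_le fun n c hc => Submodule.mem_iSup_of_mem (n + k)
      (mul_mem_symGr hc (dp_mem_symGr k x))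

theorem symCounit_of_mem (n : ℕ) (hn : n ≠ 0) (c : DividedPowerAlgebra R g)
    (hc : c ∈ symGr R g n) : symCounit R g c = 0 := by
  have h := symGr_generation (fun n => if n = 0 then ⊤ else LinearMap.ker (symCounit R g))
    (by simp) (fun m n x c h => by
      by_cases hm : m = 0
      · by_cases hn : n = 0 <;> simp [hm, hn]
      · simp only [hm, if_false, LinearMap.mem_ker] at h
        simp [hm, h]) hc
  simpa [hn] using h

theorem symLin_of_mem (n : ℕ) (hn : n ≠ 1) (c : DividedPowerAlgebra R g)
    (hc : c ∈ symGr R g n) : symLin R g c = 0 := by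
  -- Homogeneity is carried along because the derivation rule for `symLin` also involves the counit
  -- of c.
  have h := symGr_generation (fun n => symGr R g n ⊓
      if n = 1 then ⊤ else LinearMap.ker (symLin R g))
    ⟨one_mem_symGr, by simp⟩ (fun m n x c h => by
      refine ⟨mul_mem_symGr h.1 (dp_mem_symGr n x), ?_⟩
      by_cases hmn : m + n = 1
      · simp [hmn]
      rw [if_neg hmn]
      change symLin R g (c * dp R n x) = 0
      rw [symLin_mul]
      have h1 : m ≠ 0 → symCounit R g c = 0 := fun hm => symCounit_of_mem m hm c h.1
      by_cases hm : m = 0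
      · have h2 := h.2
        simp only [hm, zero_ne_one, if_false] at h2
        have hn1 : n ≠ 1 := by omega
        rw [LinearMap.mem_ker.mp h2]
        simp [hn1]
      · by_cases hm1 : m = 1
        · have hn0 : n ≠ 0 := by omega
          simp [h1 hm, hn0]
        · have h2 := h.2
          simp only [hm1, if_false] at h2
          rw [LinearMap.mem_ker.mp h2]
          simp [h1 hm]) hc
  have h2 := h.2
  simpa [hn] using h2

theorem symComul_mem (n : ℕ) (c : DividedPowerAlgebra R g) (hc : c ∈ symGr R g n) :
    symComul R g c ∈ grTensor (symGr R g) (symGr R g) n := by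
  refine symGr_generation (fun n => (grTensor (symGr R g) (symGr R g) n).comap (symComul R g))
    ?_ (fun m n x c h => ?_) hc
  · rw [Submodule.mem_comap, symComul_one, Algebra.TensorProduct.one_def]
    exact tmul_mem_grTensor one_mem_symGr one_mem_symGr rfl
  · rw [Submodule.mem_comap, symComul_mul, symComul_dp, Finset.mul_sum]
    refine Submodule.sum_mem _ fun k hk => ?_
    have hk := Finset.HasAntidiagonal.mem_antidiagonal.mp hk
    refine map_mem_of_mem_grTensor h (LinearMap.mulRight R (dp R k.1 x ⊗ₜ dp R k.2 x)) _
      (fun i j hij a ha b hb => ?_)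
    rw [LinearMap.mulRight_apply, Algebra.TensorProduct.tmul_mul_tmul]
    exact tmul_mem_grTensor (mul_mem_symGr ha (dp_mem_symGr k.1 x))
      (mul_mem_symGr hb (dp_mem_symGr k.2 x)) (by omega)

theorem symAct_mem (Y : g) (n : ℕ) (c : DividedPowerAlgebra R g) (hc : c ∈ symGr R g n) :
    symAct R g Y c ∈ symGr R g n := by
  refine (symGr_generation (fun n => symGr R g n ⊓ (symGr R g n).comap (symAct R g Y))
    ⟨one_mem_symGr, by simp⟩ (fun m n x c h => ?_) hc).2
  refine ⟨mul_mem_symGr h.1 (dp_mem_symGr n x), ?_⟩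
  change symAct R g Y (c * dp R n x) ∈ symGr R g (m + n)
  rw [symAct_mul]
  refine Submodule.add_mem _ (mul_mem_symGr h.2 (dp_mem_symGr n x)) ?_
  rcases n with _ | n
  · simp [DividedPowerAlgebra.dp_zero]
  · rw [symAct_dp_succ, add_comm n 1]
    exact mul_mem_symGr h.1 (mul_mem_symGr (dp_mem_symGr 1 _) (dp_mem_symGr n x))

/-- Linear maps on `S'` agree if they agree on the homogeneous elements. -/
theorem symGr_hom {X : Type*} [AddCommMonoid X] [Module R X]
    (f f' : DividedPowerAlgebra R g →ₗ[R] X) (h : ∀ n, ∀ c ∈ symGr R g n, f c = f' c)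
    (c : DividedPowerAlgebra R g) : f c = f' c := by
  have hle : (⊤ : Submodule R (DividedPowerAlgebra R g)) ≤ LinearMap.eqLocus f f' := by
    rw [← iSup_symGr]
    exact iSup_le h
  exact hle Submodule.mem_top

/-- A linear map `f` on `S'` is determined by a recursion `f(c) = A(c) + ∑ K(f(c') ⊗ π(c''))`,
for `π` the projection to the cogenerators. -/
theorem sym_rec_unique {X : Type*} [AddCommMonoid X] [Module R X]
    (A : DividedPowerAlgebra R g → X) (K : X ⊗[R] g →ₗ[R] X)
    (f f' : DividedPowerAlgebra R g →ₗ[R] X)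
    (hf : ∀ c, f c = A c + K (TensorProduct.map f (symLin R g) (symComul R g c)))
    (hf' : ∀ c, f' c = A c + K (TensorProduct.map f' (symLin R g) (symComul R g c)))
    (c : DividedPowerAlgebra R g) : f c = f' c := by
  refine symGr_hom f f' (fun n => ?_) c
  induction n using Nat.strong_induction_on with
  | _ n ih =>
    intro c hc
    rw [hf, hf']
    congr 2
    refine grTensor_le (P := LinearMap.eqLocus (TensorProduct.map f (symLin R g))
      (TensorProduct.map f' (symLin R g))) (fun i j hij a ha b hb => ?_) (symComul_mem n c hc)
    rw [LinearMap.mem_eqLocus, TensorProduct.map_tmul, TensorProduct.map_tmul]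
    -- Only weight one survives in the second factor, so the recursion calls the strictly smaller
    -- weight n - 1.
    by_cases hj : j = 1
    · rw [ih i (by omega) a ha]
    · rw [symLin_of_mem j hj b hb, TensorProduct.tmul_zero, TensorProduct.tmul_zero]

end SymGrading

/-! ### The tensor coalgebra T': recursions on the last letter -/

section BarRules

variable {R : Type*} [CommRing R] {g : Type*} [LieRing g] [LieAlgebra R g]

open ExteriorAlgebra (ι ιInv)

theorem tensorAlgebra_hom {M : Type*} [AddCommGroup M] [Module R M] {X : Type*} [AddCommMonoid X]
    [Module R X] (f f' : TensorAlgebra R M →ₗ[R] X) (h1 : f 1 = f' 1)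
    (hmul : ∀ m x, f m = f' m → f (m * TensorAlgebra.ι R x) = f' (m * TensorAlgebra.ι R x))
    (m : TensorAlgebra R M) : f m = f' m := by
  -- The locus where the maps agree is stable under right multiplication by letters, hence by all of
  -- the algebra, and it contains 1.
  have key : ∀ a m : TensorAlgebra R M, m ∈ LinearMap.eqLocus f f' →
      m * a ∈ LinearMap.eqLocus f f' := by
    intro a
    induction a using TensorAlgebra.induction with
    | algebraMap r =>
      intro m hm
      rw [← Algebra.commutes, ← Algebra.smul_def]
      exact Submodule.smul_mem _ r hm
    | ι x => intro m hm; exact hmul m x hm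
    | mul a b ha hb => intro m hm; rw [← mul_assoc]; exact hb _ (ha _ hm)
    | add a b ha hb => intro m hm; rw [mul_add]; exact Submodule.add_mem _ (ha _ hm) (hb _ hm)
  have h := key m 1 h1
  rwa [one_mul] at h

theorem augProj_coe (a : ExteriorAlgebra R g) :
    ((augProj R g a : AugIdeal R g) : ExteriorAlgebra R g) = a - extCounit R g a • 1 := by
  change (LinearMap.id - Algebra.linearMap R (ExteriorAlgebra R g) ∘ₗ extCounit R g :
    ExteriorAlgebra R g →ₗ[R] ExteriorAlgebra R g) a = _
  simp [Algebra.algebraMap_eq_smul_one]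

theorem augProj_augIdeal (x : AugIdeal R g) : augProj R g (x : ExteriorAlgebra R g) = x := by
  ext
  rw [augProj_coe, LinearMap.mem_ker.mp x.2, zero_smul, sub_zero]

theorem barLetter_coe (x : AugIdeal R g) :
    barLetter R g (x : ExteriorAlgebra R g) = TensorAlgebra.ι R x := by
  rw [barLetter, LinearMap.comp_apply, augProj_augIdeal]

@[simp]
theorem barLetter_one : barLetter R g 1 = 0 := by
  have : augProj R g 1 = 0 := by
    ext
    rw [augProj_coe]
    simp
  rw [barLetter, LinearMap.comp_apply, this, map_zero]

theorem barLetter_eq (a : ExteriorAlgebra R g) :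
    barLetter R g a = TensorAlgebra.ι R (augProj R g a) := rfl

/-- Linear maps on the tensor coalgebra agree if they agree on `1` and agreement is preserved by
appending letters. -/
theorem barT_hom {X : Type*} [AddCommMonoid X] [Module R X] (f f' : BarT R g →ₗ[R] X)
    (h1 : f 1 = f' 1)
    (hmul : ∀ m a, f m = f' m → f (m * barLetter R g a) = f' (m * barLetter R g a))
    (m : BarT R g) : f m = f' m :=
  tensorAlgebra_hom f f' h1 (fun m x h => by rw [← barLetter_coe]; exact hmul m _ h) m

@[simp]
theorem barSign_one : barSign R g 1 = 1 := by simp [barSign]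

theorem barSign_mul_letter (m : BarT R g) (a : ExteriorAlgebra R g) :
    barSign R g (m * barLetter R g a) = -(barSign R g m * barLetter R g (extSign R g a)) := by
  rw [barLetter_eq a]
  simp [barSign, augProj_coe]

@[simp]
theorem barSign_barSign (m : BarT R g) : barSign R g (barSign R g m) = m := by
  refine barT_hom (barSign R g ∘ₗ barSign R g) LinearMap.id (by simp) (fun m a h => ?_) m
  simp only [LinearMap.comp_apply, LinearMap.id_apply] at h ⊢
  rw [barSign_mul_letter, map_neg, barSign_mul_letter, h, extSign_extSign, neg_neg]

@[simp]
theorem barTCounit_one : barTCounit R g 1 = 1 := by simp [barTCounit]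

@[simp]
theorem barTCounit_mul_letter (m : BarT R g) (a : ExteriorAlgebra R g) :
    barTCounit R g (m * barLetter R g a) = 0 := by
  simp [barTCounit, barLetter_eq, TensorAlgebra.algebraMapInv]

theorem barTCounit_barSign (m : BarT R g) : barTCounit R g (barSign R g m) = barTCounit R g m := by
  refine barT_hom (barTCounit R g ∘ₗ barSign R g) _ (by simp) (fun m a h => ?_) m
  simp [barSign_mul_letter]

@[simp]
theorem barDeconc_one : barDeconc R g 1 = 1 ⊗ₜ 1 := by simp [barDeconc, tensorRec_one]

theorem barDeconc_mul_letter (m : BarT R g) (a : ExteriorAlgebra R g) :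
    barDeconc R g (m * barLetter R g a) = (m * barLetter R g a) ⊗ₜ 1 +
      LinearMap.lTensor _ (LinearMap.mulRight R (barLetter R g a)) (barDeconc R g m) := by
  rw [barLetter_eq, barDeconc, tensorRec_mul_ι]
  rfl

@[simp]
theorem barSplit_one : barSplit R g 1 = 0 := by simp [barSplit, tensorRec_one]

/-- Letters are indexed by all of Λ through the projection to IΛ, so that products and signs can be
inserted freely; the price is the subtracted augmentation term. -/
theorem barSplit_mul_letter (m : BarT R g) (a : ExteriorAlgebra R g) :
    barSplit R g (m * barLetter R g a) = m ⊗ₜ a - extCounit R g a • m ⊗ₜ 1 := by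
  rw [barLetter_eq, barSplit, tensorRec_mul_ι]
  change m ⊗ₜ ((augProj R g a : AugIdeal R g) : ExteriorAlgebra R g) + 0 = _
  rw [augProj_coe, TensorProduct.tmul_sub, TensorProduct.tmul_smul, add_zero]

@[simp]
theorem barTAct_one (Y : g) : barTAct R g Y 1 = 0 := by
  simp [barTAct, tensorRec_one]

theorem barTAct_mul_letter (Y : g) (m : BarT R g) (a : ExteriorAlgebra R g) :
    barTAct R g Y (m * barLetter R g a) =
      m * barLetter R g (extAct R g Y a) + barTAct R g Y m * barLetter R g a := by
  rw [barLetter_eq a, barTAct, LinearMap.flip_apply, tensorRec_mul_ι]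
  simp [augProj_coe]

theorem barSign_barTAct (Y : g) (m : BarT R g) :
    barSign R g (barTAct R g Y m) = barTAct R g Y (barSign R g m) := by
  refine barT_hom (barSign R g ∘ₗ barTAct R g Y) (barTAct R g Y ∘ₗ barSign R g) (by simp)
    (fun m a h => ?_) m
  simp only [LinearMap.comp_apply] at h ⊢
  rw [barTAct_mul_letter, map_add, barSign_mul_letter, barSign_mul_letter, h, barSign_mul_letter,
    map_neg, barTAct_mul_letter, extAct_extSign]
  abel

theorem barTCounit_barTAct (Y : g) (m : BarT R g) : barTCounit R g (barTAct R g Y m) = 0 := by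
  refine barT_hom (barTCounit R g ∘ₗ barTAct R g Y) 0 (by simp) (fun m a h => ?_) m
  simp [barTAct_mul_letter]

@[simp]
theorem barD_one : barD R g 1 = 0 := by simp [barD, tensorRec_one]

theorem barD_mul_letter (m : BarT R g) (a : ExteriorAlgebra R g) :
    barD R g (m * barLetter R g a) = LinearMap.mul' R (BarT R g)
        (TensorProduct.map (barSign R g)
          (barLetter R g ∘ₗ LinearMap.mulRight R (a - extCounit R g a • 1) ∘ₗ (-extSign R g))
          (barSplit R g m)) + barD R g m * barLetter R g a := by
  rw [barLetter_eq, barD, tensorRec_mul_ι]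
  simp only [LinearMap.mk₂_apply, augProj_coe]
  rfl

@[simp]
theorem barBoundary_one : barBoundary R g 1 = 0 := by simp [barBoundary, tensorRec_one]

theorem barBoundary_mul_letter (m : BarT R g) (a : ExteriorAlgebra R g) :
    barBoundary R g (m * barLetter R g a) =
      -(barSign R g m * barLetter R g (extBoundary R g a)) - LinearMap.mul' R (BarT R g)
            (TensorProduct.map ((barTAct R g).flip (barSign R g m) ∘ₗ ExteriorAlgebra.ιInv)
              (barLetter R g) (extComul R g a)) + barBoundary R g m * barLetter R g a := by
  rw [barLetter_eq, barBoundary, tensorRec_mul_ι]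
  simp only [LinearMap.mk₂_apply, augProj_coe, map_sub, map_smul, extBoundary_one, smul_zero,
    sub_zero, extComul_one, TensorProduct.map_tmul, LinearMap.comp_apply, ιInv_one, map_zero,
    TensorProduct.zero_tmul]
  rfl

/-- Appending a letter satisfies the rule Δ h = h ⊗ 1 + (Id ⊗ h) Δ, so deconcatenation falls under
the homotopy lemmas with trivial sign operator. -/
theorem barDeconc_coassoc (m : BarT R g) :
    TensorProduct.assoc R _ _ _ (LinearMap.rTensor _ (barDeconc R g) (barDeconc R g m)) =
      LinearMap.lTensor _ (barDeconc R g) (barDeconc R g m) := by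
  refine barT_hom ((TensorProduct.assoc R _ _ _).toLinearMap ∘ₗ
    LinearMap.rTensor _ (barDeconc R g) ∘ₗ barDeconc R g)
    (LinearMap.lTensor _ (barDeconc R g) ∘ₗ barDeconc R g) (by simp) (fun m a h => ?_) m
  exact coassoc_homotopy (s := LinearMap.id) (h := LinearMap.mulRight R (barLetter R g a))
    barDeconc_one (fun b => barDeconc_mul_letter b a) (by simp) h

theorem barDeconc_barSign (m : BarT R g) : barDeconc R g (barSign R g m) =
    TensorProduct.map (barSign R g) (barSign R g) (barDeconc R g m) := by
  refine barT_hom (barDeconc R g ∘ₗ barSign R g)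
    (TensorProduct.map (barSign R g) (barSign R g) ∘ₗ barDeconc R g) (by simp) (fun m a h => ?_) m
  simp only [LinearMap.comp_apply] at h ⊢
  rw [barSign_mul_letter, map_neg, barDeconc_mul_letter, barDeconc_mul_letter, h, map_add,
    TensorProduct.map_tmul, barSign_mul_letter, barSign_one, neg_add, TensorProduct.neg_tmul]
  congr 1
  refine eq_of_tmul (-(LinearMap.lTensor _ (LinearMap.mulRight R
      (barLetter R g (extSign R g a))) ∘ₗ TensorProduct.map (barSign R g) (barSign R g)))
    (TensorProduct.map (barSign R g) (barSign R g) ∘ₗ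
      LinearMap.lTensor _ (LinearMap.mulRight R (barLetter R g a))) (fun x y => ?_) _
  simp [barSign_mul_letter, TensorProduct.tmul_neg]

theorem barDeconc_counit_left (m : BarT R g) :
    TensorProduct.lid R _ (LinearMap.rTensor _ (barTCounit R g) (barDeconc R g m)) = m := by
  refine barT_hom ((TensorProduct.lid R _).toLinearMap ∘ₗ
    LinearMap.rTensor _ (barTCounit R g) ∘ₗ barDeconc R g) LinearMap.id (by simp)
    (fun m a h => ?_) m
  exact counit_left_homotopy (s := LinearMap.id) (h := LinearMap.mulRight R (barLetter R g a))
    (fun b => barTCounit_mul_letter b a) (by simp) (fun b => barDeconc_mul_letter b a) h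

theorem barDeconc_counit_right (m : BarT R g) :
    TensorProduct.rid R _ (LinearMap.lTensor _ (barTCounit R g) (barDeconc R g m)) = m := by
  refine barT_hom ((TensorProduct.rid R _).toLinearMap ∘ₗ
    LinearMap.lTensor _ (barTCounit R g) ∘ₗ barDeconc R g) LinearMap.id (by simp)
    (fun m a _ => ?_) m
  exact counit_right_homotopy (s := LinearMap.id) (h := LinearMap.mulRight R (barLetter R g a))
    (fun b => barTCounit_mul_letter b a) barTCounit_one (fun b => barDeconc_mul_letter b a) m

end BarRules

/-! ### The grading of T' -/

section BarGrading

variable {R : Type*} [CommRing R] {g : Type*} [LieRing g] [LieAlgebra R g]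

open ExteriorAlgebra (ι ιInv)

theorem augProj_mem {k : ℕ} {a : ExteriorAlgebra R g} (ha : a ∈ ⋀[R]^k g) :
    ((augProj R g a : AugIdeal R g) : ExteriorAlgebra R g) ∈ ⋀[R]^k g := by
  rw [augProj_coe]
  by_cases hk : k = 0
  · subst hk
    exact Submodule.sub_mem _ ha (Submodule.smul_mem _ _ one_mem_extPower)
  · rw [extCounit_of_mem hk ha, zero_smul, sub_zero]
    exact ha

theorem one_mem_barTGr : (1 : BarT R g) ∈ barTGr R g 0 := Submodule.subset_span IsBarWord.nil

theorem mul_letter_mem_barTGr {n k : ℕ} {m : BarT R g} {a : ExteriorAlgebra R g}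
    (hm : m ∈ barTGr R g n) (ha : a ∈ ⋀[R]^k g) :
    m * barLetter R g a ∈ barTGr R g (n + (k + 1)) := by
  suffices h : barTGr R g n ≤ (barTGr R g (n + (k + 1))).comap
    (LinearMap.mulRight R (barLetter R g a)) from h hm
  exact Submodule.span_le.mpr fun m hm =>
    Submodule.subset_span (IsBarWord.append hm (augProj R g a) (augProj_mem ha))

/-- Generation of the tensor coalgebra by homogeneous letters in the graded sense. -/
theorem barTGr_generation (Q : ℕ → Submodule R (BarT R g)) (h1 : 1 ∈ Q 0)
    (hmul : ∀ n k, ∀ m ∈ Q n, ∀ a ∈ ⋀[R]^k g, m * barLetter R g a ∈ Q (n + (k + 1))) {n : ℕ}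
    {m : BarT R g} (hm : m ∈ barTGr R g n) : m ∈ Q n := by
  suffices h : barTGr R g n ≤ Q n from h hm
  clear hm m
  refine Submodule.span_le.mpr fun m hm => ?_
  induction hm with
  | nil => exact h1
  | append _ x hx ih => rw [← barLetter_coe]; exact hmul _ _ _ ih _ hx

theorem barSign_of_mem (n : ℕ) (m : BarT R g) (hm : m ∈ barTGr R g n) :
    barSign R g m = (-1 : R) ^ n • m := by
  refine barTGr_generation (fun n => LinearMap.eqLocus (barSign R g) ((-1 : R) ^ n • LinearMap.id))
    (by simp) (fun n k m h a ha => ?_) hm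
  simp only [LinearMap.mem_eqLocus, LinearMap.smul_apply, LinearMap.id_apply] at h ⊢
  rw [barSign_mul_letter, h, extSign_of_mem ha, map_smul, smul_mul_smul_comm, pow_add, pow_succ,
    ← mul_assoc, mul_neg_one, neg_smul]

theorem barTCounit_of_mem (n : ℕ) (hn : n ≠ 0) (m : BarT R g) (hm : m ∈ barTGr R g n) :
    barTCounit R g m = 0 := by
  have h := barTGr_generation (fun n => if n = 0 then ⊤ else LinearMap.ker (barTCounit R g))
    (by simp) (fun n k m _ a _ => by simp) hm
  simpa [hn] using h

theorem barTAct_mem (Y : g) (n : ℕ) (m : BarT R g) (hm : m ∈ barTGr R g n) :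
    barTAct R g Y m ∈ barTGr R g n := by
  refine (barTGr_generation (fun n => barTGr R g n ⊓ (barTGr R g n).comap (barTAct R g Y))
    ⟨one_mem_barTGr, by simp⟩ (fun n k m h a ha => ?_) hm).2
  refine ⟨mul_letter_mem_barTGr h.1 ha, ?_⟩
  change barTAct R g Y (m * barLetter R g a) ∈ barTGr R g (n + (k + 1))
  rw [barTAct_mul_letter]
  exact Submodule.add_mem _ (mul_letter_mem_barTGr h.1 (extAct_mem Y ha))
    (mul_letter_mem_barTGr h.2 ha)

theorem barDeconc_mem (n : ℕ) (m : BarT R g) (hm : m ∈ barTGr R g n) :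
    barDeconc R g m ∈ grTensor (barTGr R g) (barTGr R g) n := by
  refine (barTGr_generation (fun n => barTGr R g n ⊓ (grTensor (barTGr R g) (barTGr R g) n).comap
    (barDeconc R g)) ⟨one_mem_barTGr, ?_⟩ (fun n k m h a ha => ?_) hm).2
  · change barDeconc R g 1 ∈ grTensor (barTGr R g) (barTGr R g) 0
    rw [barDeconc_one]
    exact tmul_mem_grTensor one_mem_barTGr one_mem_barTGr rfl
  · refine ⟨mul_letter_mem_barTGr h.1 ha, ?_⟩
    change barDeconc R g (m * barLetter R g a) ∈
      grTensor (barTGr R g) (barTGr R g) (n + (k + 1))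
    rw [barDeconc_mul_letter]
    refine Submodule.add_mem _ (tmul_mem_grTensor (mul_letter_mem_barTGr h.1 ha)
      one_mem_barTGr rfl) ?_
    refine map_mem_of_mem_grTensor h.2 (LinearMap.lTensor _ (LinearMap.mulRight R
      (barLetter R g a))) _ (fun i j hij p hp q hq => ?_)
    exact tmul_mem_grTensor hp (mul_letter_mem_barTGr hq ha) (by omega)

/-- The map `sw ↦ ∑ s(w_k) X^(k+1)` in terms of the homogeneous constituents `w_k` of `w`. -/
def letterWeight (R : Type*) [CommRing R] (g : Type*) [LieRing g] [LieAlgebra R g] :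
    ExteriorAlgebra R g →ₗ[R] Polynomial (BarT R g) :=
  DirectSum.toModule R ℕ _ (fun k => (Polynomial.monomial (k + 1)).restrictScalars R ∘ₗ
    barLetter R g ∘ₗ (⋀[R]^k g).subtype) ∘ₗ
      (DirectSum.decomposeLinearEquiv (fun k : ℕ => ⋀[R]^k g)).toLinearMap

theorem letterWeight_of_mem {k : ℕ} {a : ExteriorAlgebra R g} (ha : a ∈ ⋀[R]^k g) :
    letterWeight R g a = Polynomial.monomial (k + 1) (barLetter R g a) := by
  lift a to ⋀[R]^k g using ha
  rw [letterWeight, LinearMap.comp_apply, LinearEquiv.coe_coe,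
    DirectSum.decomposeLinearEquiv_apply_coe (fun k : ℕ => ⋀[R]^k g), DirectSum.toModule_lof]
  rfl

/-- The morphism `T' → T'[X]` that records the degrees of words. -/
def barWeight (R : Type*) [CommRing R] (g : Type*) [LieRing g] [LieAlgebra R g] :
    BarT R g →ₐ[R] Polynomial (BarT R g) :=
  TensorAlgebra.lift R (letterWeight R g ∘ₗ (LinearMap.ker (extCounit R g)).subtype)

theorem barWeight_of_mem (n : ℕ) (m : BarT R g) (hm : m ∈ barTGr R g n) :
    barWeight R g m = Polynomial.monomial n m := by
  refine barTGr_generation (fun n => LinearMap.eqLocus (barWeight R g).toLinearMap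
    ((Polynomial.monomial n).restrictScalars R)) ?_ (fun n k m h a ha => ?_) hm
  · simp only [LinearMap.mem_eqLocus, AlgHom.toLinearMap_apply, map_one]
    rfl
  · simp only [LinearMap.mem_eqLocus, AlgHom.toLinearMap_apply,
      LinearMap.restrictScalars_apply] at h ⊢
    have h2 : barWeight R g (barLetter R g a) =
        Polynomial.monomial (k + 1) (barLetter R g a) := by
      rw [barLetter_eq, barWeight, TensorAlgebra.lift_ι_apply, LinearMap.comp_apply,
        Submodule.subtype_apply, letterWeight_of_mem (augProj_mem ha), barLetter_coe]
    rw [map_mul, h, h2, Polynomial.monomial_mul_monomial]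

/-- The projection of `T'` to its homogeneous constituents. -/
def barProj (R : Type*) [CommRing R] (g : Type*) [LieRing g] [LieAlgebra R g] (n : ℕ) :
    BarT R g →ₗ[R] BarT R g :=
  (Polynomial.lcoeff (BarT R g) n).restrictScalars R ∘ₗ (barWeight R g).toLinearMap

theorem barProj_of_mem (k n : ℕ) (m : BarT R g) (hm : m ∈ barTGr R g n) :
    barProj R g k m = if k = n then m else 0 := by
  change (barWeight R g m).coeff k = _
  rw [barWeight_of_mem n m hm, Polynomial.coeff_monomial]
  simp [eq_comm]

theorem iSup_barTGr : ⨆ n, barTGr R g n = ⊤ := by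
  rw [eq_top_iff]
  rintro m -
  -- Membership in the span is rephrased as vanishing in the quotient, so that induction on words
  -- for linear maps applies.
  have h := barT_hom (Submodule.mkQ (⨆ n, barTGr R g n)) 0
    (by
      rw [LinearMap.zero_apply, Submodule.mkQ_apply, Submodule.Quotient.mk_eq_zero]
      exact Submodule.mem_iSup_of_mem 0 one_mem_barTGr)
    (fun m a h => by
      rw [LinearMap.zero_apply, Submodule.mkQ_apply, Submodule.Quotient.mk_eq_zero] at h ⊢
      have ha : a ∈ ⨆ n : ℕ, (⋀[R]^n g : Submodule R (ExteriorAlgebra R g)) :=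
        iSup_extPower (R := R) (g := g) ▸ Submodule.mem_top
      have hle : Submodule.map₂ ((LinearMap.mul R (BarT R g)).compl₂ (barLetter R g))
          (⨆ n, barTGr R g n) (⨆ n : ℕ, ⋀[R]^n g) ≤ ⨆ n, barTGr R g n := by
        simp only [Submodule.map₂_iSup_left, Submodule.map₂_iSup_right]
        refine iSup_le fun i => iSup_le fun j => Submodule.map₂_le.mpr fun c hc a ha => ?_
        exact Submodule.mem_iSup_of_mem _ (mul_letter_mem_barTGr hc ha)
      exact hle (Submodule.apply_mem_map₂ _ h ha)) m
  rwa [LinearMap.zero_apply, Submodule.mkQ_apply, Submodule.Quotient.mk_eq_zero] at h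

end BarGrading

/-! ### Signs and the two operators on T' -/

section BarSignRules

variable {R : Type*} [CommRing R] {g : Type*} [LieRing g] [LieAlgebra R g]

open ExteriorAlgebra (ι ιInv)

theorem barSplit_barSign (m : BarT R g) : barSplit R g (barSign R g m) =
    -TensorProduct.map (barSign R g) (extSign R g) (barSplit R g m) := by
  refine barT_hom (barSplit R g ∘ₗ barSign R g)
    (-TensorProduct.map (barSign R g) (extSign R g) ∘ₗ barSplit R g) (by simp) (fun m a _ => ?_) m
  simp [barSign_mul_letter, barSplit_mul_letter]

/-- Reattaching the last letter loses only the part of length zero. In `relBarD_barHomotopy` this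
lost part becomes the counit term. -/
theorem barSplit_recombine (m : BarT R g) :
    LinearMap.mul' R (BarT R g) (LinearMap.lTensor _ (barLetter R g) (barSplit R g m)) =
      m - barTCounit R g m • 1 := by
  refine barT_hom (LinearMap.mul' R (BarT R g) ∘ₗ LinearMap.lTensor _ (barLetter R g) ∘ₗ
    barSplit R g) (LinearMap.id - (barTCounit R g).smulRight 1) (by simp) (fun m a _ => ?_) m
  simp [barSplit_mul_letter]

theorem barD_barSign (m : BarT R g) :
    barD R g (barSign R g m) = -barSign R g (barD R g m) := by
  refine barT_hom (barD R g ∘ₗ barSign R g) (-(barSign R g ∘ₗ barD R g)) (by simp)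
    (fun m a h => ?_) m
  simp only [LinearMap.comp_apply, LinearMap.neg_apply] at h ⊢
  rw [barSign_mul_letter, map_neg, barD_mul_letter, barD_mul_letter, map_add, barSign_mul_letter,
    h, barSplit_barSign, neg_inj, extCounit_extSign]
  have key : ∀ z : BarT R g ⊗[R] ExteriorAlgebra R g,
      LinearMap.mul' R (BarT R g) (TensorProduct.map (barSign R g)
        (barLetter R g ∘ₗ LinearMap.mulRight R (extSign R g a - extCounit R g a • 1) ∘ₗ
          (-extSign R g)) (-TensorProduct.map (barSign R g) (extSign R g) z)) =
      barSign R g (LinearMap.mul' R (BarT R g) (TensorProduct.map (barSign R g)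
        (barLetter R g ∘ₗ LinearMap.mulRight R (a - extCounit R g a • 1) ∘ₗ
          (-extSign R g)) z)) := by
    refine eq_of_tmul (LinearMap.mul' R (BarT R g) ∘ₗ TensorProduct.map (barSign R g)
        (barLetter R g ∘ₗ LinearMap.mulRight R (extSign R g a - extCounit R g a • 1) ∘ₗ
          (-extSign R g)) ∘ₗ (-TensorProduct.map (barSign R g) (extSign R g)))
      (barSign R g ∘ₗ LinearMap.mul' R (BarT R g) ∘ₗ TensorProduct.map (barSign R g)
        (barLetter R g ∘ₗ LinearMap.mulRight R (a - extCounit R g a • 1) ∘ₗ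
          (-extSign R g))) (fun x y => ?_)
    simp [barSign_mul_letter, extSign_extSign]
  rw [key]
  noncomm_ring

theorem barBoundary_barSign (m : BarT R g) :
    barBoundary R g (barSign R g m) = -barSign R g (barBoundary R g m) := by
  refine barT_hom (barBoundary R g ∘ₗ barSign R g) (-(barSign R g ∘ₗ barBoundary R g)) (by simp)
    (fun m a h => ?_) m
  simp only [LinearMap.comp_apply, LinearMap.neg_apply] at h ⊢
  rw [barSign_mul_letter, map_neg, barBoundary_mul_letter, barBoundary_mul_letter, map_add,
    map_sub, map_neg, barSign_mul_letter, barSign_mul_letter, h, extBoundary_extSign,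
    extComul_extSign, map_neg]
  have key : ∀ z : ExteriorAlgebra R g ⊗[R] ExteriorAlgebra R g,
      LinearMap.mul' R (BarT R g) (TensorProduct.map
        ((barTAct R g).flip (barSign R g (barSign R g m)) ∘ₗ ExteriorAlgebra.ιInv)
        (barLetter R g) (TensorProduct.map (extSign R g) (extSign R g) z)) =
      barSign R g (LinearMap.mul' R (BarT R g) (TensorProduct.map
        ((barTAct R g).flip (barSign R g m) ∘ₗ ExteriorAlgebra.ιInv)
        (barLetter R g) z)) := by
    refine eq_of_tmul (LinearMap.mul' R (BarT R g) ∘ₗ TensorProduct.map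
        ((barTAct R g).flip (barSign R g (barSign R g m)) ∘ₗ ExteriorAlgebra.ιInv)
        (barLetter R g) ∘ₗ TensorProduct.map (extSign R g) (extSign R g))
      (barSign R g ∘ₗ LinearMap.mul' R (BarT R g) ∘ₗ TensorProduct.map
        ((barTAct R g).flip (barSign R g m) ∘ₗ ExteriorAlgebra.ιInv)
        (barLetter R g)) (fun x y => ?_)
    simp [barSign_mul_letter, ιInv_extSign, barSign_barTAct]
  rw [key]
  noncomm_ring

end BarSignRules

/-! ### The contracting homotopy of the relative bar module -/

section RelBarRules

variable {R : Type*} [CommRing R] {g : Type*} [LieRing g] [LieAlgebra R g]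

open ExteriorAlgebra (ι ιInv)

@[simp]
theorem barHomotopy_tmul (m : BarT R g) (a : ExteriorAlgebra R g) :
    barHomotopy R g (m ⊗ₜ a) = (barSign R g m * barLetter R g a) ⊗ₜ 1 := rfl

/-- Linear maps on `BΛ_∂[sg]` agree if they agree on `1 ⊗ 1` and agreement is preserved by the
right multiplications with generators of `Λ` and by the contracting homotopy. -/
theorem relBar_hom {X : Type*} [AddCommMonoid X] [Module R X] (f f' : RelBar R g →ₗ[R] X)
    (h1 : f (1 ⊗ₜ 1) = f' (1 ⊗ₜ 1))
    (hmul : ∀ v b, f b = f' b → f (relBarActOdd R g v b) = f' (relBarActOdd R g v b))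
    (hh : ∀ b, f b = f' b → f (barHomotopy R g b) = f' (barHomotopy R g b))
    (b : RelBar R g) : f b = f' b := by
  refine tensor_hom f f' (fun m => ?_) hmul b
  have hall : ∀ m : BarT R g, f (m ⊗ₜ 1) = f' (m ⊗ₜ 1) → ∀ a, f (m ⊗ₜ a) = f' (m ⊗ₜ a) :=
    fun m hm => ext_right_hom (f ∘ₗ TensorProduct.mk R _ _ m) (f' ∘ₗ TensorProduct.mk R _ _ m) hm
      fun v a h => hmul v _ h
  -- The homotopy appends a letter to the sign-twisted word, so agreement is carried for m and
  -- `barSign` of m at the same time.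
  have key := barT_hom ((f ∘ₗ inclOne R g _).prod (f ∘ₗ inclOne R g _ ∘ₗ barSign R g))
    ((f' ∘ₗ inclOne R g _).prod (f' ∘ₗ inclOne R g _ ∘ₗ barSign R g)) (by simp [h1])
    (fun m a h => by
      simp only [LinearMap.prod_apply, Function.prod_apply, LinearMap.comp_apply,
        inclOne_apply, Prod.mk.injEq] at h ⊢
      refine ⟨?_, ?_⟩
      · have := hh _ (hall _ h.2 a)
        rwa [barHomotopy_tmul, barSign_barSign] at this
      · have := hh _ (hall _ h.1 (extSign R g a))
        rw [barHomotopy_tmul] at this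
        rw [barSign_mul_letter, TensorProduct.neg_tmul, ← neg_one_smul R, map_smul, map_smul, this]) m
  exact congrArg Prod.fst key

theorem relBarSign_barHomotopy (b : RelBar R g) :
    relBarSign R g (barHomotopy R g b) = -barHomotopy R g (relBarSign R g b) := by
  refine eq_of_tmul (relBarSign R g ∘ₗ barHomotopy R g) (-(barHomotopy R g ∘ₗ relBarSign R g))
    (fun m a => ?_) b
  simp [relBarSign, barSign_mul_letter, TensorProduct.neg_tmul]

theorem relBarActEven_barHomotopy (Y : g) (b : RelBar R g) :
    relBarActEven R g Y (barHomotopy R g b) = barHomotopy R g (relBarActEven R g Y b) := by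
  refine eq_of_tmul (relBarActEven R g Y ∘ₗ barHomotopy R g)
    (barHomotopy R g ∘ₗ relBarActEven R g Y) (fun m a => ?_) b
  simp only [LinearMap.comp_apply, relBarActEven, actEven_tmul, barHomotopy_tmul, map_add,
    barTAct_mul_letter, barSign_barTAct, TensorProduct.add_tmul, extAct_one,
    TensorProduct.tmul_zero, add_zero]
  exact add_comm _ _

theorem relBarCounit_barHomotopy (b : RelBar R g) :
    relBarCounit R g (barHomotopy R g b) = 0 := by
  refine eq_of_tmul (relBarCounit R g ∘ₗ barHomotopy R g) 0 (fun m a => ?_) b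
  simp [relBarCounit]

theorem relBarD_one : relBarD R g (1 ⊗ₜ 1) = 0 := by
  rw [relBarD, twistedD_tmul_one]
  simp

/-- The operator `-h` is a contracting homotopy for the differential of `BΛ_∂[sg]`. -/
theorem relBarD_barHomotopy (b : RelBar R g) :
    relBarD R g (barHomotopy R g b) =
      -b + relBarCounit R g b • (1 ⊗ₜ 1) - barHomotopy R g (relBarD R g b) := by
  refine eq_of_tmul (relBarD R g ∘ₗ barHomotopy R g) (-LinearMap.id +
    (relBarCounit R g).smulRight (1 ⊗ₜ 1) - barHomotopy R g ∘ₗ relBarD R g) (fun m a => ?_) b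
  simp only [LinearMap.comp_apply, LinearMap.sub_apply, LinearMap.add_apply, LinearMap.neg_apply,
    LinearMap.id_apply, LinearMap.smulRight_apply, barHomotopy_tmul, relBarD, twistedD_tmul_one]
  rw [twistedD_tmul]
  simp only [LinearMap.add_apply, map_add, map_sub, barHomotopy_tmul, barSign_barSign,
    barSplit_mul_letter, map_smul, LinearMap.rTensor_tmul, barD_mul_letter, barBoundary_mul_letter,
    barD_barSign, barBoundary_barSign, barSplit_barSign, map_neg, relBarCounit, tensorCounit_tmul]
  -- Fusing the last letter of m with a, as the bar differential does, cancels against the homotopy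
  -- applied to the cap product, except for the augmentation of a.
  have h1 : ∀ z : BarT R g ⊗[R] ExteriorAlgebra R g, LinearMap.mul' R (BarT R g)
      (TensorProduct.map (barSign R g) (barLetter R g ∘ₗ
        LinearMap.mulRight R (a - extCounit R g a • 1) ∘ₗ (-extSign R g))
          (TensorProduct.map (barSign R g) (extSign R g) z)) ⊗ₜ[R] (1 : ExteriorAlgebra R g) =
      -barHomotopy R g (LinearMap.lTensor _ (LinearMap.mulRight R a)
        (LinearMap.rTensor _ (barSign R g) z)) + extCounit R g a •
          (LinearMap.mul' R (BarT R g) (LinearMap.lTensor _ (barLetter R g) z)) ⊗ₜ 1 := by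
    refine eq_of_tmul (inclOne R g _ ∘ₗ LinearMap.mul' R (BarT R g) ∘ₗ
      TensorProduct.map (barSign R g) (barLetter R g ∘ₗ
        LinearMap.mulRight R (a - extCounit R g a • 1) ∘ₗ (-extSign R g)) ∘ₗ
          TensorProduct.map (barSign R g) (extSign R g))
      (-(barHomotopy R g ∘ₗ LinearMap.lTensor _ (LinearMap.mulRight R a) ∘ₗ
        LinearMap.rTensor _ (barSign R g)) + extCounit R g a • inclOne R g _ ∘ₗ
          LinearMap.mul' R (BarT R g) ∘ₗ LinearMap.lTensor _ (barLetter R g)) (fun x y => ?_)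
    simp [extSign_extSign, mul_sub, TensorProduct.sub_tmul,
      TensorProduct.smul_tmul']
    abel
  -- The action term of D on m ⊗ a, followed by h, is the action term of ∂ on T' once a has become a
  -- letter.
  have h2 : ∀ z : ExteriorAlgebra R g ⊗[R] ExteriorAlgebra R g, barHomotopy R g
      (TensorProduct.lift ((TensorProduct.mk R (BarT R g) _).compl₁₂
        ((barTAct R g).flip (barSign R g m) ∘ₗ ιInv) LinearMap.id) z) =
      (LinearMap.mul' R (BarT R g) (TensorProduct.map ((barTAct R g).flip m ∘ₗ ιInv)
        (barLetter R g) z)) ⊗ₜ 1 := by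
    refine eq_of_tmul (barHomotopy R g ∘ₗ TensorProduct.lift
      ((TensorProduct.mk R (BarT R g) _).compl₁₂ ((barTAct R g).flip (barSign R g m) ∘ₗ ιInv)
        LinearMap.id)) (inclOne R g _ ∘ₗ LinearMap.mul' R (BarT R g) ∘ₗ TensorProduct.map
          ((barTAct R g).flip m ∘ₗ ιInv) (barLetter R g)) (fun x y => ?_)
    simp [barSign_barTAct]
  rw [h2]
  simp only [TensorProduct.add_tmul, TensorProduct.sub_tmul, TensorProduct.neg_tmul, h1,
    barSplit_recombine, neg_mul, add_mul, TensorProduct.smul_tmul', smul_sub, smul_smul,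
    mul_comm (extCounit R g a) (barTCounit R g m), neg_add, neg_neg, neg_sub]
  abel

end RelBarRules

/-! ### The differential of the relative bar module -/

section RelBarDifferential

variable {R : Type*} [CommRing R] {g : Type*} [LieRing g] [LieAlgebra R g]

open ExteriorAlgebra (ι ιInv)

theorem barTAct_comm (Y Z : g) (m : BarT R g) :
    barTAct R g Z (barTAct R g Y m) - barTAct R g Y (barTAct R g Z m) = barTAct R g ⁅Y, Z⁆ m := by
  refine barT_hom (barTAct R g Z ∘ₗ barTAct R g Y - barTAct R g Y ∘ₗ barTAct R g Z)
    (barTAct R g ⁅Y, Z⁆) (by simp) (fun m a h => ?_) m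
  simp only [LinearMap.sub_apply, LinearMap.comp_apply] at h ⊢
  simp only [barTAct_mul_letter, map_add, ← h, ← extAct_comm, map_sub, mul_sub, sub_mul]
  abel

theorem relBarD_actOdd (v : g) (b : RelBar R g) :
    relBarD R g (relBarActOdd R g v b) =
      relBarActOdd R g v (relBarD R g b) + relBarActEven R g v (relBarSign R g b) :=
  twistedD_actOdd _ _ _ _ v b

theorem relBarSign_actOdd (v : g) (b : RelBar R g) :
    relBarSign R g (relBarActOdd R g v b) = -relBarActOdd R g v (relBarSign R g b) :=
  tensorSign_actOdd _ v b

theorem relBarSign_actEven (Y : g) (b : RelBar R g) :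
    relBarSign R g (relBarActEven R g Y b) = relBarActEven R g Y (relBarSign R g b) :=
  tensorSign_actEven (barSign_barTAct Y) b

theorem relBarSign_relBarSign (b : RelBar R g) : relBarSign R g (relBarSign R g b) = b :=
  tensorSign_tensorSign barSign_barSign b

theorem relBarSign_one : relBarSign R g (1 ⊗ₜ 1) = 1 ⊗ₜ 1 := by
  simp [relBarSign]

theorem relBarActEven_one (Y : g) : relBarActEven R g Y (1 ⊗ₜ 1) = 0 := by
  simp [relBarActEven]

theorem relBarCounit_one : relBarCounit R g (1 ⊗ₜ 1) = 1 := by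
  simp [relBarCounit]

theorem relBarCounit_relBarSign (b : RelBar R g) :
    relBarCounit R g (relBarSign R g b) = relBarCounit R g b :=
  tensorCounit_tensorSign barTCounit_barSign b

theorem relBarCounit_actEven (Y : g) (b : RelBar R g) :
    relBarCounit R g (relBarActEven R g Y b) = 0 :=
  tensorCounit_actEven (barTCounit_barTAct Y) b

theorem relBarCounit_actOdd (v : g) (b : RelBar R g) :
    relBarCounit R g (relBarActOdd R g v b) = 0 :=
  tensorCounit_actOdd v b

theorem relBarD_relBarSign (b : RelBar R g) :
    relBarD R g (relBarSign R g b) = -relBarSign R g (relBarD R g b) := by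
  refine relBar_hom (relBarD R g ∘ₗ relBarSign R g) (-(relBarSign R g ∘ₗ relBarD R g)) ?_
    (fun v b h => diff_sign_step (relBarD_actOdd v) (relBarSign_actOdd v) (relBarSign_actEven v) h)
    (fun b h => ?_) b
  · simp only [LinearMap.comp_apply, LinearMap.neg_apply]
    rw [relBarSign_one, relBarD_one, map_zero, neg_zero]
  · simp only [LinearMap.comp_apply, LinearMap.neg_apply] at h ⊢
    rw [relBarSign_barHomotopy, map_neg, relBarD_barHomotopy, relBarD_barHomotopy, h, map_sub,
      map_add, map_neg, map_smul, relBarSign_one, relBarSign_barHomotopy, relBarCounit_relBarSign,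
      map_neg]

theorem relBarD_actEven (Z : g) (b : RelBar R g) :
    relBarD R g (relBarActEven R g Z b) = relBarActEven R g Z (relBarD R g b) := by
  refine relBar_hom (relBarD R g ∘ₗ relBarActEven R g Z) (relBarActEven R g Z ∘ₗ relBarD R g) ?_
    (fun v b h => diff_act_step (relBarD_actOdd v) (relBarD_actOdd ⁅v, Z⁆)
      (actEven_actOdd (barTAct R g) v Z) (relBarSign_actEven Z)
      (actEven_comm barTAct_comm v Z) h) (fun b h => ?_) b
  · simp only [LinearMap.comp_apply]
    rw [relBarActEven_one, relBarD_one, map_zero, map_zero]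
  · simp only [LinearMap.comp_apply] at h ⊢
    rw [relBarActEven_barHomotopy, relBarD_barHomotopy, relBarD_barHomotopy, h, map_sub,
      map_add, map_neg, map_smul, relBarActEven_one, relBarActEven_barHomotopy,
      relBarCounit_actEven, zero_smul, smul_zero]

theorem relBarCounit_relBarD (b : RelBar R g) : relBarCounit R g (relBarD R g b) = 0 := by
  refine relBar_hom (relBarCounit R g ∘ₗ relBarD R g) 0 ?_ (fun v b _ => ?_) (fun b _ => ?_) b
  · simp only [LinearMap.comp_apply]
    rw [relBarD_one, map_zero, LinearMap.zero_apply]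
  · simp only [LinearMap.comp_apply]
    rw [relBarD_actOdd, map_add, relBarCounit_actOdd, relBarCounit_actEven, zero_add,
      LinearMap.zero_apply]
  · simp only [LinearMap.comp_apply]
    rw [relBarD_barHomotopy, map_sub, map_add, map_neg, map_smul, relBarCounit_one,
      relBarCounit_barHomotopy, smul_eq_mul, mul_one, neg_add_cancel, sub_zero,
      LinearMap.zero_apply]

/-- Applying D to the homotopy relation gives D D h = h D D, because D e = 0 and the counit vanishes
on boundaries. The case of right multiplications is `sq_diff_step`. -/
theorem relBarD_relBarD (b : RelBar R g) : relBarD R g (relBarD R g b) = 0 := by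
  refine relBar_hom (relBarD R g ∘ₗ relBarD R g) 0 ?_
    (fun v b h => sq_diff_step (relBarD_actOdd v) relBarD_relBarSign (relBarD_actEven v) h)
    (fun b h => ?_) b
  · simp only [LinearMap.comp_apply]
    rw [relBarD_one, map_zero, LinearMap.zero_apply]
  · simp only [LinearMap.comp_apply, LinearMap.zero_apply] at h ⊢
    rw [relBarD_barHomotopy, map_sub, map_add, map_neg, map_smul, relBarD_one,
      relBarD_barHomotopy, h, relBarCounit_relBarD, map_zero]
    simp

end RelBarDifferential

/-! ### The Alexander–Whitney diagonal -/

section RelBarDiagonal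

variable {R : Type*} [CommRing R] {g : Type*} [LieRing g] [LieAlgebra R g]

open ExteriorAlgebra (ι ιInv)

theorem diagStep_apply (v : g) (z : RelBar R g ⊗[R] RelBar R g) :
    diagStep R g v z = diagOp (relBarActOdd R g v) (relBarSign R g) z := rfl

theorem diagAct_one (z : RelBar R g ⊗[R] RelBar R g) : diagAct R g 1 z = z := by
  simp [diagAct]

theorem diagAct_mul_ι (a : ExteriorAlgebra R g) (v : g) (z : RelBar R g ⊗[R] RelBar R g) :
    diagAct R g (a * ι R v) z =
      diagOp (relBarActOdd R g v) (relBarSign R g) (diagAct R g a z) := by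
  rw [← diagStep_apply]
  simp [diagAct]

theorem map_sign_diagAct (a : ExteriorAlgebra R g) (z : RelBar R g ⊗[R] RelBar R g) :
    TensorProduct.map (relBarSign R g) (relBarSign R g) (diagAct R g a z) =
      diagAct R g (extSign R g a)
        (TensorProduct.map (relBarSign R g) (relBarSign R g) z) := by
  refine ext_right_hom
    (TensorProduct.map (relBarSign R g) (relBarSign R g) ∘ₗ (diagAct R g).flip z)
    ((diagAct R g).flip (TensorProduct.map (relBarSign R g) (relBarSign R g) z) ∘ₗ extSign R g)
    ?_ (fun v a h => ?_) a
  · simp only [LinearMap.comp_apply, LinearMap.flip_apply, extSign_one, diagAct_one]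
  · simp only [LinearMap.comp_apply, LinearMap.flip_apply] at h ⊢
    rw [extSign_mul_ι, ← mul_neg, ← map_neg (ι R), diagAct_mul_ι, diagAct_mul_ι, ← h, map_neg]
    exact map_sign_diagOp (relBarSign_actOdd v) _

theorem barHomotopy_tmul_one (m : BarT R g) : barHomotopy R g (m ⊗ₜ 1) = 0 := by
  simp

theorem barHomotopy_barHomotopy (b : RelBar R g) : barHomotopy R g (barHomotopy R g b) = 0 := by
  refine eq_of_tmul (barHomotopy R g ∘ₗ barHomotopy R g) 0 (fun m a => ?_) b
  simp

theorem awComulT_one : awComulT R g 1 = (1 ⊗ₜ 1) ⊗ₜ (1 ⊗ₜ 1) := by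
  rw [awComulT, tensorRec_one]

theorem awComulT_mul_coe (m : BarT R g) (x : AugIdeal R g) :
    awComulT R g (m * TensorAlgebra.ι R x) =
      ((m * TensorAlgebra.ι R x) ⊗ₜ 1) ⊗ₜ (1 ⊗ₜ 1) +
        TensorProduct.map (relBarSign R g) (barHomotopy R g)
          (diagAct R g (x : ExteriorAlgebra R g)
            (TensorProduct.map (relBarSign R g) (relBarSign R g) (awComulT R g m))) := by
  rw [awComulT, tensorRec_mul_ι]
  rfl

/-- The second factors are multiples of 1 ⊗ 1 or lie in the image of h, and h kills both since h h =
0. -/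
theorem homotopy_awComulT (f : RelBar R g →ₗ[R] RelBar R g) (m : BarT R g) :
    TensorProduct.map f (barHomotopy R g) (awComulT R g m) = 0 := by
  refine tensorAlgebra_hom (TensorProduct.map f (barHomotopy R g) ∘ₗ awComulT R g) 0 ?_
    (fun m x _ => ?_) m
  · simp [awComulT_one]
  · rw [LinearMap.comp_apply, awComulT_mul_coe, map_add, TensorProduct.map_tmul,
      barHomotopy_tmul_one, TensorProduct.tmul_zero, zero_add]
    refine eq_of_tmul (TensorProduct.map f (barHomotopy R g) ∘ₗ
      TensorProduct.map (relBarSign R g) (barHomotopy R g)) 0 (fun y z => ?_) _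
    rw [LinearMap.comp_apply, TensorProduct.map_tmul, TensorProduct.map_tmul,
      barHomotopy_barHomotopy, TensorProduct.tmul_zero, LinearMap.zero_apply]

theorem homotopy_sign_awComulT (m : BarT R g) :
    TensorProduct.map (relBarSign R g) (barHomotopy R g)
      (TensorProduct.map (relBarSign R g) (relBarSign R g) (awComulT R g m)) = 0 := by
  have h : ∀ z : RelBar R g ⊗[R] RelBar R g,
      TensorProduct.map (relBarSign R g) (barHomotopy R g)
        (TensorProduct.map (relBarSign R g) (relBarSign R g) z) =
      LinearMap.lTensor _ (-relBarSign R g)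
        (TensorProduct.map LinearMap.id (barHomotopy R g) z) := by
    refine eq_of_tmul (TensorProduct.map (relBarSign R g) (barHomotopy R g) ∘ₗ
      TensorProduct.map (relBarSign R g) (relBarSign R g)) (LinearMap.lTensor _ (-relBarSign R g) ∘ₗ
        TensorProduct.map LinearMap.id (barHomotopy R g)) (fun x y => ?_)
    simp only [LinearMap.comp_apply, TensorProduct.map_tmul, LinearMap.lTensor_tmul,
      relBarSign_relBarSign, LinearMap.neg_apply, relBarSign_barHomotopy, neg_neg,
      LinearMap.id_apply]
  rw [h, homotopy_awComulT, map_zero]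

theorem diagAct_augProj (a : ExteriorAlgebra R g) (z : RelBar R g ⊗[R] RelBar R g) :
    diagAct R g a z =
      diagAct R g (augProj R g a : ExteriorAlgebra R g) z + extCounit R g a • z := by
  have ha : (augProj R g a : ExteriorAlgebra R g) + extCounit R g a • 1 = a := by
    rw [augProj_coe, sub_add_cancel]
  have h2 := (LinearMap.congr_fun ((diagAct R g).map_add (augProj R g a : ExteriorAlgebra R g)
    (extCounit R g a • 1)) z).symm
  rw [ha] at h2
  refine h2.symm.trans ?_
  have h3 := LinearMap.congr_fun ((diagAct R g).map_smul (extCounit R g a) 1) z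
  rw [LinearMap.smul_apply, diagAct_one] at h3
  exact congrArg (fun w => diagAct R g (augProj R g a : ExteriorAlgebra R g) z + w) h3

/-- Extends the defining recursion from IΛ to Λ: the scalar part of a would contribute h applied to
second factors of Δ m, which vanishes by `homotopy_sign_awComulT`. -/
theorem awComulT_mul_letter (m : BarT R g) (a : ExteriorAlgebra R g) :
    awComulT R g (m * barLetter R g a) =
      ((m * barLetter R g a) ⊗ₜ 1) ⊗ₜ (1 ⊗ₜ 1) +
        TensorProduct.map (relBarSign R g) (barHomotopy R g)
          (diagAct R g a
            (TensorProduct.map (relBarSign R g) (relBarSign R g) (awComulT R g m))) := by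
  have h := congrArg (TensorProduct.map (relBarSign R g) (barHomotopy R g)) (diagAct_augProj a
    (TensorProduct.map (relBarSign R g) (relBarSign R g) (awComulT R g m)))
  rw [LinearMap.map_add, LinearMap.map_smul, homotopy_sign_awComulT, smul_zero, add_zero] at h
  rw [barLetter_eq, awComulT_mul_coe, h]

theorem awComulT_barSign (m : BarT R g) :
    awComulT R g (barSign R g m) =
      TensorProduct.map (relBarSign R g) (relBarSign R g) (awComulT R g m) := by
  refine barT_hom (awComulT R g ∘ₗ barSign R g)
    (TensorProduct.map (relBarSign R g) (relBarSign R g) ∘ₗ awComulT R g) ?_ (fun m a h => ?_) m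
  · simp only [LinearMap.comp_apply, barSign_one, awComulT_one, TensorProduct.map_tmul,
      relBarSign_one]
  · simp only [LinearMap.comp_apply] at h ⊢
    have h2 : relBarSign R g ((m * barLetter R g a) ⊗ₜ 1) =
        (-1 : R) • ((barSign R g m * barLetter R g (extSign R g a)) ⊗ₜ 1) := by
      rw [relBarSign, tensorSign_tmul, extSign_one, barSign_mul_letter, TensorProduct.neg_tmul]
      exact (neg_one_smul R _).symm
    have h3 : barSign R g (m * barLetter R g a) =
        (-1 : R) • (barSign R g m * barLetter R g (extSign R g a)) := by
      rw [barSign_mul_letter]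
      exact (neg_one_smul R _).symm
    rw [h3, LinearMap.map_smul, awComulT_mul_letter, awComulT_mul_letter, h, ← map_sign_diagAct]
    exact smul_homotopy_step relBarSign_barHomotopy relBarSign_one h2 _

theorem awComul_tmul (m : BarT R g) (a : ExteriorAlgebra R g) :
    awComul R g (m ⊗ₜ a) = diagAct R g a (awComulT R g m) := rfl

theorem awComul_tmul_one (m : BarT R g) : awComul R g (m ⊗ₜ 1) = awComulT R g m :=
  diagAct_one _

theorem awComul_one : awComul R g (1 ⊗ₜ 1) = (1 ⊗ₜ 1) ⊗ₜ (1 ⊗ₜ 1) := by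
  rw [awComul_tmul_one, awComulT_one]

theorem awComul_actOdd (v : g) (b : RelBar R g) :
    awComul R g (relBarActOdd R g v b) =
      diagOp (relBarActOdd R g v) (relBarSign R g) (awComul R g b) := by
  refine eq_of_tmul (awComul R g ∘ₗ relBarActOdd R g v)
    (diagOp (relBarActOdd R g v) (relBarSign R g) ∘ₗ awComul R g) (fun m a => ?_) b
  exact diagAct_mul_ι a v (awComulT R g m)

/-- The sign operators built into the recursion amount to replacing Δ m by Δ of the sign-twisted m,
which undoes the sign in h. -/
theorem awComul_barHomotopy (b : RelBar R g) :
    awComul R g (barHomotopy R g b) = barHomotopy R g b ⊗ₜ (1 ⊗ₜ 1) +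
      TensorProduct.map (relBarSign R g) (barHomotopy R g) (awComul R g b) := by
  refine eq_of_tmul (awComul R g ∘ₗ barHomotopy R g)
    ((TensorProduct.mk R _ _).flip (1 ⊗ₜ 1) ∘ₗ barHomotopy R g +
      TensorProduct.map (relBarSign R g) (barHomotopy R g) ∘ₗ awComul R g) (fun m a => ?_) b
  simp only [LinearMap.comp_apply, LinearMap.add_apply, LinearMap.flip_apply,
    TensorProduct.mk_apply, barHomotopy_tmul, awComul_tmul]
  rw [diagAct_one, awComulT_mul_letter, ← awComulT_barSign, barSign_barSign]

theorem awComul_relBarSign (b : RelBar R g) :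
    awComul R g (relBarSign R g b) =
      TensorProduct.map (relBarSign R g) (relBarSign R g) (awComul R g b) := by
  refine eq_of_tmul (awComul R g ∘ₗ relBarSign R g)
    (TensorProduct.map (relBarSign R g) (relBarSign R g) ∘ₗ awComul R g) (fun m a => ?_) b
  rw [LinearMap.comp_apply, LinearMap.comp_apply, relBarSign, tensorSign_tmul, ← relBarSign,
    awComul_tmul, awComul_tmul, map_sign_diagAct, awComulT_barSign]

theorem awComul_actEven (Y : g) (b : RelBar R g) :
    awComul R g (relBarActEven R g Y b) =
      diagOp (relBarActEven R g Y) LinearMap.id (awComul R g b) := by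
  refine relBar_hom (awComul R g ∘ₗ relBarActEven R g Y)
    (diagOp (relBarActEven R g Y) LinearMap.id ∘ₗ awComul R g) ?_
    (fun v b h => comul_act_diagOp (awComul_actOdd v) (awComul_actOdd ⁅v, Y⁆)
      (actEven_actOdd (barTAct R g) v Y) (relBarSign_actEven Y) h) (fun b h => ?_) b
  · simp only [LinearMap.comp_apply]
    rw [relBarActEven_one, awComul_one, map_zero, diagOp_tmul, relBarActEven_one,
      TensorProduct.zero_tmul, TensorProduct.tmul_zero, add_zero]
  · exact comul_act_homotopy (relBarActEven_one Y) (relBarActEven_barHomotopy Y)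
      (relBarSign_actEven Y) awComul_barHomotopy h

theorem awComul_coassoc (b : RelBar R g) :
    TensorProduct.assoc R _ _ _ (LinearMap.rTensor _ (awComul R g) (awComul R g b)) =
      LinearMap.lTensor _ (awComul R g) (awComul R g b) := by
  refine relBar_hom ((TensorProduct.assoc R _ _ _).toLinearMap ∘ₗ
      LinearMap.rTensor _ (awComul R g) ∘ₗ awComul R g)
    (LinearMap.lTensor _ (awComul R g) ∘ₗ awComul R g) ?_
    (fun v b h => coassoc_diagOp (awComul_actOdd v) awComul_relBarSign h)
    (fun b h => coassoc_homotopy awComul_one awComul_barHomotopy awComul_relBarSign h) b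
  simp only [LinearMap.comp_apply, LinearEquiv.coe_coe]
  rw [awComul_one, LinearMap.rTensor_tmul, LinearMap.lTensor_tmul, awComul_one,
    TensorProduct.assoc_tmul]

theorem awComul_counit_left (b : RelBar R g) :
    TensorProduct.lid R _ (LinearMap.rTensor _ (relBarCounit R g) (awComul R g b)) = b := by
  refine relBar_hom ((TensorProduct.lid R _).toLinearMap ∘ₗ
      LinearMap.rTensor _ (relBarCounit R g) ∘ₗ awComul R g) LinearMap.id ?_
    (fun v b h => counit_left_diagOp (relBarCounit_actOdd v) (awComul_actOdd v) h)
    (fun b h => counit_left_homotopy relBarCounit_barHomotopy relBarCounit_relBarSign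
      awComul_barHomotopy h) b
  simp only [LinearMap.comp_apply, LinearEquiv.coe_coe]
  rw [awComul_one, LinearMap.rTensor_tmul, relBarCounit_one, TensorProduct.lid_tmul, one_smul,
    LinearMap.id_apply]

theorem awComul_counit_right (b : RelBar R g) :
    TensorProduct.rid R _ (LinearMap.lTensor _ (relBarCounit R g) (awComul R g b)) = b := by
  refine relBar_hom ((TensorProduct.rid R _).toLinearMap ∘ₗ
      LinearMap.lTensor _ (relBarCounit R g) ∘ₗ awComul R g) LinearMap.id ?_
    (fun v b h => counit_right_diagOp (relBarCounit_actOdd v) relBarCounit_relBarSign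
      (awComul_actOdd v) h)
    (fun b _ => counit_right_homotopy relBarCounit_barHomotopy relBarCounit_one
      awComul_barHomotopy b) b
  simp only [LinearMap.comp_apply, LinearEquiv.coe_coe]
  rw [awComul_one, LinearMap.lTensor_tmul, relBarCounit_one, TensorProduct.rid_tmul, one_smul,
    LinearMap.id_apply]

/-- The step along h relies on the right counit law, and the step along r_v on the equivariance of
the diagonal under g. -/
theorem awComul_relBarD (b : RelBar R g) :
    awComul R g (relBarD R g b) = codiffOp (relBarSign R g) (relBarD R g) (awComul R g b) := by
  refine relBar_hom (awComul R g ∘ₗ relBarD R g)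
    (codiffOp (relBarSign R g) (relBarD R g) ∘ₗ awComul R g) ?_
    (fun v b h => coderivation_diagOp (relBarD_actOdd v) (relBarSign_actOdd v) relBarD_relBarSign
      (awComul_actOdd v) awComul_relBarSign (awComul_actEven v) h)
    (fun b h => coderivation_homotopy relBarD_barHomotopy relBarSign_relBarSign relBarD_relBarSign
      awComul_one awComul_barHomotopy relBarD_one awComul_counit_right h) b
  simp only [LinearMap.comp_apply]
  rw [awComul_one, codiffOp_tmul, relBarD_one, map_zero, TensorProduct.zero_tmul,
    TensorProduct.tmul_zero, add_zero]

end RelBarDiagonal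

/-! ### The relative bar module as a graded object -/

section RelBarGrading

variable {R : Type*} [CommRing R] {g : Type*} [LieRing g] [LieAlgebra R g]

theorem relBarSign_of_mem {n : ℕ} {b : RelBar R g} (hb : b ∈ relBarGr R g n) :
    relBarSign R g b = (-1 : R) ^ n • b :=
  tensorSign_of_mem (w := id) barSign_of_mem hb

theorem one_mem_relBarGr : (1 ⊗ₜ 1 : RelBar R g) ∈ relBarGr R g 0 :=
  tmul_mem_tensorGr (w := id) one_mem_barTGr one_mem_extPower rfl

theorem relBarActOdd_mem (v : g) {n : ℕ} {b : RelBar R g} (hb : b ∈ relBarGr R g n) :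
    relBarActOdd R g v b ∈ relBarGr R g (n + 1) :=
  actOdd_mem_tensorGr v hb

theorem relBarActEven_mem (Y : g) {n : ℕ} {b : RelBar R g} (hb : b ∈ relBarGr R g n) :
    relBarActEven R g Y b ∈ relBarGr R g n :=
  actEven_mem_tensorGr Y (barTAct_mem Y) hb

theorem barHomotopy_mem {n : ℕ} {b : RelBar R g} (hb : b ∈ relBarGr R g n) :
    barHomotopy R g b ∈ relBarGr R g (n + 1) := by
  refine tensorGr_le (P := (relBarGr R g (n + 1)).comap (barHomotopy R g))
    (fun i j hij c hc a ha => ?_) hb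
  change barHomotopy R g (c ⊗ₜ a) ∈ relBarGr R g (n + 1)
  rw [barHomotopy_tmul, barSign_of_mem i c hc, smul_mul_assoc, ← TensorProduct.smul_tmul']
  refine Submodule.smul_mem _ _ (tmul_mem_tensorGr (w := id) (mul_letter_mem_barTGr hc ha)
    one_mem_extPower ?_)
  change i + j = n at hij
  simp only [id]
  omega

/-- Generation of `BΛ_∂[sg]` in the graded sense. -/
theorem relBarGr_generation (Q : ℕ → Submodule R (RelBar R g)) (h1 : (1 ⊗ₜ 1 : RelBar R g) ∈ Q 0)
    (hmul : ∀ v n, ∀ b ∈ Q n, relBarActOdd R g v b ∈ Q (n + 1))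
    (hh : ∀ n, ∀ b ∈ Q n, barHomotopy R g b ∈ Q (n + 1)) {n : ℕ} {b : RelBar R g}
    (hb : b ∈ relBarGr R g n) : b ∈ Q n := by
  refine tensorGr_generation (w := id) Q (fun i m hm => ?_) hmul hb
  refine (barTGr_generation (fun i => barTGr R g i ⊓ (Q i).comap (inclOne R g _))
    ⟨one_mem_barTGr, h1⟩ (fun n k m hm a ha => ⟨mul_letter_mem_barTGr hm.1 ha, ?_⟩) hm).2
  have h2 : m ⊗ₜ[R] a ∈ Q (n + k) :=
    extPower_le (fun j => (Q (n + j)).comap (TensorProduct.mk R (BarT R g) _ m)) hm.2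
      (fun v j a h => hmul v _ _ h) k a ha
  have h3 := hh _ _ h2
  rw [barHomotopy_tmul, barSign_of_mem n m hm.1, smul_mul_assoc, ← TensorProduct.smul_tmul'] at h3
  -- A second factor (-1)^n removes the sign in the definition of h.
  have h4 := (Q (n + k + 1)).smul_mem ((-1 : R) ^ n) h3
  rwa [smul_smul, ← mul_pow, neg_one_mul, neg_neg, one_pow, one_smul] at h4

/-- Using the zero module as target in degree 0 treats both degree conditions on D in one induction.
-/
theorem relBarD_mem_aux {n : ℕ} {b : RelBar R g} (hb : b ∈ relBarGr R g n) :
    relBarD R g b ∈ (if n = 0 then ⊥ else relBarGr R g (n - 1) : Submodule R (RelBar R g)) := by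
  refine (relBarGr_generation (fun n => relBarGr R g n ⊓
    (if n = 0 then ⊥ else relBarGr R g (n - 1)).comap (relBarD R g)) ⟨one_mem_relBarGr, ?_⟩
    (fun v n b h => ⟨relBarActOdd_mem v h.1, ?_⟩) (fun n b h => ⟨barHomotopy_mem h.1, ?_⟩) hb).2
  · change relBarD R g (1 ⊗ₜ 1) ∈ (⊥ : Submodule R (RelBar R g))
    rw [relBarD_one]
    exact Submodule.zero_mem _
  · change relBarD R g (relBarActOdd R g v b) ∈
      (if n + 1 = 0 then ⊥ else relBarGr R g n : Submodule R (RelBar R g))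
    have h2 : relBarD R g b ∈
      (if n = 0 then ⊥ else relBarGr R g (n - 1) : Submodule R (RelBar R g)) := h.2
    rw [relBarD_actOdd, relBarSign_of_mem h.1, map_smul, if_neg (Nat.succ_ne_zero n)]
    refine Submodule.add_mem _ ?_ (Submodule.smul_mem _ _ (relBarActEven_mem v h.1))
    cases n with
    | zero =>
      rw [if_pos rfl, Submodule.mem_bot] at h2
      rw [h2, map_zero]
      exact Submodule.zero_mem _
    | succ n => exact relBarActOdd_mem v h2
  · change relBarD R g (barHomotopy R g b) ∈
      (if n + 1 = 0 then ⊥ else relBarGr R g n : Submodule R (RelBar R g))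
    have h2 : relBarD R g b ∈
      (if n = 0 then ⊥ else relBarGr R g (n - 1) : Submodule R (RelBar R g)) := h.2
    rw [relBarD_barHomotopy, if_neg (Nat.succ_ne_zero n)]
    refine Submodule.sub_mem _ (Submodule.add_mem _ (Submodule.neg_mem _ h.1) ?_) ?_
    · by_cases hn : n = 0
      · subst hn
        exact Submodule.smul_mem _ _ one_mem_relBarGr
      · have h0 : relBarCounit R g b = 0 :=
          tensorCounit_of_mem (w := id) barTCounit_of_mem rfl hn h.1
        rw [h0, zero_smul]
        exact Submodule.zero_mem _
    · cases n with
      | zero =>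
        rw [if_pos rfl, Submodule.mem_bot] at h2
        rw [h2, map_zero]
        exact Submodule.zero_mem _
      | succ n => exact barHomotopy_mem h2

theorem awComul_mem {n : ℕ} {b : RelBar R g} (hb : b ∈ relBarGr R g n) :
    awComul R g b ∈ grTensor (relBarGr R g) (relBarGr R g) n := by
  refine (relBarGr_generation (fun n => relBarGr R g n ⊓
    (grTensor (relBarGr R g) (relBarGr R g) n).comap (awComul R g)) ⟨one_mem_relBarGr, ?_⟩
    (fun v n b h => ⟨relBarActOdd_mem v h.1, ?_⟩) (fun n b h => ⟨barHomotopy_mem h.1, ?_⟩) hb).2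
  · change awComul R g (1 ⊗ₜ 1) ∈ grTensor (relBarGr R g) (relBarGr R g) 0
    rw [awComul_one]
    exact tmul_mem_grTensor one_mem_relBarGr one_mem_relBarGr rfl
  · change awComul R g (relBarActOdd R g v b) ∈ grTensor (relBarGr R g) (relBarGr R g) (n + 1)
    rw [awComul_actOdd]
    refine map_mem_of_mem_grTensor h.2 _ _ (fun p q hpq a ha b hb => ?_)
    rw [diagOp_tmul, relBarSign_of_mem hb]
    exact Submodule.add_mem _ (tmul_mem_grTensor (relBarActOdd_mem v ha)
      (Submodule.smul_mem _ _ hb) (by omega))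
      (tmul_mem_grTensor ha (relBarActOdd_mem v hb) (by omega))
  · change awComul R g (barHomotopy R g b) ∈ grTensor (relBarGr R g) (relBarGr R g) (n + 1)
    rw [awComul_barHomotopy]
    refine Submodule.add_mem _ (tmul_mem_grTensor (barHomotopy_mem h.1) one_mem_relBarGr rfl) ?_
    refine map_mem_of_mem_grTensor h.2 _ _ (fun p q hpq a ha b hb => ?_)
    rw [TensorProduct.map_tmul, relBarSign_of_mem ha]
    exact tmul_mem_grTensor (Submodule.smul_mem _ _ ha) (barHomotopy_mem hb) (by omega)

theorem relBarGr_isInternal : DirectSum.IsInternal (relBarGr R g) :=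
  tensorGr_isInternal (fun _ => le_rfl) (barProj R g) barProj_of_mem iSup_barTGr

variable (R g)

theorem relBar_isGradedCoalgebra :
    IsGradedCoalgebra (C := RelBar R g) (relBarGr R g) (relBarComul R g) (relBarCounit R g) where
  internal := relBarGr_isInternal
  comul_mem _ _ hb := tensorComul_mem (w := id) barSign_of_mem barDeconc_mem (fun _ _ => rfl) hb
  counit_eq_zero _ hn _ hb := tensorCounit_of_mem (w := id) barTCounit_of_mem rfl hn hb
  coassoc := tensorComul_coassoc barDeconc_barSign barDeconc_coassoc
  counit_left := tensorComul_counit_left barDeconc_counit_left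
  counit_right := tensorComul_counit_right barTCounit_barSign barDeconc_counit_right

theorem relBar_isDGCoalgebra :
    IsDGCoalgebra (C := RelBar R g) (relBarGr R g) (awComul R g) (relBarCounit R g)
      (relBarD R g) where
  internal := relBarGr_isInternal
  comul_mem _ _ hb := awComul_mem hb
  counit_eq_zero _ hn _ hb := tensorCounit_of_mem (w := id) barTCounit_of_mem rfl hn hb
  coassoc := awComul_coassoc
  counit_left := awComul_counit_left
  counit_right := awComul_counit_right
  d_mem _ _ hb := relBarD_mem_aux hb
  d_zero _ hb := (Submodule.mem_bot R).mp (relBarD_mem_aux hb)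
  d_d := relBarD_relBarD
  counit_d := relBarCounit_relBarD
  coderivation := ⟨relBarSign R g, fun _ _ hb => relBarSign_of_mem hb, awComul_relBarD⟩

theorem relBar_isDGConeModule :
    IsDGConeModule (C := RelBar R g) (relBarGr R g) (relBarD R g) (relBarActEven R g)
      (relBarActOdd R g) where
  even_mem Y _ _ hb := relBarActEven_mem Y hb
  odd_mem Y _ _ hb := relBarActOdd_mem Y hb
  even_even := actEven_comm barTAct_comm
  odd_even Y Z b := by
    rw [sub_eq_iff_eq_add']
    exact actEven_actOdd (barTAct R g) Y Z b
  odd_odd := actOdd_anticomm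
  d_even := relBarD_actEven
  d_odd Y n b hb := by rw [relBarD_actOdd, relBarSign_of_mem hb, map_smul]

end RelBarGrading

/-! ### Differentials from a coalgebra C with a linear map to g -/

section CotwistedDifferential

variable {R : Type*} [CommRing R] {g : Type*} [LieRing g] [LieAlgebra R g]
variable {C : Type*} [AddCommGroup C] [Module R C]

open ExteriorAlgebra (ι ιInv)

/-- The differential on `C ⊗ Λ` for a coalgebra `C` with a linear map `π : C → g`:
`c ⊗ a ↦ -∑ c' ⊗ sπ(c'') a + c ⊗ ∂ a + ∑ (c · τ_g(a')) ⊗ a''`. -/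
def cotwistedD (Δ : C →ₗ[R] C ⊗[R] C) (π : C →ₗ[R] g) (act : g →ₗ[R] C →ₗ[R] C) :
    C ⊗[R] ExteriorAlgebra R g →ₗ[R] C ⊗[R] ExteriorAlgebra R g :=
  twistedD R g LinearMap.id 0 (LinearMap.lTensor C (ι R ∘ₗ π) ∘ₗ Δ) act

variable {Δ : C →ₗ[R] C ⊗[R] C} {ε : C →ₗ[R] R} {π : C →ₗ[R] g} {act : g →ₗ[R] C →ₗ[R] C}

theorem cotwistedD_tmul_one (c : C) :
    cotwistedD Δ π act (c ⊗ₜ 1) = -LinearMap.lTensor C (ι R ∘ₗ π) (Δ c) := by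
  rw [cotwistedD, twistedD_tmul_one]
  simp

theorem cotwistedD_tmul_one_eq_smul (c : C) :
    cotwistedD Δ π act (c ⊗ₜ 1) = (-1 : R) • LinearMap.lTensor C (ι R ∘ₗ π) (Δ c) := by
  rw [cotwistedD_tmul_one, neg_one_smul]

theorem cotwistedD_actOdd (v : g) (b : C ⊗[R] ExteriorAlgebra R g) :
    cotwistedD Δ π act (actOdd R g C v b) = actOdd R g C v (cotwistedD Δ π act b) +
      actEven R g act v (tensorSign R g LinearMap.id b) :=
  twistedD_actOdd _ _ _ _ v b

theorem tensorSign_id_actEven (Y : g) (b : C ⊗[R] ExteriorAlgebra R g) :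
    tensorSign R g LinearMap.id (actEven R g act Y b) =
      actEven R g act Y (tensorSign R g LinearMap.id b) :=
  tensorSign_actEven (σ := LinearMap.id) (fun _ => rfl) b

theorem cotwistedD_tensorSign (b : C ⊗[R] ExteriorAlgebra R g) :
    cotwistedD Δ π act (tensorSign R g LinearMap.id b) =
      -tensorSign R g LinearMap.id (cotwistedD Δ π act b) := by
  refine tensor_hom (cotwistedD Δ π act ∘ₗ tensorSign R g LinearMap.id)
    (-(tensorSign R g LinearMap.id ∘ₗ cotwistedD Δ π act)) (fun c => ?_)
    (fun v b h => diff_sign_step (D := cotwistedD Δ π act) (s := tensorSign R g LinearMap.id)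
      (r := actOdd R g C v) (Y := actEven R g act v) (cotwistedD_actOdd v)
      (tensorSign_actOdd LinearMap.id v) (tensorSign_id_actEven v) h) b
  simp only [LinearMap.comp_apply, LinearMap.neg_apply, tensorSign_tmul, extSign_one,
    LinearMap.id_apply, cotwistedD_tmul_one, map_neg, neg_neg]
  generalize Δ c = z
  refine eq_of_tmul (-LinearMap.lTensor C (ι R ∘ₗ π))
    (tensorSign R g LinearMap.id ∘ₗ LinearMap.lTensor C (ι R ∘ₗ π)) (fun x y => ?_) z
  simp [TensorProduct.tmul_neg]

theorem cotwistedD_actEven (hact : ∀ Y Z c, act Z (act Y c) - act Y (act Z c) = act ⁅Y, Z⁆ c)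
    (hΔ : ∀ Y c, Δ (act Y c) = diagOp (act Y) LinearMap.id (Δ c))
    (hπ : ∀ Y c, π (act Y c) = ⁅π c, Y⁆) (Z : g) (b : C ⊗[R] ExteriorAlgebra R g) :
    cotwistedD Δ π act (actEven R g act Z b) = actEven R g act Z (cotwistedD Δ π act b) := by
  refine tensor_hom (cotwistedD Δ π act ∘ₗ actEven R g act Z)
    (actEven R g act Z ∘ₗ cotwistedD Δ π act) (fun c => ?_)
    (fun v b h => diff_act_step (D := cotwistedD Δ π act) (s := tensorSign R g LinearMap.id)
      (r := actOdd R g C v) (Y := actEven R g act v) (Z := actEven R g act Z)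
      (r' := actOdd R g C ⁅v, Z⁆) (Y' := actEven R g act ⁅v, Z⁆) (cotwistedD_actOdd v) (cotwistedD_actOdd ⁅v, Z⁆)
      (actEven_actOdd act v Z) (tensorSign_id_actEven Z) (actEven_comm hact v Z) h) b
  simp only [LinearMap.comp_apply, actEven_tmul, extAct_one, TensorProduct.tmul_zero, add_zero,
    cotwistedD_tmul_one, map_neg, hΔ]
  congr 1
  generalize Δ c = z
  refine eq_of_tmul (LinearMap.lTensor C (ι R ∘ₗ π) ∘ₗ diagOp (act Z) LinearMap.id)
    (actEven R g act Z ∘ₗ LinearMap.lTensor C (ι R ∘ₗ π)) (fun x y => ?_) z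
  simp [hπ, extAct_ι]

theorem tensorCounit_cotwistedD (hε : ∀ Y c, ε (act Y c) = 0)
    (b : C ⊗[R] ExteriorAlgebra R g) : tensorCounit R g ε (cotwistedD Δ π act b) = 0 := by
  refine tensor_hom (tensorCounit R g ε ∘ₗ cotwistedD Δ π act) 0 (fun c => ?_)
    (fun v b _ => ?_) b
  · simp only [LinearMap.comp_apply, cotwistedD_tmul_one, map_neg, LinearMap.zero_apply,
      neg_eq_zero]
    refine eq_of_tmul (tensorCounit R g ε ∘ₗ LinearMap.lTensor C (ι R ∘ₗ π)) 0 (fun x y => ?_) _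
    simp
  · simp only [LinearMap.comp_apply, cotwistedD_actOdd, map_add, tensorCounit_actOdd,
      tensorCounit_actEven (hε v), LinearMap.zero_apply, add_zero]

/-- On C ⊗ 1 the square of D has two parts, ∑ c' ⊗ sπ(c'') sπ(c''') and ∑ c' · π(c'') ⊗ 1, up to
sign. They vanish separately, by `halt` and `hself`. -/
theorem cotwistedD_cotwistedD
    (hco : ∀ c, TensorProduct.assoc R C C C (LinearMap.rTensor C Δ (Δ c)) =
      LinearMap.lTensor C Δ (Δ c))
    (hact : ∀ Y Z c, act Z (act Y c) - act Y (act Z c) = act ⁅Y, Z⁆ c)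
    (hΔ : ∀ Y c, Δ (act Y c) = diagOp (act Y) LinearMap.id (Δ c))
    (hπ : ∀ Y c, π (act Y c) = ⁅π c, Y⁆)
    (halt : ∀ c, TensorProduct.lift (((LinearMap.mul R (ExteriorAlgebra R g)).compl₁₂
      (ι R ∘ₗ π) (ι R ∘ₗ π))) (Δ c) = 0)
    (hself : ∀ c, TensorProduct.lift (act.flip.compl₂ π) (Δ c) = 0)
    (b : C ⊗[R] ExteriorAlgebra R g) : cotwistedD Δ π act (cotwistedD Δ π act b) = 0 := by
  refine tensor_hom (cotwistedD Δ π act ∘ₗ cotwistedD Δ π act) 0 (fun c => ?_)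
    (fun v b h => sq_diff_step (cotwistedD_actOdd v) cotwistedD_tensorSign
      (cotwistedD_actEven hact hΔ hπ v) h) b
  simp only [LinearMap.comp_apply, cotwistedD_tmul_one, map_neg, LinearMap.zero_apply,
    neg_eq_zero]
  set m := TensorProduct.lift ((LinearMap.mul R (ExteriorAlgebra R g)).compl₁₂
      (ι R ∘ₗ π) (ι R ∘ₗ π)) with hm
  have h1 : ∀ z : C ⊗[R] C, cotwistedD Δ π act (LinearMap.lTensor C (ι R ∘ₗ π) z) =
      -LinearMap.lTensor C m (TensorProduct.assoc R C C C (LinearMap.rTensor C Δ z)) +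
        TensorProduct.lift (act.flip.compl₂ π) z ⊗ₜ 1 := by
    refine eq_of_tmul (cotwistedD Δ π act ∘ₗ LinearMap.lTensor C (ι R ∘ₗ π))
      (-(LinearMap.lTensor C m ∘ₗ (TensorProduct.assoc R C C C).toLinearMap ∘ₗ
        LinearMap.rTensor C Δ) + inclOne R g C ∘ₗ TensorProduct.lift (act.flip.compl₂ π))
      (fun x y => ?_)
    -- An element x ⊗ sv is (x ⊗ 1) · sv, so the rule for right multiplication evaluates D on it.
    have h2 : x ⊗ₜ[R] ι R (π y) = actOdd R g C (π y) (x ⊗ₜ 1) := by simp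
    simp only [LinearMap.comp_apply, LinearMap.lTensor_tmul, h2, cotwistedD_actOdd,
      cotwistedD_tmul_one, tensorSign_tmul, extSign_one, actEven_tmul, extAct_one,
      TensorProduct.tmul_zero, add_zero, LinearMap.add_apply, LinearMap.neg_apply,
      LinearMap.rTensor_tmul, LinearEquiv.coe_coe, inclOne_apply, TensorProduct.lift.tmul,
      LinearMap.compl₂_apply, LinearMap.flip_apply, LinearMap.id_apply, map_neg]
    congr 2
    generalize Δ x = w
    refine eq_of_tmul (actOdd R g C (π y) ∘ₗ LinearMap.lTensor C (ι R ∘ₗ π))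
      (LinearMap.lTensor C m ∘ₗ (TensorProduct.assoc R C C C).toLinearMap ∘ₗ
        (TensorProduct.mk R _ _).flip y) (fun u v => ?_) w
    simp [hm]
  have h3 : LinearMap.lTensor C m (LinearMap.lTensor C Δ (Δ c)) = 0 := by
    rw [← LinearMap.comp_apply, ← LinearMap.lTensor_comp,
      show m ∘ₗ Δ = 0 from LinearMap.ext halt, LinearMap.lTensor_zero, LinearMap.zero_apply]
  rw [h1, hco, h3, hself, TensorProduct.zero_tmul, neg_zero, add_zero]

/-- On C ⊗ 1 both sides are sums over c' ⊗ c'' ⊗ c''' with one factor sent to sg, attached either to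
the first or to the second copy. Attaching it to the first copy takes the factors in another order,
which cocommutativity allows. -/
theorem tensorComul_cotwistedD
    (hco : ∀ c, TensorProduct.assoc R C C C (LinearMap.rTensor C Δ (Δ c)) =
      LinearMap.lTensor C Δ (Δ c))
    (hcomm : ∀ c, TensorProduct.comm R C C (Δ c) = Δ c)
    (hΔ : ∀ Y c, Δ (act Y c) = diagOp (act Y) LinearMap.id (Δ c))
    (b : C ⊗[R] ExteriorAlgebra R g) :
    tensorComul R g LinearMap.id Δ (cotwistedD Δ π act b) =
      codiffOp (tensorSign R g LinearMap.id) (cotwistedD Δ π act)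
        (tensorComul R g LinearMap.id Δ b) := by
  have hid : ∀ c, Δ ((LinearMap.id : C →ₗ[R] C) c) =
      TensorProduct.map (LinearMap.id : C →ₗ[R] C) (LinearMap.id : C →ₗ[R] C) (Δ c) := by
    intro c
    rw [TensorProduct.map_id]
    rfl
  refine tensor_hom (tensorComul R g LinearMap.id Δ ∘ₗ cotwistedD Δ π act)
    (codiffOp (tensorSign R g LinearMap.id) (cotwistedD Δ π act) ∘ₗ
      tensorComul R g LinearMap.id Δ) (fun c => ?_)
    (fun v b h => coderivation_diagOp (cotwistedD_actOdd v) (tensorSign_actOdd _ v)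
      cotwistedD_tensorSign (tensorComul_actOdd _ Δ v) (tensorComul_tensorSign hid)
      (tensorComul_actEven (fun _ _ => rfl) hΔ v) h) b
  simp only [LinearMap.comp_apply, cotwistedD_tmul_one, map_neg, tensorComul_tmul_one]
  set j := inclOne R g C with hj
  set T := LinearMap.lTensor C (ι R ∘ₗ π) with hT
  set U := TensorProduct.map T j ∘ₗ (TensorProduct.assoc R C C C).symm.toLinearMap with hU
  have h1 : ∀ z : C ⊗[R] C, tensorComul R g LinearMap.id Δ (T z) =
      U (LinearMap.lTensor C (TensorProduct.comm R C C).toLinearMap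
        (TensorProduct.assoc R C C C (LinearMap.rTensor C Δ z))) +
      TensorProduct.map j T (TensorProduct.assoc R C C C (LinearMap.rTensor C Δ z)) := by
    refine eq_of_tmul (tensorComul R g LinearMap.id Δ ∘ₗ T)
      (U ∘ₗ LinearMap.lTensor C (TensorProduct.comm R C C).toLinearMap ∘ₗ
        (TensorProduct.assoc R C C C).toLinearMap ∘ₗ LinearMap.rTensor C Δ +
      TensorProduct.map j T ∘ₗ (TensorProduct.assoc R C C C).toLinearMap ∘ₗ
        LinearMap.rTensor C Δ) (fun x y => ?_)
    have h2 : x ⊗ₜ[R] ι R (π y) = actOdd R g C (π y) (x ⊗ₜ 1) := by simp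
    simp only [LinearMap.comp_apply, hT, LinearMap.lTensor_tmul, h2, tensorComul_actOdd,
      tensorComul_tmul_one, LinearMap.add_apply, LinearMap.rTensor_tmul, LinearEquiv.coe_coe]
    generalize Δ x = w
    refine eq_of_tmul (diagOp (actOdd R g C (π y)) (tensorSign R g LinearMap.id) ∘ₗ
        TensorProduct.map j j)
      (U ∘ₗ LinearMap.lTensor C (TensorProduct.comm R C C).toLinearMap ∘ₗ
        (TensorProduct.assoc R C C C).toLinearMap ∘ₗ (TensorProduct.mk R _ _).flip y +
      TensorProduct.map j T ∘ₗ (TensorProduct.assoc R C C C).toLinearMap ∘ₗ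
        (TensorProduct.mk R _ _).flip y) (fun u v => ?_) w
    simp [hj, hU, hT]
  have h2 : ∀ z : C ⊗[R] C, codiffOp (tensorSign R g LinearMap.id) (cotwistedD Δ π act)
        (TensorProduct.map j j z) =
      -(U (TensorProduct.assoc R C C C (LinearMap.rTensor C Δ z)) +
        TensorProduct.map j T (LinearMap.lTensor C Δ z)) := by
    refine eq_of_tmul (codiffOp (tensorSign R g LinearMap.id) (cotwistedD Δ π act) ∘ₗ
        TensorProduct.map j j)
      (-(U ∘ₗ (TensorProduct.assoc R C C C).toLinearMap ∘ₗ LinearMap.rTensor C Δ +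
        TensorProduct.map j T ∘ₗ LinearMap.lTensor C Δ)) (fun x y => ?_)
    simp [hj, hU, cotwistedD_tmul_one, TensorProduct.neg_tmul, TensorProduct.tmul_neg, hT,
      add_comm]
  -- Cocommutativity of the inner diagonal absorbs the interchange of the last two factors.
  have h3 : LinearMap.lTensor C (TensorProduct.comm R C C).toLinearMap
      (LinearMap.lTensor C Δ (Δ c)) = LinearMap.lTensor C Δ (Δ c) := by
    rw [← LinearMap.comp_apply, ← LinearMap.lTensor_comp,
      show (TensorProduct.comm R C C).toLinearMap ∘ₗ Δ = Δ from LinearMap.ext hcomm]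
  rw [h1, h2, hco, h3]

end CotwistedDifferential

/-! ### The cup square after multiplication by a primitive element -/

section ConeBracket

variable {R : Type*} [CommRing R] {g : Type*} [LieRing g] [LieAlgebra R g]
variable {E : Type*} [AddCommGroup E] [Module R E] {ε : E →ₗ[R] R} {t : E →ₗ[R] g × g}
  {r s : E →ₗ[R] E} {v : g}

/-- The cup square of a twisting cochain `t` after right multiplication with a primitive element
`v` with `t (b v) = ε(b) v`. -/
theorem coneBracket_diagOp (htr : ∀ b, t (r b) = (0, ε b • v))
    (hts : ∀ b, t (s b) = ((t b).1, -(t b).2)) (hsr : ∀ b, s (r b) = -r (s b))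
    (hεs : ∀ b, ε (s b) = ε b) (z : E ⊗[R] E) :
    TensorProduct.lift (coneBracket R g) (TensorProduct.map (t ∘ₗ s) t (diagOp r s z)) =
      (⁅(t (TensorProduct.lid R E (LinearMap.rTensor E ε z))).1, v⁆,
        -⁅(t (TensorProduct.lid R E (LinearMap.rTensor E ε z))).2, v⁆) +
      (⁅(t (TensorProduct.rid R E (LinearMap.lTensor E ε z))).1, v⁆,
        -⁅(t (TensorProduct.rid R E (LinearMap.lTensor E ε z))).2, v⁆) := by
  set A : g × g →ₗ[R] g × g := LinearMap.prodMap ((lieBilin R g).flip v) (-(lieBilin R g).flip v)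
    with hA
  have hA' : ∀ p : g × g, A p = (⁅p.1, v⁆, -⁅p.2, v⁆) := fun p => rfl
  simp only [← hA']
  refine eq_of_tmul (TensorProduct.lift (coneBracket R g) ∘ₗ TensorProduct.map (t ∘ₗ s) t ∘ₗ
      diagOp r s)
    (A ∘ₗ t ∘ₗ (TensorProduct.lid R E).toLinearMap ∘ₗ LinearMap.rTensor E ε +
      A ∘ₗ t ∘ₗ (TensorProduct.rid R E).toLinearMap ∘ₗ LinearMap.lTensor E ε) (fun x y => ?_) z
  simp only [LinearMap.comp_apply, LinearMap.add_apply, diagOp_tmul, map_add,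
    TensorProduct.map_tmul, TensorProduct.lift.tmul, hsr, map_neg, htr, hts, hεs,
    LinearMap.rTensor_tmul, LinearMap.lTensor_tmul, LinearEquiv.coe_coe, TensorProduct.lid_tmul,
    TensorProduct.rid_tmul, map_smul, hA', coneBracket, LinearMap.mk₂_apply]
  have hv : ∀ x : g, ⁅v, x⁆ = -⁅x, v⁆ := fun x => (lie_skew v x).symm
  congr 1 <;> ext <;> simp [hv, -lie_skew]

end ConeBracket

/-! ### The Weil coalgebra -/

section WeilCoalgebra

variable {R : Type*} [CommRing R] {g : Type*} [LieRing g] [LieAlgebra R g]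

open ExteriorAlgebra (ι ιInv)

theorem weilD_eq : weilD R g = cotwistedD (symComul R g) (symLin R g) (symAct R g) := rfl

theorem symTwist_alternating (c : DividedPowerAlgebra R g) :
    TensorProduct.lift ((LinearMap.mul R (ExteriorAlgebra R g)).compl₁₂
      (ι R ∘ₗ symLin R g) (ι R ∘ₗ symLin R g)) (symComul R g c) = 0 :=
  sym_alternating ((LinearMap.mul R (ExteriorAlgebra R g)).compl₁₂ (ι R) (ι R))
    (fun x => by simp) c

/-- The identity `∑ c' · π(c'') = 0` for the adjoint action. -/
theorem symAct_symLin (c : DividedPowerAlgebra R g) :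
    TensorProduct.lift ((symAct R g).flip.compl₂ (symLin R g)) (symComul R g c) = 0 := by
  set B : g →ₗ[R] g →ₗ[R] (DividedPowerAlgebra R g) := (lieBilin R g).compr₂ (DividedPowerAlgebra.embed R g) with hB
  set β := TensorProduct.lift (B.compl₁₂ (symLin R g) (symLin R g)) with hβ
  set H := LinearMap.mul' R (DividedPowerAlgebra R g) ∘ₗ LinearMap.rTensor (DividedPowerAlgebra R g) β ∘ₗ
    (TensorProduct.assoc R (DividedPowerAlgebra R g) (DividedPowerAlgebra R g) (DividedPowerAlgebra R g)).symm.toLinearMap with hH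
  -- Written as a convolution, the sum is ∑ s²[π(c'), π(c''')] c''. Interchanging the last two
  -- factors makes the bracket one of neighbours, where `sym_alternating` applies.
  have h1 : ∀ z : (DividedPowerAlgebra R g) ⊗[R] (DividedPowerAlgebra R g), TensorProduct.lift ((symAct R g).flip.compl₂ (symLin R g)) z =
      H (LinearMap.lTensor (DividedPowerAlgebra R g) (TensorProduct.comm R (DividedPowerAlgebra R g) (DividedPowerAlgebra R g)).toLinearMap
        (TensorProduct.assoc R (DividedPowerAlgebra R g) (DividedPowerAlgebra R g) (DividedPowerAlgebra R g) (LinearMap.rTensor (DividedPowerAlgebra R g) (symComul R g) z))) := by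
    refine eq_of_tmul _ (H ∘ₗ LinearMap.lTensor (DividedPowerAlgebra R g) (TensorProduct.comm R (DividedPowerAlgebra R g) (DividedPowerAlgebra R g)).toLinearMap ∘ₗ
        (TensorProduct.assoc R (DividedPowerAlgebra R g) (DividedPowerAlgebra R g) (DividedPowerAlgebra R g)).toLinearMap ∘ₗ LinearMap.rTensor (DividedPowerAlgebra R g) (symComul R g))
      (fun x y => ?_)
    simp only [TensorProduct.lift.tmul, LinearMap.compl₂_apply, LinearMap.flip_apply,
      LinearMap.comp_apply, LinearMap.rTensor_tmul, LinearEquiv.coe_coe]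
    change LinearMap.mul' R (DividedPowerAlgebra R g) (LinearMap.rTensor (DividedPowerAlgebra R g) (DividedPowerAlgebra.embed R g ∘ₗ
      (lieBilin R g).flip (symLin R g y) ∘ₗ symLin R g) (symComul R g x)) = _
    generalize symComul R g x = w
    refine eq_of_tmul (LinearMap.mul' R (DividedPowerAlgebra R g) ∘ₗ LinearMap.rTensor (DividedPowerAlgebra R g) (DividedPowerAlgebra.embed R g ∘ₗ
        (lieBilin R g).flip (symLin R g y) ∘ₗ symLin R g))
      (H ∘ₗ LinearMap.lTensor (DividedPowerAlgebra R g) (TensorProduct.comm R (DividedPowerAlgebra R g) (DividedPowerAlgebra R g)).toLinearMap ∘ₗ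
        (TensorProduct.assoc R (DividedPowerAlgebra R g) (DividedPowerAlgebra R g) (DividedPowerAlgebra R g)).toLinearMap ∘ₗ (TensorProduct.mk R _ _).flip y)
      (fun u v => ?_) w
    simp [hH, hβ, hB]
  have h3 : LinearMap.lTensor (DividedPowerAlgebra R g) (TensorProduct.comm R (DividedPowerAlgebra R g) (DividedPowerAlgebra R g)).toLinearMap
      (LinearMap.lTensor (DividedPowerAlgebra R g) (symComul R g) (symComul R g c)) =
        LinearMap.lTensor (DividedPowerAlgebra R g) (symComul R g) (symComul R g c) := by
    rw [← LinearMap.comp_apply, ← LinearMap.lTensor_comp,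
      show (TensorProduct.comm R (DividedPowerAlgebra R g) (DividedPowerAlgebra R g)).toLinearMap ∘ₗ symComul R g = symComul R g from
        LinearMap.ext symComul_comm]
  have h4 : LinearMap.rTensor (DividedPowerAlgebra R g) β (LinearMap.rTensor (DividedPowerAlgebra R g) (symComul R g) (symComul R g c)) = 0 := by
    rw [← LinearMap.comp_apply, ← LinearMap.rTensor_comp, show β ∘ₗ symComul R g = 0 from
      LinearMap.ext (sym_alternating B (fun x => by simp [hB, lieBilin])),
      LinearMap.rTensor_zero, LinearMap.zero_apply]
  rw [h1, symComul_coassoc, h3, ← symComul_coassoc, hH, LinearMap.comp_apply,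
    LinearMap.comp_apply, LinearEquiv.coe_coe, LinearEquiv.symm_apply_apply, h4, map_zero]

theorem weilComul_id_sign (c : DividedPowerAlgebra R g) :
    symComul R g ((LinearMap.id : DividedPowerAlgebra R g →ₗ[R] _) c) =
      TensorProduct.map (LinearMap.id : DividedPowerAlgebra R g →ₗ[R] _)
        (LinearMap.id : DividedPowerAlgebra R g →ₗ[R] _) (symComul R g c) := by
  rw [TensorProduct.map_id]
  rfl

theorem id_sign_of_mem (i : ℕ) (c : DividedPowerAlgebra R g) (_ : c ∈ symGr R g i) :
    (LinearMap.id : DividedPowerAlgebra R g →ₗ[R] _) c = (-1 : R) ^ (2 * i) • c := by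
  rw [pow_mul, neg_one_sq, one_pow, one_smul, LinearMap.id_apply]

theorem weilD_mem_aux {n : ℕ} {b : Weil R g} (hb : b ∈ weilGr R g n) :
    weilD R g b ∈ (if n = 0 then ⊥ else weilGr R g (n - 1) : Submodule R (Weil R g)) := by
  refine (tensorGr_generation (fun n => weilGr R g n ⊓
    (if n = 0 then ⊥ else weilGr R g (n - 1) : Submodule R (Weil R g)).comap (weilD R g))
    (fun i c hc => ⟨tmul_mem_tensorGr hc one_mem_extPower rfl, ?_⟩)
    (fun v n b h => ⟨actOdd_mem_tensorGr v h.1, ?_⟩) hb).2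
  · change weilD R g (c ⊗ₜ 1) ∈
      (if 2 * i = 0 then ⊥ else weilGr R g (2 * i - 1) : Submodule R (Weil R g))
    rw [weilD_eq, cotwistedD_tmul_one_eq_smul]
    refine Submodule.smul_mem _ _ (map_mem_of_mem_grTensor (symComul_mem i c hc)
      (LinearMap.lTensor (DividedPowerAlgebra R g) (ι R ∘ₗ symLin R g)) _
      (fun p q hpq x hx y hy => ?_))
    rw [LinearMap.lTensor_tmul, LinearMap.comp_apply]
    -- Only c'' of weight one contributes: degree 2 is traded for degree 1, and the total weight is
    -- then positive.
    by_cases hq : q = 1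
    · rw [if_neg (by omega)]
      exact tmul_mem_tensorGr hx (ι_mem_extPower _) (by omega)
    · rw [symLin_of_mem q hq y hy, map_zero, TensorProduct.tmul_zero]
      exact Submodule.zero_mem _
  · change weilD R g (actOdd R g _ v b) ∈
      (if n + 1 = 0 then ⊥ else weilGr R g n : Submodule R (Weil R g))
    have h2 : weilD R g b ∈
      (if n = 0 then ⊥ else weilGr R g (n - 1) : Submodule R (Weil R g)) := h.2
    rw [weilD_eq, cotwistedD_actOdd, ← weilD_eq, tensorSign_of_mem id_sign_of_mem h.1, map_smul,
      if_neg (Nat.succ_ne_zero n)]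
    refine Submodule.add_mem _ ?_
      (Submodule.smul_mem _ _ (actEven_mem_tensorGr v (symAct_mem v) h.1))
    cases n with
    | zero =>
      rw [if_pos rfl, Submodule.mem_bot] at h2
      rw [h2, map_zero]
      exact Submodule.zero_mem _
    | succ n => exact actOdd_mem_tensorGr v h2

variable (R g)

theorem weil_isDGCoalgebra :
    IsDGCoalgebra (C := Weil R g) (weilGr R g) (weilComul R g) (weilCounit R g) (weilD R g) where
  internal := tensorGr_isInternal (fun i => by omega) (symProj R g) symProj_of_mem iSup_symGr
  comul_mem _ _ hb := tensorComul_mem id_sign_of_mem symComul_mem (fun i j => by omega) hb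
  counit_eq_zero _ hn _ hb := tensorCounit_of_mem symCounit_of_mem rfl hn hb
  coassoc := tensorComul_coassoc weilComul_id_sign symComul_coassoc
  counit_left := tensorComul_counit_left symComul_counit_left
  counit_right := tensorComul_counit_right (fun _ => rfl) symComul_counit_right
  d_mem _ _ hb := weilD_mem_aux hb
  d_zero _ hb := (Submodule.mem_bot R).mp (weilD_mem_aux hb)
  d_d := cotwistedD_cotwistedD symComul_coassoc symAct_comm symComul_symAct symLin_symAct
    symTwist_alternating symAct_symLin
  counit_d := tensorCounit_cotwistedD symCounit_symAct
  coderivation := ⟨tensorSign R g LinearMap.id, fun _ _ hb => tensorSign_of_mem id_sign_of_mem hb,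
    tensorComul_cotwistedD symComul_coassoc symComul_comm symComul_symAct⟩

theorem weil_isDGConeModule :
    IsDGConeModule (C := Weil R g) (weilGr R g) (weilD R g) (weilActEven R g)
      (weilActOdd R g) where
  even_mem Y _ _ hb := actEven_mem_tensorGr Y (symAct_mem Y) hb
  odd_mem Y _ _ hb := actOdd_mem_tensorGr Y hb
  even_even := actEven_comm symAct_comm
  odd_even Y Z b := by
    rw [sub_eq_iff_eq_add']
    exact actEven_actOdd (symAct R g) Y Z b
  odd_odd := actOdd_anticomm
  d_even := cotwistedD_actEven symAct_comm symComul_symAct symLin_symAct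
  d_odd Y n b hb := by
    rw [weilD_eq, weilActOdd, cotwistedD_actOdd, tensorSign_of_mem id_sign_of_mem hb, map_smul]
    rfl

variable {R g}

theorem coneTwist_tmul (c : DividedPowerAlgebra R g) (a : ExteriorAlgebra R g) :
    coneTwist R g (c ⊗ₜ a) = (extCounit R g a • symLin R g c, symCounit R g c • ιInv a) := rfl

theorem coneTwist_actOdd (v : g) (b : Weil R g) :
    coneTwist R g (actOdd R g _ v b) = (0, weilCounit R g b • v) := by
  refine eq_of_tmul (coneTwist R g ∘ₗ actOdd R g _ v)
    (LinearMap.inr R g g ∘ₗ (weilCounit R g).smulRight v) (fun c a => ?_) b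
  simp [coneTwist_tmul, weilCounit, smul_smul]

theorem coneTwist_tensorSign (b : Weil R g) :
    coneTwist R g (tensorSign R g LinearMap.id b) =
      ((coneTwist R g b).1, -(coneTwist R g b).2) := by
  refine eq_of_tmul (coneTwist R g ∘ₗ tensorSign R g LinearMap.id)
    (LinearMap.prodMap LinearMap.id (-LinearMap.id) ∘ₗ coneTwist R g) (fun c a => ?_) b
  simp [coneTwist_tmul, ιInv_extSign]

theorem coneTwist_actEven (Y : g) (b : Weil R g) :
    coneTwist R g (actEven R g (symAct R g) Y b) =
      (⁅(coneTwist R g b).1, Y⁆, ⁅(coneTwist R g b).2, Y⁆) := by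
  refine eq_of_tmul (coneTwist R g ∘ₗ actEven R g (symAct R g) Y)
    (LinearMap.prodMap ((lieBilin R g).flip Y) ((lieBilin R g).flip Y) ∘ₗ coneTwist R g)
    (fun c a => ?_) b
  simp [coneTwist_tmul, ιInv_extAct, symLin_symAct, extCounit_extAct, symCounit_symAct, lieBilin]

theorem coneTwist_weilD_tmul_one (c : DividedPowerAlgebra R g) :
    coneTwist R g (weilD R g (c ⊗ₜ 1)) = (0, -symLin R g c) := by
  rw [weilD_eq, cotwistedD_tmul_one_eq_smul, LinearMap.map_smul]
  have h : ∀ z : DividedPowerAlgebra R g ⊗[R] DividedPowerAlgebra R g,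
      coneTwist R g (LinearMap.lTensor _ (ι R ∘ₗ symLin R g) z) =
      (0, symLin R g (TensorProduct.lid R _ (LinearMap.rTensor _ (symCounit R g) z))) := by
    refine eq_of_tmul (coneTwist R g ∘ₗ LinearMap.lTensor _ (ι R ∘ₗ symLin R g))
      (LinearMap.inr R g g ∘ₗ symLin R g ∘ₗ (TensorProduct.lid R _).toLinearMap ∘ₗ
        LinearMap.rTensor _ (symCounit R g)) (fun x y => ?_)
    simp [coneTwist_tmul]
  rw [h, symComul_counit_left, Prod.smul_mk, smul_zero, neg_one_smul]

variable (R g)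

/-- On S' ⊗ 1 the cup square vanishes because [sx, sy] = 0, and d τ cancels τ D. After
multiplication by sv, both sides are computed from τ b outright, without the identity for b; the two
counit laws give two equal brackets, whence the factor 2. -/
theorem weil_isConeCE : IsConeCE R g (weilD R g) := by
  refine LinearMap.ext (tensor_hom _ _ (fun c => ?_) (fun v b _ => ?_))
  · simp only [LinearMap.smul_apply, LinearMap.add_apply, LinearMap.comp_apply,
      coneTwist_weilD_tmul_one, cupBracket, weilComul, tensorComul_tmul_one]
    have h : ∀ z : DividedPowerAlgebra R g ⊗[R] DividedPowerAlgebra R g,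
        TensorProduct.lift (coneBracket R g) (TensorProduct.map
          (coneTwist R g ∘ₗ tensorSign R g LinearMap.id) (coneTwist R g)
          (TensorProduct.map (inclOne R g _) (inclOne R g _) z)) = 0 := by
      refine eq_of_tmul (TensorProduct.lift (coneBracket R g) ∘ₗ TensorProduct.map
          (coneTwist R g ∘ₗ tensorSign R g LinearMap.id) (coneTwist R g) ∘ₗ
          TensorProduct.map (inclOne R g _) (inclOne R g _)) 0 (fun x y => ?_)
      simp [coneTwist_tmul, coneBracket]
    rw [h]
    simp [coneTwist_tmul, coneD]
  · have h := coneBracket_diagOp (t := coneTwist R g) (ε := weilCounit R g)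
      (coneTwist_actOdd v) coneTwist_tensorSign (tensorSign_actOdd LinearMap.id v)
      (tensorCounit_tensorSign (fun _ => rfl)) (weilComul R g b)
    rw [(weil_isDGCoalgebra R g).counit_left, (weil_isDGCoalgebra R g).counit_right] at h
    have h2 : weilComul R g (actOdd R g _ v b) =
        diagOp (actOdd R g _ v) (tensorSign R g LinearMap.id) (weilComul R g b) :=
      tensorComul_actOdd LinearMap.id _ v b
    simp only [LinearMap.smul_apply, LinearMap.add_apply, LinearMap.comp_apply, cupBracket, h2]
    rw [h, weilD_eq, cotwistedD_actOdd, ← weilD_eq, map_add, coneTwist_actOdd, coneTwist_actOdd,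
      coneTwist_actEven, coneTwist_tensorSign, (weil_isDGCoalgebra R g).counit_d]
    simp [coneD, two_smul]

end WeilCoalgebra

/-! ### The adjoint κ = `symAdjoint` of the twisting cochain -/

section Adjoint

variable {R : Type*} [CommRing R] {g : Type*} [LieRing g] [LieAlgebra R g]

open ExteriorAlgebra (ι ιInv)

theorem symAdjoint_of_mem {n : ℕ} {c : DividedPowerAlgebra R g} (hc : c ∈ symGr R g n) :
    symAdjoint R g c = adjointComponent R g (symTwist R g) n c := by
  rw [symAdjoint, LinearMap.comp_apply, mem_symGr.mp hc]
  simp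

theorem adjointComponent_mem (n : ℕ) (c : DividedPowerAlgebra R g) :
    adjointComponent R g (symTwist R g) n c ∈ barTGr R g (2 * n) := by
  induction n generalizing c with
  | zero =>
    rw [adjointComponent, LinearMap.comp_apply, Algebra.linearMap_apply,
      Algebra.algebraMap_eq_smul_one]
    exact Submodule.smul_mem _ _ one_mem_barTGr
  | succ n ih =>
    rw [adjointComponent, LinearMap.comp_apply, LinearMap.comp_apply]
    generalize symComul R g c = z
    induction z using TensorProduct.induction_on with
    | zero => rw [map_zero, map_zero]; exact Submodule.zero_mem _
    | add x y hx hy => rw [map_add, map_add]; exact Submodule.add_mem _ hx hy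
    | tmul x y =>
      rw [TensorProduct.map_tmul, LinearMap.mul'_apply]
      exact mul_letter_mem_barTGr (ih x) (ι_mem_extPower _)

theorem symAdjoint_mem {n : ℕ} {c : DividedPowerAlgebra R g} (hc : c ∈ symGr R g n) :
    symAdjoint R g c ∈ barTGr R g (2 * n) := by
  rw [symAdjoint_of_mem hc]
  exact adjointComponent_mem n c

/-- Letters s(sx) have degree two, so the values of κ are even and signs disappear in all
computations with them. -/
theorem barSign_symAdjoint (c : DividedPowerAlgebra R g) :
    barSign R g (symAdjoint R g c) = symAdjoint R g c := by
  refine symGr_hom (barSign R g ∘ₗ symAdjoint R g) _ (fun n c hc => ?_) c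
  rw [LinearMap.comp_apply, barSign_of_mem _ _ (symAdjoint_mem hc), pow_mul, neg_one_sq, one_pow,
    one_smul]

/-- The letter `s(sx)` of `T'`. -/
def degTwoLetter (R : Type*) [CommRing R] (g : Type*) [LieRing g] [LieAlgebra R g] :
    g →ₗ[R] BarT R g := barLetter R g ∘ₗ ι R

/-- The operator `m ⊗ x ↦ m · s(sx)`. -/
def appendLetter (R : Type*) [CommRing R] (g : Type*) [LieRing g] [LieAlgebra R g] :
    BarT R g ⊗[R] g →ₗ[R] BarT R g :=
  LinearMap.mul' R (BarT R g) ∘ₗ TensorProduct.map LinearMap.id (degTwoLetter R g)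

@[simp]
theorem appendLetter_tmul (m : BarT R g) (x : g) :
    appendLetter R g (m ⊗ₜ x) = m * barLetter R g (ι R x) := rfl

/-- In weight n only the n-th component counts, and its last factor has weight one. With
`sym_rec_unique`, this recursion replaces the decomposition by weights in what follows. -/
theorem symAdjoint_rec (c : DividedPowerAlgebra R g) :
    symAdjoint R g c = symCounit R g c • 1 +
      appendLetter R g (TensorProduct.map (symAdjoint R g) (symLin R g) (symComul R g c)) := by
  refine symGr_hom (symAdjoint R g) ((symCounit R g).smulRight 1 + appendLetter R g ∘ₗ
    TensorProduct.map (symAdjoint R g) (symLin R g) ∘ₗ symComul R g) (fun n c hc => ?_) c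
  simp only [LinearMap.add_apply, LinearMap.smulRight_apply, LinearMap.comp_apply]
  rw [symAdjoint_of_mem hc]
  cases n with
  | zero =>
    have h : TensorProduct.map (symAdjoint R g) (symLin R g) (symComul R g c) = 0 := by
      refine grTensor_le (P := LinearMap.ker (TensorProduct.map (symAdjoint R g) (symLin R g)))
        (fun i j hij a _ b hb => ?_) (symComul_mem 0 c hc)
      rw [LinearMap.mem_ker, TensorProduct.map_tmul, symLin_of_mem j (by omega) b hb,
        TensorProduct.tmul_zero]
    rw [h, map_zero, add_zero, adjointComponent, LinearMap.comp_apply, Algebra.linearMap_apply,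
      Algebra.algebraMap_eq_smul_one]
  | succ n =>
    rw [symCounit_of_mem _ (Nat.succ_ne_zero n) c hc, zero_smul, zero_add, adjointComponent,
      LinearMap.comp_apply, LinearMap.comp_apply]
    refine grTensor_le (P := LinearMap.eqLocus (LinearMap.mul' R (BarT R g) ∘ₗ
      TensorProduct.map (adjointComponent R g (symTwist R g) n) (barLetter R g ∘ₗ symTwist R g))
      (appendLetter R g ∘ₗ TensorProduct.map (symAdjoint R g) (symLin R g)))
      (fun i j hij a ha b hb => ?_) (symComul_mem (n + 1) c hc)
    simp only [LinearMap.mem_eqLocus, LinearMap.comp_apply, TensorProduct.map_tmul,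
      LinearMap.mul'_apply, appendLetter_tmul]
    by_cases hj : j = 1
    · obtain rfl : i = n := by omega
      rw [symAdjoint_of_mem ha]
      rfl
    · simp [symTwist, symLin_of_mem j hj b hb]

theorem barTCounit_symAdjoint (c : DividedPowerAlgebra R g) :
    barTCounit R g (symAdjoint R g c) = symCounit R g c := by
  rw [symAdjoint_rec, map_add, map_smul, barTCounit_one, smul_eq_mul, mul_one, add_eq_left]
  refine eq_of_tmul (barTCounit R g ∘ₗ appendLetter R g ∘ₗ
    TensorProduct.map (symAdjoint R g) (symLin R g)) 0 (fun x y => ?_) (symComul R g c)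
  simp

theorem barSplit_symAdjoint (c : DividedPowerAlgebra R g) :
    barSplit R g (symAdjoint R g c) =
      TensorProduct.map (symAdjoint R g) (ι R ∘ₗ symLin R g) (symComul R g c) := by
  rw [symAdjoint_rec, map_add, map_smul, barSplit_one, smul_zero, zero_add]
  refine eq_of_tmul (barSplit R g ∘ₗ appendLetter R g ∘ₗ
    TensorProduct.map (symAdjoint R g) (symLin R g))
    (TensorProduct.map (symAdjoint R g) (ι R ∘ₗ symLin R g)) (fun x y => ?_) (symComul R g c)
  simp [barSplit_mul_letter]

/-- A letter s(sx) contributes nothing: ∂(sx) = 0 in Λ, and in the diagonal of the primitive element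
sx one summand gives the letter of 1 and the other has no component in g. So ∂ κ solves the
homogeneous recursion. -/
theorem barBoundary_symAdjoint (c : DividedPowerAlgebra R g) :
    barBoundary R g (symAdjoint R g c) = 0 := by
  refine sym_rec_unique (fun _ => 0) (appendLetter R g) (barBoundary R g ∘ₗ symAdjoint R g) 0
    (fun c => ?_) (fun c => by simp) c
  rw [LinearMap.comp_apply, symAdjoint_rec, map_add, map_smul, barBoundary_one, smul_zero]
  congr 1
  refine eq_of_tmul (barBoundary R g ∘ₗ appendLetter R g ∘ₗ
    TensorProduct.map (symAdjoint R g) (symLin R g))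
    (appendLetter R g ∘ₗ TensorProduct.map (barBoundary R g ∘ₗ symAdjoint R g) (symLin R g))
    (fun x y => ?_) (symComul R g c)
  simp [barBoundary_mul_letter, extComul_ι, extBoundary_ι]

/-- The differential fuses the last two letters of κ(c) into s(sπ(c'') sπ(c''')); after
reassociation this is an alternating expression in a diagonal and vanishes by
`symTwist_alternating`. What remains is the homogeneous recursion. -/
theorem barD_symAdjoint (c : DividedPowerAlgebra R g) :
    barD R g (symAdjoint R g c) = 0 := by
  refine sym_rec_unique (fun _ => 0) (appendLetter R g) (barD R g ∘ₗ symAdjoint R g) 0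
    (fun c => ?_) (fun c => by simp) c
  rw [LinearMap.comp_apply, symAdjoint_rec, map_add, map_smul, barD_one, smul_zero]
  congr 1
  set m := TensorProduct.lift ((LinearMap.mul R (ExteriorAlgebra R g)).compl₁₂
    (ι R ∘ₗ symLin R g) (ι R ∘ₗ symLin R g)) with hm
  have h1 : ∀ z : DividedPowerAlgebra R g ⊗[R] DividedPowerAlgebra R g, barD R g
      (appendLetter R g (TensorProduct.map (symAdjoint R g) (symLin R g) z)) =
      LinearMap.mul' R (BarT R g) (TensorProduct.map (symAdjoint R g) (barLetter R g ∘ₗ m)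
        (TensorProduct.assoc R _ _ _ (LinearMap.rTensor _ (symComul R g) z))) +
      appendLetter R g (TensorProduct.map (barD R g ∘ₗ symAdjoint R g) (symLin R g) z) := by
    refine eq_of_tmul (barD R g ∘ₗ appendLetter R g ∘ₗ
        TensorProduct.map (symAdjoint R g) (symLin R g))
      (LinearMap.mul' R (BarT R g) ∘ₗ TensorProduct.map (symAdjoint R g) (barLetter R g ∘ₗ m) ∘ₗ
        (TensorProduct.assoc R _ _ _).toLinearMap ∘ₗ LinearMap.rTensor _ (symComul R g) +
      appendLetter R g ∘ₗ TensorProduct.map (barD R g ∘ₗ symAdjoint R g) (symLin R g))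
      (fun x y => ?_)
    simp only [LinearMap.comp_apply, LinearMap.add_apply, TensorProduct.map_tmul,
      appendLetter_tmul, barD_mul_letter, barSplit_symAdjoint, extCounit_ι, zero_smul, sub_zero,
      LinearMap.rTensor_tmul, LinearEquiv.coe_coe]
    congr 1
    generalize symComul R g x = w
    refine eq_of_tmul (LinearMap.mul' R (BarT R g) ∘ₗ TensorProduct.map (barSign R g)
        (barLetter R g ∘ₗ LinearMap.mulRight R (ι R (symLin R g y)) ∘ₗ (-extSign R g)) ∘ₗ
        TensorProduct.map (symAdjoint R g) (ι R ∘ₗ symLin R g))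
      (LinearMap.mul' R (BarT R g) ∘ₗ TensorProduct.map (symAdjoint R g) (barLetter R g ∘ₗ m) ∘ₗ
        (TensorProduct.assoc R _ _ _).toLinearMap ∘ₗ (TensorProduct.mk R _ _).flip y)
      (fun u v => ?_) w
    simp [hm, barSign_symAdjoint]
  have h2 : TensorProduct.map (symAdjoint R g) (barLetter R g ∘ₗ m)
      (LinearMap.lTensor _ (symComul R g) (symComul R g c)) = 0 := by
    rw [← LinearMap.comp_apply, LinearMap.map_comp_lTensor, LinearMap.comp_assoc,
      show m ∘ₗ symComul R g = 0 from LinearMap.ext symTwist_alternating, LinearMap.comp_zero,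
      TensorProduct.map_zero_right, LinearMap.zero_apply]
  rw [h1, symComul_coassoc, h2, map_zero, zero_add]

/-- Both sides satisfy the recursion whose inhomogeneous term lets Y act on the last letter. -/
theorem symAdjoint_symAct (Y : g) (c : DividedPowerAlgebra R g) :
    symAdjoint R g (symAct R g Y c) = barTAct R g Y (symAdjoint R g c) := by
  set A : DividedPowerAlgebra R g → BarT R g := fun c => appendLetter R g
    (TensorProduct.map (symAdjoint R g) ((lieBilin R g).flip Y ∘ₗ symLin R g) (symComul R g c))
    with hA
  refine sym_rec_unique A (appendLetter R g) (symAdjoint R g ∘ₗ symAct R g Y)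
    (barTAct R g Y ∘ₗ symAdjoint R g) (fun c => ?_) (fun c => ?_) c
  · rw [LinearMap.comp_apply, symAdjoint_rec, symCounit_symAct, zero_smul, zero_add,
      symComul_symAct, hA]
    refine eq_of_tmul (appendLetter R g ∘ₗ TensorProduct.map (symAdjoint R g) (symLin R g) ∘ₗ
        diagOp (symAct R g Y) LinearMap.id)
      (appendLetter R g ∘ₗ TensorProduct.map (symAdjoint R g)
        ((lieBilin R g).flip Y ∘ₗ symLin R g) + appendLetter R g ∘ₗ
          TensorProduct.map (symAdjoint R g ∘ₗ symAct R g Y) (symLin R g)) (fun x y => ?_)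
      (symComul R g c)
    simp only [LinearMap.comp_apply, LinearMap.add_apply, diagOp_tmul, map_add,
      TensorProduct.map_tmul, appendLetter_tmul, symLin_symAct, LinearMap.id_apply]
    exact add_comm _ _
  · rw [LinearMap.comp_apply, symAdjoint_rec, map_add, map_smul, barTAct_one, smul_zero,
      zero_add, hA]
    refine eq_of_tmul (barTAct R g Y ∘ₗ appendLetter R g ∘ₗ
        TensorProduct.map (symAdjoint R g) (symLin R g))
      (appendLetter R g ∘ₗ TensorProduct.map (symAdjoint R g)
        ((lieBilin R g).flip Y ∘ₗ symLin R g) + appendLetter R g ∘ₗ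
          TensorProduct.map (barTAct R g Y ∘ₗ symAdjoint R g) (symLin R g)) (fun x y => ?_)
      (symComul R g c)
    simp [barTAct_mul_letter, extAct_ι, lieBilin]

/-- The recursion satisfied by `∑ F(c') ⊗ κ(c'')` for the adjoint `κ`. -/
theorem map_symAdjoint_rec {X : Type*} [AddCommMonoid X] [Module R X]
    (F : DividedPowerAlgebra R g →ₗ[R] X) (c : DividedPowerAlgebra R g) :
    TensorProduct.map F (symAdjoint R g) (symComul R g c) = F c ⊗ₜ 1 +
      LinearMap.lTensor X (appendLetter R g) (TensorProduct.assoc R X (BarT R g) g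
        (TensorProduct.map (TensorProduct.map F (symAdjoint R g) ∘ₗ symComul R g) (symLin R g)
          (symComul R g c))) := by
  have h1 : symAdjoint R g = (symCounit R g).smulRight 1 + appendLetter R g ∘ₗ
      TensorProduct.map (symAdjoint R g) (symLin R g) ∘ₗ symComul R g :=
    LinearMap.ext symAdjoint_rec
  have h2 : ∀ z : DividedPowerAlgebra R g ⊗[R] DividedPowerAlgebra R g,
      TensorProduct.map F (symAdjoint R g) z =
        F (TensorProduct.rid R _ (LinearMap.lTensor _ (symCounit R g) z)) ⊗ₜ 1 +
        LinearMap.lTensor X (appendLetter R g) (TensorProduct.map F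
          (TensorProduct.map (symAdjoint R g) (symLin R g))
            (LinearMap.lTensor _ (symComul R g) z)) := by
    refine eq_of_tmul _ ((TensorProduct.mk R X (BarT R g)).flip 1 ∘ₗ F ∘ₗ
        (TensorProduct.rid R _).toLinearMap ∘ₗ LinearMap.lTensor _ (symCounit R g) +
      LinearMap.lTensor X (appendLetter R g) ∘ₗ TensorProduct.map F
          (TensorProduct.map (symAdjoint R g) (symLin R g)) ∘ₗ
            LinearMap.lTensor _ (symComul R g)) (fun x y => ?_)
    rw [TensorProduct.map_tmul, symAdjoint_rec]
    simp [TensorProduct.tmul_add, TensorProduct.smul_tmul']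
  have h3 : ∀ z : DividedPowerAlgebra R g ⊗[R] DividedPowerAlgebra R g,
      TensorProduct.map F (TensorProduct.map (symAdjoint R g) (symLin R g))
        (TensorProduct.assoc R _ _ _ (LinearMap.rTensor _ (symComul R g) z)) =
      TensorProduct.assoc R X (BarT R g) g
        (TensorProduct.map (TensorProduct.map F (symAdjoint R g) ∘ₗ symComul R g) (symLin R g)
          z) := by
    refine eq_of_tmul (TensorProduct.map F (TensorProduct.map (symAdjoint R g) (symLin R g)) ∘ₗ
        (TensorProduct.assoc R _ _ _).toLinearMap ∘ₗ LinearMap.rTensor _ (symComul R g))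
      ((TensorProduct.assoc R X (BarT R g) g).toLinearMap ∘ₗ
        TensorProduct.map (TensorProduct.map F (symAdjoint R g) ∘ₗ symComul R g) (symLin R g))
      (fun x y => ?_)
    simp only [LinearMap.comp_apply, LinearMap.rTensor_tmul, LinearEquiv.coe_coe,
      TensorProduct.map_tmul]
    generalize symComul R g x = w
    refine eq_of_tmul (TensorProduct.map F (TensorProduct.map (symAdjoint R g) (symLin R g)) ∘ₗ
        (TensorProduct.assoc R _ _ _).toLinearMap ∘ₗ (TensorProduct.mk R _ _).flip y)
      ((TensorProduct.assoc R X (BarT R g) g).toLinearMap ∘ₗ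
        (TensorProduct.mk R _ _).flip (symLin R g y) ∘ₗ TensorProduct.map F (symAdjoint R g))
      (fun u v => ?_) w
    simp
  rw [h2, symComul_counit_right, ← symComul_coassoc, h3]

/-- Cutting after the last letter gives κ(c) ⊗ 1, and any other cut leaves that letter on the right
factor. By `map_symAdjoint_rec`, the right side obeys the same recursion. -/
theorem barDeconc_symAdjoint (c : DividedPowerAlgebra R g) :
    barDeconc R g (symAdjoint R g c) =
      TensorProduct.map (symAdjoint R g) (symAdjoint R g) (symComul R g c) := by
  refine sym_rec_unique (fun c => symAdjoint R g c ⊗ₜ 1) (LinearMap.lTensor _ (appendLetter R g) ∘ₗ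
      (TensorProduct.assoc R (BarT R g) (BarT R g) g).toLinearMap)
    (barDeconc R g ∘ₗ symAdjoint R g)
    (TensorProduct.map (symAdjoint R g) (symAdjoint R g) ∘ₗ symComul R g) (fun c => ?_)
    (fun c => map_symAdjoint_rec (symAdjoint R g) c) c
  have h : ∀ z : DividedPowerAlgebra R g ⊗[R] DividedPowerAlgebra R g, barDeconc R g
      (appendLetter R g (TensorProduct.map (symAdjoint R g) (symLin R g) z)) =
      appendLetter R g (TensorProduct.map (symAdjoint R g) (symLin R g) z) ⊗ₜ 1 +
      LinearMap.lTensor _ (appendLetter R g) (TensorProduct.assoc R (BarT R g) (BarT R g) g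
        (TensorProduct.map (barDeconc R g ∘ₗ symAdjoint R g) (symLin R g) z)) := by
    refine eq_of_tmul (barDeconc R g ∘ₗ appendLetter R g ∘ₗ
        TensorProduct.map (symAdjoint R g) (symLin R g))
      ((TensorProduct.mk R _ _).flip 1 ∘ₗ appendLetter R g ∘ₗ
        TensorProduct.map (symAdjoint R g) (symLin R g) +
      LinearMap.lTensor _ (appendLetter R g) ∘ₗ
        (TensorProduct.assoc R (BarT R g) (BarT R g) g).toLinearMap ∘ₗ
        TensorProduct.map (barDeconc R g ∘ₗ symAdjoint R g) (symLin R g)) (fun x y => ?_)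
    simp only [LinearMap.comp_apply, TensorProduct.map_tmul, appendLetter_tmul,
      barDeconc_mul_letter, LinearMap.add_apply, LinearMap.flip_apply, TensorProduct.mk_apply,
      LinearEquiv.coe_coe]
    congr 1
    generalize barDeconc R g (symAdjoint R g x) = w
    refine eq_of_tmul (LinearMap.lTensor _ (LinearMap.mulRight R
        (barLetter R g (ι R (symLin R g y)))))
      (LinearMap.lTensor _ (appendLetter R g) ∘ₗ
        (TensorProduct.assoc R (BarT R g) (BarT R g) g).toLinearMap ∘ₗ
        (TensorProduct.mk R _ _).flip (symLin R g y)) (fun u v => ?_) w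
    simp
  rw [LinearMap.comp_apply, LinearMap.comp_apply, LinearEquiv.coe_coe]
  conv_lhs => rw [symAdjoint_rec]
  conv_rhs => enter [1]; rw [symAdjoint_rec]
  rw [map_add, map_smul, barDeconc_one, h, TensorProduct.add_tmul, TensorProduct.smul_tmul',
    add_assoc]

end Adjoint

/-! ### The map ι: compatibility with all structures -/

section WeilToBar

variable {R : Type*} [CommRing R] {g : Type*} [LieRing g] [LieAlgebra R g]

open ExteriorAlgebra (ι ιInv)

/-- The operator `(y' ⊗ y'') ⊗ v ↦ (Id ⊗ h) ((y' ⊗ y'') · sv)`. -/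
def awStep (R : Type*) [CommRing R] (g : Type*) [LieRing g] [LieAlgebra R g] :
    (RelBar R g ⊗[R] RelBar R g) ⊗[R] g →ₗ[R] RelBar R g ⊗[R] RelBar R g :=
  TensorProduct.map (relBarSign R g) (barHomotopy R g) ∘ₗ
    TensorProduct.lift (LinearMap.flip (diagStep R g))

theorem awStep_tmul (z : RelBar R g ⊗[R] RelBar R g) (v : g) :
    awStep R g (z ⊗ₜ v) = TensorProduct.map (relBarSign R g) (barHomotopy R g)
      (diagOp (relBarActOdd R g v) (relBarSign R g) z) := rfl

theorem diagAct_ι (v : g) (z : RelBar R g ⊗[R] RelBar R g) :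
    diagAct R g (ι R v) z = diagOp (relBarActOdd R g v) (relBarSign R g) z := by
  have h := diagAct_mul_ι 1 v z
  rwa [one_mul, diagAct_one] at h

theorem relBarSign_symAdjoint (c : DividedPowerAlgebra R g) :
    relBarSign R g (symAdjoint R g c ⊗ₜ 1) = symAdjoint R g c ⊗ₜ 1 := by
  rw [relBarSign, tensorSign_tmul, barSign_symAdjoint, extSign_one]

/-- When y acts on the left factor, the right factor stays in T' ⊗ 1 and h kills it. Hence the
Alexander–Whitney step only appends the letter on the right, exactly as deconcatenation does. -/
theorem awStep_symAdjoint (u v : DividedPowerAlgebra R g) (y : g) :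
    awStep R g (((symAdjoint R g u ⊗ₜ 1) ⊗ₜ (symAdjoint R g v ⊗ₜ 1)) ⊗ₜ y) =
      (symAdjoint R g u ⊗ₜ 1) ⊗ₜ ((symAdjoint R g v * barLetter R g (ι R y)) ⊗ₜ 1) := by
  rw [awStep_tmul, diagOp_tmul, relBarSign_symAdjoint, LinearMap.map_add, TensorProduct.map_tmul,
    TensorProduct.map_tmul, barHomotopy_tmul_one, TensorProduct.tmul_zero, zero_add,
    relBarSign_symAdjoint, relBarActOdd, actOdd_tmul, one_mul, barHomotopy_tmul,
    barSign_symAdjoint]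

theorem awComulT_appendLetter
    (z : DividedPowerAlgebra R g ⊗[R] DividedPowerAlgebra R g) :
    awComulT R g (appendLetter R g (TensorProduct.map (symAdjoint R g) (symLin R g) z)) =
      (appendLetter R g (TensorProduct.map (symAdjoint R g) (symLin R g) z) ⊗ₜ 1) ⊗ₜ (1 ⊗ₜ 1) +
        awStep R g (TensorProduct.map (awComulT R g ∘ₗ symAdjoint R g) (symLin R g) z) := by
  refine eq_of_tmul (awComulT R g ∘ₗ appendLetter R g ∘ₗ
      TensorProduct.map (symAdjoint R g) (symLin R g))
    ((TensorProduct.mk R _ _).flip (1 ⊗ₜ 1) ∘ₗ inclOne R g _ ∘ₗ appendLetter R g ∘ₗ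
      TensorProduct.map (symAdjoint R g) (symLin R g) +
      awStep R g ∘ₗ TensorProduct.map (awComulT R g ∘ₗ symAdjoint R g) (symLin R g))
    (fun x y => ?_) z
  simp only [LinearMap.comp_apply, TensorProduct.map_tmul, appendLetter_tmul, awStep_tmul,
    LinearMap.add_apply, LinearMap.flip_apply, TensorProduct.mk_apply, inclOne_apply]
  rw [awComulT_mul_letter, ← awComulT_barSign, barSign_symAdjoint, diagAct_ι]

/-- Combines the unit and the appended part of `symAdjoint_rec` for maps into an arbitrary module.
-/
theorem map_smul_add_of_eq {T X : Type*} [AddCommMonoid T] [Module R T] [AddCommMonoid X]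
    [Module R X] {f L : T →ₗ[R] X} {e p : T} {k : X} (he : f e = L e) (hp : f p = L p + k) (r : R) :
    f (r • e + p) = L (r • e + p) + k := by
  rw [f.map_add, f.map_smul, he, hp, L.map_add, L.map_smul, add_assoc]

theorem awComulT_symAdjoint_rec (c : DividedPowerAlgebra R g) :
    awComulT R g (symAdjoint R g c) = (symAdjoint R g c ⊗ₜ 1) ⊗ₜ (1 ⊗ₜ 1) +
      awStep R g (TensorProduct.map (awComulT R g ∘ₗ symAdjoint R g) (symLin R g)
        (symComul R g c)) := by
  have h := map_smul_add_of_eq (f := awComulT R g)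
    (L := (TensorProduct.mk R (RelBar R g) (RelBar R g)).flip (1 ⊗ₜ 1) ∘ₗ inclOne R g _)
    awComulT_one (awComulT_appendLetter (symComul R g c)) (symCounit R g c)
  rw [← symAdjoint_rec] at h
  exact h

/-- The maps `(1 ⊗ append) (J ⊗ symAdjoint ⊗ Id)` and `awStep (J ⊗ J ⊗ Id)` agree, where `J` is
`symAdjoint` with values in `RelBar`. -/
theorem awStep_map_symAdjoint (y : g) (w : DividedPowerAlgebra R g ⊗[R] DividedPowerAlgebra R g) :
    LinearMap.lTensor (RelBar R g) (inclOne R g (BarT R g) ∘ₗ appendLetter R g)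
      (TensorProduct.assoc R (RelBar R g) (BarT R g) g
        (TensorProduct.map (inclOne R g _ ∘ₗ symAdjoint R g) (symAdjoint R g) w ⊗ₜ y)) =
    awStep R g (TensorProduct.map (inclOne R g _ ∘ₗ symAdjoint R g)
      (inclOne R g _ ∘ₗ symAdjoint R g) w ⊗ₜ y) := by
  refine eq_of_tmul (LinearMap.lTensor (RelBar R g) (inclOne R g (BarT R g) ∘ₗ appendLetter R g) ∘ₗ
      (TensorProduct.assoc R (RelBar R g) (BarT R g) g).toLinearMap ∘ₗ
      (TensorProduct.mk R _ _).flip y ∘ₗ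
      TensorProduct.map (inclOne R g _ ∘ₗ symAdjoint R g) (symAdjoint R g))
    (awStep R g ∘ₗ (TensorProduct.mk R _ _).flip y ∘ₗ TensorProduct.map
      (inclOne R g _ ∘ₗ symAdjoint R g) (inclOne R g _ ∘ₗ symAdjoint R g)) (fun u v => ?_) w
  exact (awStep_symAdjoint u v y).symm

theorem awStep_map_symComul (z : DividedPowerAlgebra R g ⊗[R] DividedPowerAlgebra R g) :
    LinearMap.lTensor (RelBar R g) (inclOne R g (BarT R g) ∘ₗ appendLetter R g)
      (TensorProduct.assoc R (RelBar R g) (BarT R g) g (TensorProduct.map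
        (TensorProduct.map (inclOne R g _ ∘ₗ symAdjoint R g) (symAdjoint R g) ∘ₗ symComul R g)
          (symLin R g) z)) =
    awStep R g (TensorProduct.map (TensorProduct.map (inclOne R g _ ∘ₗ symAdjoint R g)
      (inclOne R g _ ∘ₗ symAdjoint R g) ∘ₗ symComul R g) (symLin R g) z) := by
  refine eq_of_tmul (LinearMap.lTensor (RelBar R g) (inclOne R g (BarT R g) ∘ₗ appendLetter R g) ∘ₗ
      (TensorProduct.assoc R (RelBar R g) (BarT R g) g).toLinearMap ∘ₗ TensorProduct.map
        (TensorProduct.map (inclOne R g _ ∘ₗ symAdjoint R g) (symAdjoint R g) ∘ₗ symComul R g)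
          (symLin R g))
    (awStep R g ∘ₗ TensorProduct.map (TensorProduct.map (inclOne R g _ ∘ₗ symAdjoint R g)
      (inclOne R g _ ∘ₗ symAdjoint R g) ∘ₗ symComul R g) (symLin R g)) (fun x y => ?_) z
  exact awStep_map_symAdjoint (symLin R g y) (symComul R g x)

/-- Recasts `map_symAdjoint_rec` with `awStep` in place of appending a letter, so that it has the
shape of `awComulT_symAdjoint_rec` and uniqueness applies. -/
theorem map_inclOne_symAdjoint_rec (c : DividedPowerAlgebra R g) :
    TensorProduct.map (inclOne R g _ ∘ₗ symAdjoint R g) (inclOne R g _ ∘ₗ symAdjoint R g)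
        (symComul R g c) = (symAdjoint R g c ⊗ₜ 1) ⊗ₜ (1 ⊗ₜ 1) +
      awStep R g (TensorProduct.map (TensorProduct.map (inclOne R g _ ∘ₗ symAdjoint R g)
        (inclOne R g _ ∘ₗ symAdjoint R g) ∘ₗ symComul R g) (symLin R g) (symComul R g c)) := by
  have h1 : ∀ z : DividedPowerAlgebra R g ⊗[R] DividedPowerAlgebra R g,
      TensorProduct.map (inclOne R g _ ∘ₗ symAdjoint R g) (inclOne R g _ ∘ₗ symAdjoint R g) z =
        LinearMap.lTensor (RelBar R g) (inclOne R g (BarT R g))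
          (TensorProduct.map (inclOne R g _ ∘ₗ symAdjoint R g) (symAdjoint R g) z) :=
    eq_of_tmul _ (LinearMap.lTensor (RelBar R g) (inclOne R g (BarT R g)) ∘ₗ
      TensorProduct.map (inclOne R g _ ∘ₗ symAdjoint R g) (symAdjoint R g)) (fun x y => rfl)
  rw [h1, map_symAdjoint_rec, LinearMap.map_add, ← awStep_map_symComul, LinearMap.lTensor_comp]
  rfl

theorem awComulT_symAdjoint (c : DividedPowerAlgebra R g) :
    awComulT R g (symAdjoint R g c) =
      TensorProduct.map (inclOne R g _ ∘ₗ symAdjoint R g) (inclOne R g _ ∘ₗ symAdjoint R g)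
        (symComul R g c) :=
  sym_rec_unique (fun c => (symAdjoint R g c ⊗ₜ 1) ⊗ₜ (1 ⊗ₜ 1)) (awStep R g)
    (awComulT R g ∘ₗ symAdjoint R g)
    (TensorProduct.map (inclOne R g _ ∘ₗ symAdjoint R g) (inclOne R g _ ∘ₗ symAdjoint R g) ∘ₗ
      symComul R g) awComulT_symAdjoint_rec map_inclOne_symAdjoint_rec c

theorem weilToBar_tmul (c : DividedPowerAlgebra R g) (a : ExteriorAlgebra R g) :
    weilToBar R g (c ⊗ₜ a) = symAdjoint R g c ⊗ₜ a := rfl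

theorem weilToBar_actOdd (v : g) (b : Weil R g) :
    weilToBar R g (weilActOdd R g v b) = relBarActOdd R g v (weilToBar R g b) :=
  eq_of_tmul (weilToBar R g ∘ₗ weilActOdd R g v) (relBarActOdd R g v ∘ₗ weilToBar R g)
    (fun _ _ => rfl) b

theorem weilToBar_actEven (Y : g) (b : Weil R g) :
    weilToBar R g (weilActEven R g Y b) = relBarActEven R g Y (weilToBar R g b) := by
  refine eq_of_tmul (weilToBar R g ∘ₗ weilActEven R g Y) (relBarActEven R g Y ∘ₗ weilToBar R g)
    (fun c a => ?_) b
  simp only [LinearMap.comp_apply, weilActEven, relBarActEven, weilToBar_tmul, actEven_tmul,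
    map_add, symAdjoint_symAct]

theorem weilToBar_sign (b : Weil R g) :
    weilToBar R g (tensorSign R g LinearMap.id b) = relBarSign R g (weilToBar R g b) := by
  refine eq_of_tmul (weilToBar R g ∘ₗ tensorSign R g LinearMap.id)
    (relBarSign R g ∘ₗ weilToBar R g) (fun c a => ?_) b
  simp only [LinearMap.comp_apply, relBarSign, weilToBar_tmul, tensorSign_tmul,
    barSign_symAdjoint, LinearMap.id_apply]

theorem weilToBar_counit (b : Weil R g) :
    relBarCounit R g (weilToBar R g b) = weilCounit R g b := by
  refine eq_of_tmul (relBarCounit R g ∘ₗ weilToBar R g) (weilCounit R g) (fun c a => ?_) b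
  simp only [LinearMap.comp_apply, relBarCounit, weilCounit, weilToBar_tmul, tensorCounit_tmul,
    barTCounit_symAdjoint]

theorem weilToBar_mem {n : ℕ} {b : Weil R g} (hb : b ∈ weilGr R g n) :
    weilToBar R g b ∈ relBarGr R g n := by
  refine tensorGr_le (P := (relBarGr R g n).comap (weilToBar R g))
    (fun i j hij c hc a ha => ?_) hb
  exact tmul_mem_tensorGr (w := id) (symAdjoint_mem hc) ha hij

/-- As d and ∂ vanish on κ(c), D on κ(c) ⊗ 1 is only the cap product, which by `barSplit_symAdjoint`
is the image of the one on S'. Both differentials then follow the same rule under right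
multiplication. -/
theorem weilToBar_weilD (b : Weil R g) :
    relBarD R g (weilToBar R g b) = weilToBar R g (weilD R g b) := by
  refine tensor_hom (relBarD R g ∘ₗ weilToBar R g) (weilToBar R g ∘ₗ weilD R g) (fun c => ?_)
    (fun v b h => ?_) b
  · rw [LinearMap.comp_apply, LinearMap.comp_apply, weilToBar_tmul, relBarD, twistedD_tmul_one,
      LinearMap.add_apply, barD_symAdjoint, barBoundary_symAdjoint, add_zero,
      TensorProduct.zero_tmul, zero_sub, barSplit_symAdjoint, weilD_eq,
      cotwistedD_tmul_one_eq_smul, LinearMap.map_smul]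
    refine (neg_one_smul R _).symm.trans (congrArg _ ?_)
    refine eq_of_tmul (LinearMap.rTensor _ (barSign R g) ∘ₗ
        TensorProduct.map (symAdjoint R g) (ι R ∘ₗ symLin R g))
      (weilToBar R g ∘ₗ LinearMap.lTensor _ (ι R ∘ₗ symLin R g)) (fun x y => ?_) (symComul R g c)
    simp only [LinearMap.comp_apply, TensorProduct.map_tmul, LinearMap.rTensor_tmul,
      LinearMap.lTensor_tmul, weilToBar_tmul, barSign_symAdjoint]
  · simp only [LinearMap.comp_apply] at h ⊢
    have h1 := weilToBar_actOdd v b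
    have h2 := weilToBar_actOdd v (weilD R g b)
    have h3 := weilToBar_actEven v (tensorSign R g LinearMap.id b)
    rw [weilActOdd] at h1 h2
    rw [weilActEven] at h3
    rw [h1, relBarD_actOdd, h, weilD_eq, cotwistedD_actOdd, ← weilD_eq, LinearMap.map_add, h2, h3,
      weilToBar_sign]

theorem map_weilToBar_diagOp (v : g) (z : Weil R g ⊗[R] Weil R g) :
    TensorProduct.map (weilToBar R g) (weilToBar R g)
      (diagOp (actOdd R g (DividedPowerAlgebra R g) v) (tensorSign R g LinearMap.id) z) =
    diagOp (relBarActOdd R g v) (relBarSign R g)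
      (TensorProduct.map (weilToBar R g) (weilToBar R g) z) := by
  refine eq_of_tmul (TensorProduct.map (weilToBar R g) (weilToBar R g) ∘ₗ
      diagOp (actOdd R g (DividedPowerAlgebra R g) v) (tensorSign R g LinearMap.id))
    (diagOp (relBarActOdd R g v) (relBarSign R g) ∘ₗ
      TensorProduct.map (weilToBar R g) (weilToBar R g)) (fun x y => ?_) z
  have hx := weilToBar_actOdd v x
  have hy := weilToBar_actOdd v y
  rw [weilActOdd] at hx hy
  rw [LinearMap.comp_apply, LinearMap.comp_apply, diagOp_tmul, LinearMap.map_add,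
    TensorProduct.map_tmul, TensorProduct.map_tmul, TensorProduct.map_tmul, diagOp_tmul, hx, hy,
    weilToBar_sign]

/-- Treats both diagonals at once: they share the rule under right multiplication and the value on
κ(c) ⊗ 1. -/
theorem weilToBar_comul_of_actOdd {Δ : RelBar R g →ₗ[R] RelBar R g ⊗[R] RelBar R g}
    (hΔ : ∀ v b, Δ (relBarActOdd R g v b) =
      diagOp (relBarActOdd R g v) (relBarSign R g) (Δ b))
    (h1 : ∀ c, Δ (symAdjoint R g c ⊗ₜ 1) = TensorProduct.map (inclOne R g _ ∘ₗ symAdjoint R g)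
      (inclOne R g _ ∘ₗ symAdjoint R g) (symComul R g c)) (b : Weil R g) :
    Δ (weilToBar R g b) = TensorProduct.map (weilToBar R g) (weilToBar R g)
      (weilComul R g b) := by
  refine tensor_hom (Δ ∘ₗ weilToBar R g) (TensorProduct.map (weilToBar R g) (weilToBar R g) ∘ₗ
    weilComul R g) (fun c => ?_) (fun v b h => ?_) b
  · rw [LinearMap.comp_apply, LinearMap.comp_apply, weilToBar_tmul, h1, weilComul,
      tensorComul_tmul_one]
    exact eq_of_tmul (TensorProduct.map (inclOne R g _ ∘ₗ symAdjoint R g)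
        (inclOne R g _ ∘ₗ symAdjoint R g))
      (TensorProduct.map (weilToBar R g) (weilToBar R g) ∘ₗ
        TensorProduct.map (inclOne R g _) (inclOne R g _)) (fun x y => rfl) _
  · simp only [LinearMap.comp_apply] at h ⊢
    have h2 := weilToBar_actOdd v b
    rw [weilActOdd] at h2
    rw [h2, hΔ, h, weilComul, tensorComul_actOdd]
    exact (map_weilToBar_diagOp v (weilComul R g b)).symm

theorem weilToBar_relBarComul (b : Weil R g) : relBarComul R g (weilToBar R g b) =
    TensorProduct.map (weilToBar R g) (weilToBar R g) (weilComul R g b) := by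
  refine weilToBar_comul_of_actOdd (tensorComul_actOdd (barSign R g) (barDeconc R g))
    (fun c => ?_) b
  rw [tensorComul_tmul_one, barDeconc_symAdjoint]
  exact eq_of_tmul (TensorProduct.map (inclOne R g _) (inclOne R g _) ∘ₗ
    TensorProduct.map (symAdjoint R g) (symAdjoint R g)) (TensorProduct.map
      (inclOne R g _ ∘ₗ symAdjoint R g) (inclOne R g _ ∘ₗ symAdjoint R g)) (fun x y => rfl) _

theorem weilToBar_awComul (b : Weil R g) : awComul R g (weilToBar R g b) =
    TensorProduct.map (weilToBar R g) (weilToBar R g) (weilComul R g b) := by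
  refine weilToBar_comul_of_actOdd awComul_actOdd (fun c => ?_) b
  rw [awComul_tmul_one, awComulT_symAdjoint]

variable (R g)

theorem weilToBar_isDGCoalgebraHom_relBarComul :
    IsDGCoalgebraHom (C := Weil R g) (C' := RelBar R g) (weilGr R g) (weilComul R g)
      (weilCounit R g) (weilD R g) (relBarGr R g) (relBarComul R g) (relBarCounit R g)
      (relBarD R g) (weilToBar R g) where
  map_mem _ _ hb := weilToBar_mem hb
  map_comul := weilToBar_relBarComul
  map_counit := weilToBar_counit
  map_d := weilToBar_weilD

theorem weilToBar_isDGCoalgebraHom_awComul :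
    IsDGCoalgebraHom (C := Weil R g) (C' := RelBar R g) (weilGr R g) (weilComul R g)
      (weilCounit R g) (weilD R g) (relBarGr R g) (awComul R g) (relBarCounit R g)
      (relBarD R g) (weilToBar R g) where
  map_mem _ _ hb := weilToBar_mem hb
  map_comul := weilToBar_awComul
  map_counit := weilToBar_counit
  map_d := weilToBar_weilD

end WeilToBar

end WeilBar
end

theorem theorem3p3p2 (R : Type*) [CommRing R] (g : Type*) [LieRing g] [LieAlgebra R g]
    [Module.Projective R g] (h2 : (2 : R) ∈ nonZeroDivisors R) :
    -- `W'[g]` is the differential graded Chevalley--Eilenberg coalgebra of `Cg`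
    WeilBar.IsDGCoalgebra (C := WeilBar.Weil R g) (WeilBar.weilGr R g) (WeilBar.weilComul R g) (WeilBar.weilCounit R g)
      (WeilBar.weilD R g) ∧
    WeilBar.IsConeCE R g (WeilBar.weilD R g) ∧
    WeilBar.IsDGConeModule (C := WeilBar.Weil R g) (WeilBar.weilGr R g) (WeilBar.weilD R g) (WeilBar.weilActEven R g)
      (WeilBar.weilActOdd R g) ∧
    -- the structure of `BΛ_∂[sg]`
    WeilBar.IsGradedCoalgebra (C := WeilBar.RelBar R g) (WeilBar.relBarGr R g) (WeilBar.relBarComul R g)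
      (WeilBar.relBarCounit R g) ∧
    WeilBar.IsDGCoalgebra (C := WeilBar.RelBar R g) (WeilBar.relBarGr R g) (WeilBar.awComul R g)
      (WeilBar.relBarCounit R g) (WeilBar.relBarD R g) ∧
    WeilBar.IsDGConeModule (C := WeilBar.RelBar R g) (WeilBar.relBarGr R g) (WeilBar.relBarD R g)
      (WeilBar.relBarActEven R g) (WeilBar.relBarActOdd R g) ∧
    -- `ι` is a morphism of differential graded coalgebras, for the tensor product diagonal
    -- as well as for the diagonal coming from the simplicial structure
    WeilBar.IsDGCoalgebraHom (C := WeilBar.Weil R g) (C' := WeilBar.RelBar R g)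
      (WeilBar.weilGr R g) (WeilBar.weilComul R g) (WeilBar.weilCounit R g) (WeilBar.weilD R g)
      (WeilBar.relBarGr R g) (WeilBar.relBarComul R g) (WeilBar.relBarCounit R g)
      (WeilBar.relBarD R g) (WeilBar.weilToBar R g) ∧
    WeilBar.IsDGCoalgebraHom (C := WeilBar.Weil R g) (C' := WeilBar.RelBar R g)
      (WeilBar.weilGr R g) (WeilBar.weilComul R g) (WeilBar.weilCounit R g) (WeilBar.weilD R g)
      (WeilBar.relBarGr R g) (WeilBar.awComul R g) (WeilBar.relBarCounit R g)
      (WeilBar.relBarD R g) (WeilBar.weilToBar R g) ∧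
    -- `ι` is compatible with the right `Cg`-module structures
    (∀ (Y : g) (c : WeilBar.Weil R g), WeilBar.weilToBar R g (WeilBar.weilActEven R g Y c) =
      WeilBar.relBarActEven R g Y (WeilBar.weilToBar R g c)) ∧
    (∀ (Y : g) (c : WeilBar.Weil R g), WeilBar.weilToBar R g (WeilBar.weilActOdd R g Y c) =
      WeilBar.relBarActOdd R g Y (WeilBar.weilToBar R g c)) :=
  ⟨WeilBar.weil_isDGCoalgebra R g,
    WeilBar.weil_isConeCE R g,
    WeilBar.weil_isDGConeModule R g,
    WeilBar.relBar_isGradedCoalgebra R g,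
    WeilBar.relBar_isDGCoalgebra R g,
    WeilBar.relBar_isDGConeModule R g,
    WeilBar.weilToBar_isDGCoalgebraHom_relBarComul R g,
    WeilBar.weilToBar_isDGCoalgebraHom_awComul R g,
    WeilBar.weilToBar_actEven,
    WeilBar.weilToBar_actOdd⟩
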